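/- Let $n>1/4$ be a real number, $\alpha=\frac1{2n+2}$, and $\phi_1(\xi)=|\xi|\sqrt{1+|\xi|^2}$ for $\xi\in\mathbb R^5$. Write $\widehat f(\xi)=\int_{\mathbb R^5}e^{-ix\cdot\xi}f(x)\,dx$ and $\langle f,g\rangle=\Re\int_{\mathbb R^5}\overline f\,g$. Let $\mathcal P_n$ be the set of real potentials $W\in L^1(\mathbb R^5)$ of the form $W=(-\Delta)^nV$, i.e. $\widehat W(\xi)=|\xi|^{2n}\widehat V(\xi)$, with $V\in L^1(\mathbb R^5)$ real, $|\widehat V(0)|=1$ and $$\|W\|'=\|W\|_{\mathbf W^{4,1}}+\big\|(1+|x|^4)V\big\|_{H^{4n+4}}+\|W\|_{H^4}<\infty .$$ Let $X$ be a $C^2$ curve in $\mathbb R^5$ on $[0,T]$ with $\dot X=P$. For $\rho_0>0$, $\epsilon>0$ and $t\in[0,T]$ let $R_3=R_3(t)\in\mathbb R^5$ be the vector with components ($1\le j\le5$) $$R_{3,j}=-\frac{\rho_0}{2(2\pi)^5}\Big\langle i\xi_j\widehat W,\ \frac{\widehat W|\xi|}{i\sqrt{1+|\xi|^2}}D_1^3-\frac{\widehat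 W|\xi|}{i\sqrt{1+|\xi|^2}}D_2^3\Big\rangle ,$$ where $D_1^3$ (upper signs) and $D_2^3$ (lower signs) are $$\frac{e^{\pm it\phi_1(\xi)+i(X(t)-X(0))\cdot\xi}}{\pm i\phi_1(\xi)+iP(t)\cdot\xi-\epsilon}\; i\int_0^t\int_0^s\dot P(s)\cdot\xi\; e^{\mp i\tau\phi_1(\xi)-i(X(\tau)-X(0))\cdot\xi}\,d\tau\,ds .$$ For every $M>0$ there is a constant $C(M)>0$, depending only on $M$ and $n$, such that the following holds for all $\rho_0>0$, $W\in\mathcal P_n$, $T$, all such curves $X$ on $[0,T]$, and all $\epsilon>0$. If the bootstrap assumptions $$\max_{0\le t\le T}(1+t)^{1+\alpha}|\dot P(t)|\le M^{3+2n},\qquad \max_{0\le t\le T}(1+t)^{\alpha}\,(|P(t)|-1)\,1_{\{|P(t)|>1\}}\le M$$ hold, then for every $t\in[0,T]$ the integrals over $\xi$ defining $R_3(t)$ converge absolutely and $$|R_3(t)|\le\rho_0\,\frac{C(M)\,(\|W\|')^2}{(1+t)^{1+\alpha}} .$$ -/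

import Mathlib

open MeasureTheory
open scoped ENNReal ContDiff FourierTransform

noncomputable section

namespace BoseGas

/-- Euclidean space of dimension five. -/
abbrev E5 : Type := EuclideanSpace ℝ (Fin 5)

/-- The Fourier transform of an integrable real function, with the convention
`f̂ ξ = ∫ exp (-i x · ξ) f x dx`. -/
def paperFourier (f : E5 → ℝ) (ξ : E5) : ℂ :=
  ∫ x : E5, Complex.exp (-(Complex.I * ((inner ℝ x ξ : ℝ) : ℂ))) * (f x : ℂ)

/-- `g` is the weak (distributional) derivative `∂_{i 0} ⋯ ∂_{i (m - 1)} f`. -/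
def IsWeakPartial {m : ℕ} (i : Fin m → Fin 5) (f g : E5 → ℝ) : Prop :=
  LocallyIntegrable f volume ∧ LocallyIntegrable g volume ∧
    ∀ φ : E5 → ℝ, ContDiff ℝ ∞ φ → HasCompactSupport φ →
      ∫ x, f x * iteratedFDeriv ℝ m φ x (fun k => EuclideanSpace.single (i k) (1 : ℝ))
        = (-1) ^ m * ∫ x, g x * φ x

/-- The norm of the Sobolev space `W^{k,1}`: the sum of the `L¹` norms of all iterated weak
partial derivatives of order at most `k`. An infimum is used only to pick the weak derivative,
which is unique almost everywhere; the value is `∞` when one of them does not exist. -/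
def sobolevW1Norm (k : ℕ) (f : E5 → ℝ) : ℝ≥0∞ :=
  ∑ m ∈ Finset.range (k + 1), ∑ i : Fin m → Fin 5,
    ⨅ (g : E5 → ℝ) (_ : IsWeakPartial i f g), eLpNorm g 1 volume

/-- The norm `‖(1 - Δ)^{s/2} f‖_{L²}` of the Sobolev space `H^s`, for `s ≥ 0`, through the `L²`
Fourier transform of Mathlib (whose frequency variable is `ξ / 2π`). The infimum is over a
proposition: the value is `∞` when `f` is not in `L²`. -/
def sobolevHNorm (s : ℝ) (f : E5 → ℝ) : ℝ≥0∞ :=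
  ⨅ h : MemLp (fun x => (f x : ℂ)) 2 (volume : Measure E5),
    eLpNorm (fun ξ : E5 =>
      (((1 + (2 * Real.pi * ‖ξ‖) ^ 2) ^ (s / 2) : ℝ) : ℂ) *
        (𝓕 (h.toLp (fun x => (f x : ℂ))) : Lp ℂ 2 (volume : Measure E5)) ξ) 2 volume

/-- `W = (-Δ)^n V` for a real exponent `n`, as a Fourier multiplier. -/
def IsFracLaplacian (n : ℝ) (V W : E5 → ℝ) : Prop :=
  Integrable V volume ∧ Integrable W volume ∧
    ∀ ξ : E5, paperFourier W ξ = ((‖ξ‖ ^ (2 * n) : ℝ) : ℂ) * paperFourier V ξ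

/-- The norm `‖W‖' = ‖W‖_{W^{4,1}} + ‖(1 + |x|⁴) V‖_{H^{4n+4}} + ‖W‖_{H⁴}` of a potential
`W = (-Δ)^n V`; `V` is determined by `W` almost everywhere. -/
def potentialNorm (n : ℝ) (V W : E5 → ℝ) : ℝ≥0∞ :=
  sobolevW1Norm 4 W + sobolevHNorm (4 * n + 4) (fun x => (1 + ‖x‖ ^ 4) * V x) +
    sobolevHNorm 4 W

/-- `W` belongs to the class of potentials `𝒫_n`, with `V` the function such that
`W = (-Δ)^n V`. -/
structure IsPotential (n : ℝ) (V W : E5 → ℝ) : Prop where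
  eq_fracLaplacian : IsFracLaplacian n V W
  normalized : ‖paperFourier V 0‖ = 1
  norm_lt_top : potentialNorm n V W < ⊤

/-- A trajectory on `[0, T]`: position `X`, velocity `P` and acceleration `A`, with `X' = P`,
`P' = A` (one-sided derivatives at the endpoints) and `A` continuous. -/
structure IsTrajectory (T : ℝ) (X P A : ℝ → E5) : Prop where
  deriv_position : ∀ t ∈ Set.Icc 0 T, HasDerivWithinAt X (P t) (Set.Icc 0 T) t
  deriv_velocity : ∀ t ∈ Set.Icc 0 T, HasDerivWithinAt P (A t) (Set.Icc 0 T) t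
  continuous_acceleration : ContinuousOn A (Set.Icc 0 T)

/-- The decay exponent `α = 1 / (2n + 2)`. -/
def decayExp (n : ℝ) : ℝ := 1 / (2 * n + 2)

/-- The two bootstrap assumptions on `[0, T]`. -/
structure Bootstrap (n M T : ℝ) (P A : ℝ → E5) : Prop where
  acceleration : ∀ t ∈ Set.Icc 0 T,
    (1 + t) ^ (1 + decayExp n) * ‖A t‖ ≤ M ^ (3 + 2 * n)
  velocity : ∀ t ∈ Set.Icc 0 T,
    (1 + t) ^ decayExp n * Set.indicator {p : E5 | 1 < ‖p‖} (fun p => ‖p‖ - 1) (P t) ≤ M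

/-- The dispersion relation `φ₁(ξ) = |ξ| √(1 + |ξ|²)`. -/
def phi1 (ξ : E5) : ℝ := ‖ξ‖ * √(1 + ‖ξ‖ ^ 2)

/-- For `θ = 1` and `θ = -1` these are the two factors `D₁³` and `D₂³`:
`exp (iθtφ₁ + i(X(t) - X(0))·ξ) / (iθφ₁ + iP(t)·ξ - ε)
  * i ∫₀ᵗ ∫₀ˢ P'(s)·ξ exp (-iθτφ₁ - i(X(τ) - X(0))·ξ) dτ ds`. -/
def factorD (θ : ℝ) (X P A : ℝ → E5) (ε t : ℝ) (ξ : E5) : ℂ :=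
  Complex.exp (Complex.I * ((θ * t * phi1 ξ + inner ℝ (X t - X 0) ξ : ℝ) : ℂ)) /
      (Complex.I * ((θ * phi1 ξ + inner ℝ (P t) ξ : ℝ) : ℂ) - (ε : ℂ)) *
    (Complex.I * ∫ s in (0 : ℝ)..t, ∫ τ in (0 : ℝ)..s,
      ((inner ℝ (A s) ξ : ℝ) : ℂ) *
        Complex.exp (-(Complex.I * ((θ * τ * phi1 ξ + inner ℝ (X τ - X 0) ξ : ℝ) : ℂ))))

/-- The integrand (in `ξ`) of the inner product
`⟨i ξ_j Ŵ, Ŵ |ξ| / (i √(1 + |ξ|²)) D₁³ - Ŵ |ξ| / (i √(1 + |ξ|²)) D₂³⟩`. -/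
def integrandR3 (W : E5 → ℝ) (X P A : ℝ → E5) (ε t : ℝ) (j : Fin 5) (ξ : E5) : ℂ :=
  (starRingEnd ℂ) (Complex.I * ((ξ j : ℝ) : ℂ) * paperFourier W ξ) *
    (paperFourier W ξ * (‖ξ‖ : ℂ) / (Complex.I * ((√(1 + ‖ξ‖ ^ 2) : ℝ) : ℂ)) *
        factorD 1 X P A ε t ξ -
      paperFourier W ξ * (‖ξ‖ : ℂ) / (Complex.I * ((√(1 + ‖ξ‖ ^ 2) : ℝ) : ℂ)) *
        factorD (-1) X P A ε t ξ)

/-- The remainder `R₃(t) ∈ ℝ⁵`. -/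
def R3 (ρ₀ : ℝ) (W : E5 → ℝ) (X P A : ℝ → E5) (ε t : ℝ) : E5 :=
  WithLp.toLp 2 fun j : Fin 5 =>
    -(ρ₀ / (2 * (2 * Real.pi) ^ 5)) * (∫ ξ : E5, integrandR3 W X P A ε t j ξ).re

end BoseGas

end

/-! The denominators in `R₃` are Laplace transforms: with `β = ±iφ₁ + iP(t)·ξ - ε`, one has `1/β =
-∫₀^∞ e^{βu} du`. By Fubini, each half of a component of `R₃` is, up to a constant, an integral over
`0 < τ ≤ s ≤ t` and `u > 0` of `e^{-εu}` times the kernel `∫ |Ŵ|² |ξ|⟨ξ⟩⁻¹ ξ_j (P'(s)·ξ) e^{i(±Lφ₁ +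
z·ξ)} dξ`, where `L = t + u - τ` and `z = X(t) - X(τ) + uP(t)` (`integral_potWeight_mul_factorD`).
Only `e^{-εu} ≤ 1` enters the final estimate, so it is uniform in `ε`.

The kernel is small unless `z` outruns the waves. The group velocity satisfies `φ' ≥ 1 + (3/2)
r²/⟨r⟩`, so if `|z| ≤ L(1 + δ)` the phase can be stationary only for `r ≲ √δ`, where the factor
`|Ŵ|² = |ξ|^{4n}|V̂|²` is small. For a purely radial weight `r^(4n+1)⟨r⟩^(-q)` this gives the bound
`L⁻² min(1, δ)^(2n+3) + L^(-7/2)` (`exists_quadKernel_le`). If `|z| ≤ L/2`, four radial integrations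
by parts suffice. Otherwise the angular integral is computed first; in dimension five it is
elementary, starts at order `(ρr)⁻²` with `ρ = |z|`, and leaves one-dimensional integrals over `r`.

The function `V̂` is not smooth enough for integration by parts. Instead, products of `N` symbols
`1` or `iξ_i`, with `N ≤ 4n + 4`, times `V̂` are Fourier transforms of functions `F` with `(1 +
|x|)^(7/5) F` integrable (`exists_weighted_word`). Their squared moduli sum to `⟨ξ⟩^(2N)|V̂|²`, so
the kernel of the potential is a superposition of radial kernels evaluated at `z - x + y`. The
displacement costs `((|x| + |y|)/L)^(7/5)`, which the weight on `F` absorbs, and the error term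
becomes `L^(-17/5)` (`exists_norm_potKernel_le`).

The bootstrap assumptions give `δ ≲ L^(-α) + (1 + t)^(-α) 1_{u > t}`. Since `α(2n + 3) = 1 + α`, the
main term of the kernel is of order `L^(-(3+α))`, apart from a harmless contribution of `u > t`, and
`17/5 > 3 + α` because `n > 1/4` (`exists_sonicRate_le_timeRate`). Integration in `u` and then in
`τ` leaves `(1 + t - s)^(-(1+α))`, whose convolution with the decay `(1 + s)^(-(1+α))` of the
acceleration decays at that same rate (`norm_integral_timeMeasure_le`). -/

namespace BoseGas

/-! ### Symbol classes on half-lines -/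

/-- The bracket `⟨r⟩ = √(1 + r²)`. -/
noncomputable def bracket (r : ℝ) : ℝ := √(1 + r ^ 2)

lemma bracket_pos (r : ℝ) : 0 < bracket r := Real.sqrt_pos.2 (by positivity)

lemma bracket_sq (r : ℝ) : bracket r ^ 2 = 1 + r ^ 2 := Real.sq_sqrt (by positivity)

lemma one_le_bracket (r : ℝ) : 1 ≤ bracket r := Real.one_le_sqrt.2 (by nlinarith)

lemma le_bracket (r : ℝ) : r ≤ bracket r := Real.le_sqrt_of_sq_le (by linarith)

lemma continuous_bracket : Continuous bracket := by unfold bracket; fun_prop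

lemma hasDerivAt_bracket (r : ℝ) : HasDerivAt bracket (r / bracket r) r := by
  have h1 : HasDerivAt (fun x : ℝ => 1 + x ^ 2) (2 * r) r := by
    simpa using ((hasDerivAt_pow 2 r).const_add 1)
  have h2 := h1.sqrt (by positivity)
  convert! h2 using 1
  unfold bracket
  field_simp

/-- Functions on `[r₀, ∞)` that obey, together with their first `K` derivatives, the estimates
`|h⁽ᵏ⁾(r)| ≤ C r^(p - k) ⟨r⟩^q`. -/
def SymbolOn (r₀ : ℝ) : ℕ → ℝ → ℝ → ℝ → (ℝ → ℝ) → Prop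
  | 0, p, q, C, h => ContinuousOn h (Set.Ici r₀) ∧
      ∀ r, r₀ ≤ r → |h r| ≤ C * (r ^ p * bracket r ^ q)
  | K + 1, p, q, C, h => (∀ r, r₀ ≤ r → |h r| ≤ C * (r ^ p * bracket r ^ q)) ∧
      ∃ h' : ℝ → ℝ, (∀ r, r₀ ≤ r → HasDerivAt h (h' r) r) ∧ SymbolOn r₀ K (p - 1) q C h'

namespace SymbolOn

variable {r₀ : ℝ} {K : ℕ} {p q C p' q' C' : ℝ} {h g : ℝ → ℝ}

lemma bound (hh : SymbolOn r₀ K p q C h) : ∀ r, r₀ ≤ r → |h r| ≤ C * (r ^ p * bracket r ^ q) := by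
  cases K with
  | zero => exact hh.2
  | succ K => exact hh.1

lemma continuousOn (hh : SymbolOn r₀ K p q C h) : ContinuousOn h (Set.Ici r₀) := by
  cases K with
  | zero => exact hh.1
  | succ K =>
    obtain ⟨_, h', hd, _⟩ := hh
    exact fun r hr => (hd r hr).continuousAt.continuousWithinAt

lemma weight_nonneg {r p q : ℝ} (hr : 0 < r) : 0 ≤ r ^ p * bracket r ^ q :=
  mul_nonneg (Real.rpow_nonneg hr.le _) (Real.rpow_nonneg (bracket_pos r).le _)

lemma mono_const (hr : 0 < r₀) (hC : C ≤ C') (hh : SymbolOn r₀ K p q C h) :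
    SymbolOn r₀ K p q C' h := by
  induction K generalizing p h with
  | zero =>
    exact ⟨hh.1, fun r hr' => (hh.2 r hr').trans
      (mul_le_mul_of_nonneg_right hC (weight_nonneg (hr.trans_le hr')))⟩
  | succ K ih =>
    obtain ⟨hb, h', hd, hs⟩ := hh
    exact ⟨fun r hr' => (hb r hr').trans
      (mul_le_mul_of_nonneg_right hC (weight_nonneg (hr.trans_le hr'))), h', hd, ih hs⟩

lemma of_succ (hh : SymbolOn r₀ (K + 1) p q C h) : SymbolOn r₀ K p q C h := by
  induction K generalizing p h with
  | zero => exact ⟨hh.continuousOn, hh.bound⟩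
  | succ K ih =>
    obtain ⟨hb, h', hd, hs⟩ := hh
    exact ⟨hb, h', hd, ih hs⟩

lemma const_nonneg (hr : 0 < r₀) (hh : SymbolOn r₀ K p q C h) : 0 ≤ C := by
  have h1 := (abs_nonneg _).trans (hh.bound r₀ le_rfl)
  have h2 : 0 < r₀ ^ p * bracket r₀ ^ q :=
    mul_pos (Real.rpow_pos_of_pos hr _) (Real.rpow_pos_of_pos (bracket_pos _) _)
  by_contra hC
  push Not at hC
  nlinarith [mul_neg_of_neg_of_pos hC h2]

lemma add (hh : SymbolOn r₀ K p q C h) (hg : SymbolOn r₀ K p q C' g) :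
    SymbolOn r₀ K p q (C + C') (fun r => h r + g r) := by
  have key : ∀ {p : ℝ} {h g : ℝ → ℝ}, SymbolOn r₀ K p q C h → SymbolOn r₀ K p q C' g →
      ∀ r, r₀ ≤ r → |h r + g r| ≤ (C + C') * (r ^ p * bracket r ^ q) := by
    intro p h g hh hg r hr
    have := abs_add_le (h r) (g r)
    have := hh.bound r hr
    have := hg.bound r hr
    linarith
  induction K generalizing p h g with
  | zero => exact ⟨hh.1.add hg.1, key hh hg⟩
  | succ K ih =>
    refine ⟨key hh hg, ?_⟩
    obtain ⟨_, h', hd, hs⟩ := hh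
    obtain ⟨_, g', gd, gs⟩ := hg
    refine ⟨fun r => h' r + g' r, fun r hr => (hd r hr).add (gd r hr), ih hs gs ?_⟩
    intro p h g hh hg r hr
    have := abs_add_le (h r) (g r)
    have := hh.bound r hr
    have := hg.bound r hr
    linarith

lemma const_mul (c : ℝ) (hh : SymbolOn r₀ K p q C h) :
    SymbolOn r₀ K p q (|c| * C) (fun r => c * h r) := by
  induction K generalizing p h with
  | zero =>
    refine ⟨hh.1.const_mul c |>.congr fun r _ => rfl, fun r hr => ?_⟩
    rw [abs_mul, mul_assoc]
    exact mul_le_mul_of_nonneg_left (hh.2 r hr) (abs_nonneg c)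
  | succ K ih =>
    obtain ⟨hb, h', hd, hs⟩ := hh
    refine ⟨fun r hr => ?_, fun r => c * h' r, fun r hr => (hd r hr).const_mul c, ih hs⟩
    rw [abs_mul, mul_assoc]
    exact mul_le_mul_of_nonneg_left (hb r hr) (abs_nonneg c)

lemma congr_exp (hh : SymbolOn r₀ K p q C h) (hp : p = p') (hq : q = q') :
    SymbolOn r₀ K p' q' C h := hp ▸ hq ▸ hh

lemma mul (hr : 0 < r₀) (hh : SymbolOn r₀ K p q C h) (hg : SymbolOn r₀ K p' q' C' g) :
    SymbolOn r₀ K (p + p') (q + q') (2 ^ K * (C * C')) (fun r => h r * g r) := by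
  have key : ∀ {K : ℕ} {p p' : ℝ} {h g : ℝ → ℝ}, SymbolOn r₀ K p q C h →
      SymbolOn r₀ K p' q' C' g →
      ∀ r, r₀ ≤ r → |h r * g r| ≤ 2 ^ K * (C * C') * (r ^ (p + p') * bracket r ^ (q + q')) := by
    intro K p p' h g hh hg r hr'
    have hr0 := hr.trans_le hr'
    have h1 := mul_le_mul (hh.bound r hr') (hg.bound r hr') (abs_nonneg _)
      (mul_nonneg (hh.const_nonneg hr) (weight_nonneg hr0))
    rw [abs_mul, Real.rpow_add hr0, Real.rpow_add (bracket_pos r)]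
    have h2 : (1 : ℝ) ≤ 2 ^ K := one_le_pow₀ (by norm_num)
    have h3 : 0 ≤ C * (r ^ p * bracket r ^ q) * (C' * (r ^ p' * bracket r ^ q')) :=
      mul_nonneg (mul_nonneg (hh.const_nonneg hr) (weight_nonneg hr0))
        (mul_nonneg (hg.const_nonneg hr) (weight_nonneg hr0))
    calc _ ≤ _ := h1
      _ ≤ 2 ^ K * (C * (r ^ p * bracket r ^ q) * (C' * (r ^ p' * bracket r ^ q'))) :=
        le_mul_of_one_le_left h3 h2
      _ = _ := by ring
  induction K generalizing p p' h g with
  | zero => exact ⟨hh.1.mul hg.1, key hh hg⟩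
  | succ K ih =>
    refine ⟨key hh hg, ?_⟩
    obtain ⟨_, h', hd, hs⟩ := id hh
    obtain ⟨_, g', gd, gs⟩ := id hg
    refine ⟨fun r => h' r * g r + h r * g' r, fun r hr => (hd r hr).mul (gd r hr), ?_⟩
    have e1 := (ih hs hg.of_succ).congr_exp (p' := p + p' - 1) (by ring) rfl
    have e2 := (ih hh.of_succ gs).congr_exp (p' := p + p' - 1) (by ring) rfl
    exact (e1.add e2).mono_const hr (le_of_eq (by ring))

/-- Since `r ≤ ⟨r⟩`, a power of `r` can be exchanged for the same power of `⟨r⟩`. This gives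
derivatives that vanish faster than required at the origin the weights expected by the class. -/
lemma weaken (hr : 0 < r₀) {s : ℝ} (hs : 0 ≤ s) (hh : SymbolOn r₀ K (p + s) (q - s) C h) :
    SymbolOn r₀ K p q C h := by
  have key : ∀ {K : ℕ} {p : ℝ} {h : ℝ → ℝ}, SymbolOn r₀ K (p + s) (q - s) C h →
      ∀ r, r₀ ≤ r → |h r| ≤ C * (r ^ p * bracket r ^ q) := by
    intro K p h hh r hr'
    have hr0 := hr.trans_le hr'
    refine (hh.bound r hr').trans (mul_le_mul_of_nonneg_left ?_ (hh.const_nonneg hr))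
    rw [Real.rpow_add hr0, Real.rpow_sub (bracket_pos r)]
    have h1 : r ^ s ≤ bracket r ^ s := Real.rpow_le_rpow hr0.le (le_bracket r) hs
    have h2 : 0 < bracket r ^ s := Real.rpow_pos_of_pos (bracket_pos r) s
    calc r ^ p * r ^ s * (bracket r ^ q / bracket r ^ s)
        = r ^ p * bracket r ^ q * (r ^ s / bracket r ^ s) := by ring
      _ ≤ r ^ p * bracket r ^ q * 1 :=
        mul_le_mul_of_nonneg_left ((div_le_one h2).2 h1) (weight_nonneg hr0)
      _ = _ := mul_one _
  induction K generalizing p h with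
  | zero => exact ⟨hh.1, key hh⟩
  | succ K ih =>
    refine ⟨key hh, ?_⟩
    obtain ⟨_, h', hd, hs⟩ := hh
    exact ⟨h', hd, ih (hs.congr_exp (by ring) rfl)⟩

/-- Reciprocals of functions bounded below. -/
lemma exists_inv (K : ℕ) (a b c B : ℝ) (hc : 0 < c) : ∃ C, ∀ (r₀ : ℝ), 0 < r₀ →
    ∀ χ χ' : ℝ → ℝ, (∀ r, r₀ ≤ r → HasDerivAt χ (χ' r) r) → SymbolOn r₀ K (a - 1) b B χ' →
    (∀ r, r₀ ≤ r → c * (r ^ a * bracket r ^ b) ≤ χ r) →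
    SymbolOn r₀ K (-a) (-b) C (fun r => (χ r)⁻¹) := by
  have key : ∀ (r₀ : ℝ), 0 < r₀ → ∀ χ : ℝ → ℝ,
      (∀ r, r₀ ≤ r → c * (r ^ a * bracket r ^ b) ≤ χ r) →
      ∀ r, r₀ ≤ r → 0 < χ r ∧ |(χ r)⁻¹| ≤ c⁻¹ * (r ^ (-a) * bracket r ^ (-b)) := by
    intro r₀ hr χ hχ r hr'
    have hr0 := hr.trans_le hr'
    have hp : 0 < c * (r ^ a * bracket r ^ b) := mul_pos hc
      (mul_pos (Real.rpow_pos_of_pos hr0 _) (Real.rpow_pos_of_pos (bracket_pos _) _))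
    have hp' := hp.trans_le (hχ r hr')
    refine ⟨hp', ?_⟩
    rw [abs_of_pos (inv_pos.2 hp'), Real.rpow_neg hr0.le, Real.rpow_neg (bracket_pos r).le,
      ← mul_inv, ← mul_inv]
    exact inv_anti₀ hp (hχ r hr')
  induction K with
  | zero =>
    refine ⟨c⁻¹, fun r₀ hr χ χ' hd hs hχ => ⟨fun r hr' => ?_, fun r hr' => (key r₀ hr χ hχ r hr').2⟩⟩
    exact ((hd r hr').continuousAt.inv₀ (key r₀ hr χ hχ r hr').1.ne').continuousWithinAt
  | succ K ih =>
    obtain ⟨C, hC⟩ := ih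
    -- The derivative is `-χ' · χ⁻¹ · χ⁻¹`, to which the product rule and the induction hypothesis
    -- apply; the exponents add up to `(a - 1) - 2a = -a - 1`.
    refine ⟨max c⁻¹ (|(-1)| * (2 ^ K * (B * (2 ^ K * (C * C))))), fun r₀ hr χ χ' hd hs hχ => ?_⟩
    have hi := hC r₀ hr χ χ' hd hs.of_succ hχ
    refine ⟨fun r hr' => ((key r₀ hr χ hχ r hr').2).trans (mul_le_mul_of_nonneg_right
      (le_max_left _ _) (weight_nonneg (hr.trans_le hr'))),
      fun r => -1 * (χ' r * ((χ r)⁻¹ * (χ r)⁻¹)), fun r hr' => ?_, ?_⟩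
    · have hne := (key r₀ hr χ hχ r hr').1.ne'
      convert! (hd r hr').inv hne using 1
      field_simp
    · have h1 := ((hs.of_succ.mul hr (hi.mul hr hi)).const_mul (-1)).mono_const hr
        (le_max_right c⁻¹ _)
      exact h1.congr_exp (by ring) (by ring)

lemma exists_rpow (K : ℕ) (p : ℝ) : ∃ C, ∀ r₀, 0 < r₀ → SymbolOn r₀ K p 0 C (fun r => r ^ p) := by
  have hb : ∀ {r p : ℝ}, 0 < r → |r ^ p| ≤ 1 * (r ^ p * bracket r ^ (0 : ℝ)) := by
    intro r p hr
    rw [Real.rpow_zero, mul_one, one_mul, abs_of_nonneg (Real.rpow_nonneg hr.le _)]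
  induction K generalizing p with
  | zero =>
    refine ⟨1, fun r₀ hr => ⟨fun r hr' => ?_, fun r hr' => hb (hr.trans_le hr')⟩⟩
    exact (Real.continuousAt_rpow_const _ _ (Or.inl (hr.trans_le hr').ne')).continuousWithinAt
  | succ K ih =>
    obtain ⟨C, hC⟩ := ih (p - 1)
    refine ⟨max 1 (|p| * C), fun r₀ hr => ⟨fun r hr' => (hb (hr.trans_le hr')).trans
      (mul_le_mul_of_nonneg_right (le_max_left _ _) (weight_nonneg (hr.trans_le hr'))),
      fun r => p * r ^ (p - 1), fun r hr' =>
        Real.hasDerivAt_rpow_const (Or.inl (hr.trans_le hr').ne'), ?_⟩⟩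
    exact ((hC r₀ hr).const_mul p).mono_const hr (le_max_right _ _)

lemma exists_bracket_rpow (K : ℕ) (q : ℝ) :
    ∃ C, ∀ r₀, 0 < r₀ → SymbolOn r₀ K 0 q C (fun r => bracket r ^ q) := by
  have hb : ∀ {r q : ℝ}, |bracket r ^ q| ≤ 1 * (r ^ (0 : ℝ) * bracket r ^ q) := by
    intro r q
    rw [Real.rpow_zero, one_mul, one_mul, abs_of_nonneg (Real.rpow_nonneg (bracket_pos r).le _)]
  induction K generalizing q with
  | zero =>
    refine ⟨1, fun r₀ hr => ⟨Continuous.continuousOn ?_, fun r hr' => hb⟩⟩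
    exact continuous_bracket.rpow_const fun r => Or.inl (bracket_pos r).ne'
  | succ K ih =>
    obtain ⟨C, hC⟩ := ih (q - 2)
    obtain ⟨D, hD⟩ := exists_rpow K 1
    refine ⟨max 1 (|q| * (2 ^ K * (D * C))), fun r₀ hr => ⟨fun r hr' => hb.trans
      (mul_le_mul_of_nonneg_right (le_max_left _ _) (weight_nonneg (hr.trans_le hr'))),
      fun r => q * (r ^ (1 : ℝ) * bracket r ^ (q - 2)), fun r hr' => ?_, ?_⟩⟩
    · convert! (hasDerivAt_bracket r).rpow_const (p := q) (Or.inl (bracket_pos r).ne') using 1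
      simp only [Real.rpow_one, Real.rpow_sub (bracket_pos r), Real.rpow_two]
      field_simp
    · have h1 := (((hD r₀ hr).mul hr (hC r₀ hr)).const_mul q).mono_const hr (le_max_right 1 _)
      -- The derivative `q r ⟨r⟩^(q-2)` is better by `r²/⟨r⟩² ≤ 1` than the class demands.
      exact (h1.congr_exp (p' := (0 - 1 + 2)) (q' := q - 2) (by ring) (by ring)).weaken hr
        (by norm_num)

lemma exists_rpow_mul_bracket (K : ℕ) (p q : ℝ) : ∃ C, ∀ r₀, 0 < r₀ →
    SymbolOn r₀ K p q C (fun r => r ^ p * bracket r ^ q) := by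
  obtain ⟨C, hC⟩ := exists_rpow K p
  obtain ⟨D, hD⟩ := exists_bracket_rpow K q
  exact ⟨_, fun r₀ hr => ((hC r₀ hr).mul hr (hD r₀ hr)).congr_exp (add_zero p) (zero_add q)⟩

end SymbolOn


/-! ### Integrals of symbols -/

/-- Used at large `r`, where `⟨r⁻¹⟩` stays between `1` and a constant: there `⟨r⟩^q` may be replaced
by `r^q`, up to a constant, whatever the sign of `q`. -/
lemma bracket_eq_mul {r : ℝ} (hr : 0 < r) : bracket r = r * bracket r⁻¹ := by
  unfold bracket
  rw [show 1 + r ^ 2 = r ^ 2 * (1 + r⁻¹ ^ 2) by field_simp; ring, Real.sqrt_mul (by positivity),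
    Real.sqrt_sq hr.le]

lemma bracket_mono {r s : ℝ} (hr : 0 ≤ r) (h : r ≤ s) : bracket r ≤ bracket s :=
  Real.sqrt_le_sqrt (by gcongr)

lemma bracket_rpow_le {r s : ℝ} (q : ℝ) (hr : 0 ≤ r) (h : r ≤ s) :
    bracket r ^ q ≤ bracket s ^ |q| :=
  (Real.rpow_le_rpow_of_exponent_le (one_le_bracket r) (le_abs_self q)).trans
    (Real.rpow_le_rpow (bracket_pos r).le (bracket_mono hr h) (abs_nonneg q))

lemma continuousOn_rpow_mul_bracket (p q : ℝ) :
    ContinuousOn (fun r => r ^ p * bracket r ^ q) (Set.Ioi 0) := by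
  intro r hr
  refine ContinuousAt.continuousWithinAt (ContinuousAt.mul ?_ ?_)
  · exact Real.continuousAt_rpow_const _ _ (Or.inl (ne_of_gt hr))
  · exact continuous_bracket.continuousAt.rpow_const (Or.inl (bracket_pos r).ne')

lemma integrableOn_Ioi_rpow_mul_bracket {p q r₀ : ℝ} (hr : 0 < r₀) (hpq : p + q < -1) :
    IntegrableOn (fun r => r ^ p * bracket r ^ q) (Set.Ioi r₀) := by
  have h1 := (integrableOn_Ioi_rpow_of_lt hpq hr).const_mul (bracket r₀⁻¹ ^ |q|)
  refine h1.mono' (((continuousOn_rpow_mul_bracket p q).mono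
    (Set.Ioi_subset_Ioi hr.le)).aestronglyMeasurable measurableSet_Ioi) ?_
  refine (ae_restrict_iff' measurableSet_Ioi).2 (Filter.Eventually.of_forall fun r hr' => ?_)
  have hr0 : 0 < r := hr.trans hr'
  rw [Real.norm_of_nonneg (SymbolOn.weight_nonneg hr0), bracket_eq_mul hr0,
    Real.mul_rpow hr0.le (bracket_pos _).le, Real.rpow_add hr0]
  have h2 := bracket_rpow_le q (inv_nonneg.2 hr0.le) (inv_anti₀ hr (le_of_lt hr'))
  have h3 : 0 ≤ r ^ p * r ^ q := mul_nonneg (Real.rpow_nonneg hr0.le _) (Real.rpow_nonneg hr0.le _)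
  calc _ = bracket r⁻¹ ^ q * (r ^ p * r ^ q) := by ring
    _ ≤ _ := mul_le_mul_of_nonneg_right h2 h3

lemma integrableOn_Ioi_zero_rpow_mul_bracket {p q : ℝ} (hp : -1 < p) (hpq : p + q < -1) :
    IntegrableOn (fun r => r ^ p * bracket r ^ q) (Set.Ioi 0) := by
  rw [← Set.Ioc_union_Ioi_eq_Ioi (zero_le_one (α := ℝ))]
  refine IntegrableOn.union ?_ (integrableOn_Ioi_rpow_mul_bracket one_pos hpq)
  have h1 : IntegrableOn (fun r : ℝ => r ^ p) (Set.Ioc 0 1) :=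
    (intervalIntegrable_iff_integrableOn_Ioc_of_le zero_le_one).1
      (intervalIntegral.intervalIntegrable_rpow' hp)
  refine (h1.const_mul (bracket 1 ^ |q|)).mono' (((continuousOn_rpow_mul_bracket p q).mono
    Set.Ioc_subset_Ioi_self).aestronglyMeasurable measurableSet_Ioc) ?_
  refine (ae_restrict_iff' measurableSet_Ioc).2 (Filter.Eventually.of_forall fun r hr' => ?_)
  rw [Real.norm_of_nonneg (SymbolOn.weight_nonneg hr'.1), mul_comm]
  exact mul_le_mul_of_nonneg_right (bracket_rpow_le q hr'.1.le hr'.2)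
    (Real.rpow_nonneg hr'.1.le _)

/-! ### Non-stationary phase on a half-line -/

/-- The oscillatory integral `∫_{r₀}^∞ h e^{iLψ}`. -/
noncomputable def oscInt (r₀ L : ℝ) (ψ h : ℝ → ℝ) : ℂ :=
  ∫ r in Set.Ioi r₀, (h r : ℂ) * Complex.exp (Complex.I * ((L * ψ r : ℝ) : ℂ))

/-- The bound for `oscInt` that `K` integrations by parts give when `ψ' ≳ r^a ⟨r⟩^b`. -/
noncomputable def ibpBound (r₀ L a b : ℝ) : ℕ → ℝ → ℝ → ℝ
  | 0, p, q => ∫ r in Set.Ioi r₀, r ^ p * bracket r ^ q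
  | K + 1, p, q =>
      L⁻¹ * (r₀ ^ (p - a) * bracket r₀ ^ (q - b) + ibpBound r₀ L a b K (p - a - 1) (q - b))

lemma norm_mul_exp_I (h x : ℝ) : ‖(h : ℂ) * Complex.exp (Complex.I * (x : ℂ))‖ = |h| := by
  rw [norm_mul, mul_comm Complex.I, Complex.norm_exp_ofReal_mul_I, mul_one, Complex.norm_real,
    Real.norm_eq_abs]

lemma SymbolOn.integrableOn {r₀ : ℝ} {K : ℕ} {p q C : ℝ} {h : ℝ → ℝ} (hr : 0 < r₀)
    (hpq : p + q < -1) (hh : SymbolOn r₀ K p q C h) {f : ℝ → ℝ} (hf : ContinuousOn f (Set.Ici r₀)) :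
    IntegrableOn (fun r => (h r : ℂ) * Complex.exp (Complex.I * (f r : ℂ))) (Set.Ioi r₀) := by
  refine ((integrableOn_Ioi_rpow_mul_bracket hr hpq).const_mul C).mono' ?_ ?_
  · refine ContinuousOn.aestronglyMeasurable ?_ measurableSet_Ioi
    have h1 := hh.continuousOn.mono Set.Ioi_subset_Ici_self
    have h2 := hf.mono Set.Ioi_subset_Ici_self
    exact (Complex.continuous_ofReal.comp_continuousOn h1).mul
      (Complex.continuous_exp.comp_continuousOn
        (continuousOn_const.mul (Complex.continuous_ofReal.comp_continuousOn h2)))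
  · refine (ae_restrict_iff' measurableSet_Ioi).2 (Filter.Eventually.of_forall fun r hr' => ?_)
    rw [norm_mul_exp_I]
    exact hh.bound r (le_of_lt hr')

lemma tendsto_rpow_mul_bracket {p q : ℝ} (hpq : p + q < 0) :
    Filter.Tendsto (fun r => r ^ p * bracket r ^ q) Filter.atTop (nhds 0) := by
  have h1 : Filter.Tendsto (fun r : ℝ => bracket 1 ^ |q| * r ^ (p + q)) Filter.atTop (nhds 0) := by
    have := (tendsto_rpow_neg_atTop (y := -(p + q)) (by linarith)).const_mul (bracket 1 ^ |q|)
    simpa using this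
  refine squeeze_zero' ?_ ?_ h1
  · filter_upwards [Filter.eventually_gt_atTop 0] with r hr using SymbolOn.weight_nonneg hr
  · filter_upwards [Filter.eventually_ge_atTop 1] with r hr
    have hr0 : 0 < r := by linarith
    rw [bracket_eq_mul hr0, Real.mul_rpow hr0.le (bracket_pos _).le, Real.rpow_add hr0]
    have h2 := bracket_rpow_le q (inv_nonneg.2 hr0.le) (inv_le_one_of_one_le₀ hr)
    have h3 : 0 ≤ r ^ p * r ^ q :=
      mul_nonneg (Real.rpow_nonneg hr0.le _) (Real.rpow_nonneg hr0.le _)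
    calc _ = bracket r⁻¹ ^ q * (r ^ p * r ^ q) := by ring
      _ ≤ _ := mul_le_mul_of_nonneg_right h2 h3

lemma ibpBound_nonneg {r₀ L : ℝ} (hr : 0 < r₀) (hL : 0 < L) (a b : ℝ) (K : ℕ) (p q : ℝ) :
    0 ≤ ibpBound r₀ L a b K p q := by
  induction K generalizing p q with
  | zero =>
    exact setIntegral_nonneg measurableSet_Ioi fun r hr' => SymbolOn.weight_nonneg (hr.trans hr')
  | succ K ih =>
    exact mul_nonneg (inv_nonneg.2 hL.le) (add_nonneg (SymbolOn.weight_nonneg hr) (ih _ _))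

/-- One integration by parts. -/
lemma norm_oscInt_le {r₀ L p q D : ℝ} {ψ χ u u' : ℝ → ℝ} (hr : 0 < r₀) (hL : 0 < L)
    (hψ : ∀ r, r₀ ≤ r → HasDerivAt ψ (χ r) r) (hu : ∀ r, r₀ ≤ r → HasDerivAt u (u' r) r)
    (hpq : p + q < 0) (hub : ∀ r, r₀ ≤ r → |u r| ≤ D * (r ^ p * bracket r ^ q))
    (hu' : SymbolOn r₀ 0 (p - 1) q D u')
    (hint : IntegrableOn (fun r => ((u r * χ r : ℝ) : ℂ) *
      Complex.exp (Complex.I * ((L * ψ r : ℝ) : ℂ))) (Set.Ioi r₀)) :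
    ‖oscInt r₀ L ψ (fun r => u r * χ r)‖ ≤ L⁻¹ * (|u r₀| + ‖oscInt r₀ L ψ u'‖) := by
  have hψc : ContinuousOn (fun r => L * ψ r) (Set.Ici r₀) := fun r hr' =>
    ((hψ r hr').continuousAt.const_mul L).continuousWithinAt
  have hd : ∀ r ∈ Set.Ici r₀, HasDerivAt
      (fun r => (u r : ℂ) * Complex.exp (Complex.I * ((L * ψ r : ℝ) : ℂ)))
      ((u' r : ℂ) * Complex.exp (Complex.I * ((L * ψ r : ℝ) : ℂ)) +
        Complex.I * L * (((u r * χ r : ℝ) : ℂ) *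
          Complex.exp (Complex.I * ((L * ψ r : ℝ) : ℂ)))) r := by
    intro r hr'
    have h1 := (hu r hr').ofReal_comp
    have h2 : HasDerivAt (fun r => Complex.exp (Complex.I * ((L * ψ r : ℝ) : ℂ)))
        (Complex.exp (Complex.I * ((L * ψ r : ℝ) : ℂ)) * (Complex.I * ((L * χ r : ℝ) : ℂ))) r :=
      ((((hψ r hr').const_mul L).ofReal_comp).const_mul Complex.I).cexp
    convert! h1.mul h2 using 1
    push_cast
    ring
  have hi1 := hu'.integrableOn hr (by linarith) hψc
  have hi2 := hint.const_mul (Complex.I * L)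
  have ht : Filter.Tendsto (fun r => (u r : ℂ) * Complex.exp (Complex.I * ((L * ψ r : ℝ) : ℂ)))
      Filter.atTop (nhds 0) := by
    rw [tendsto_zero_iff_norm_tendsto_zero]
    have := (tendsto_rpow_mul_bracket hpq).const_mul D
    rw [mul_zero] at this
    refine squeeze_zero' (Filter.Eventually.of_forall fun _ => norm_nonneg _) ?_ this
    filter_upwards [Filter.eventually_ge_atTop r₀] with r hr'
    rw [norm_mul_exp_I]
    exact hub r hr'
  have key := integral_Ioi_of_hasDerivAt_of_tendsto' hd (hi1.add hi2) ht
  rw [integral_add hi1 hi2, integral_const_mul, zero_sub] at key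
  have h3 : Complex.I * L * oscInt r₀ L ψ (fun r => u r * χ r) =
      -((u r₀ : ℂ) * Complex.exp (Complex.I * ((L * ψ r₀ : ℝ) : ℂ))) - oscInt r₀ L ψ u' := by
    unfold oscInt
    rw [← key]
    ring
  have h4 : L * ‖oscInt r₀ L ψ (fun r => u r * χ r)‖ ≤ |u r₀| + ‖oscInt r₀ L ψ u'‖ := by
    have h5 := congrArg norm h3
    rw [norm_mul, norm_mul, Complex.norm_I, one_mul, Complex.norm_real, Real.norm_of_nonneg hL.le]
      at h5
    rw [h5]
    refine (norm_sub_le _ _).trans ?_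
    rw [norm_neg, norm_mul_exp_I]
  rwa [inv_mul_eq_div, le_div_iff₀' hL]

/-- `K` integrations by parts. -/
lemma exists_norm_oscInt_le (K : ℕ) (a b c B : ℝ) (hab : 0 ≤ a + b) (hc : 0 < c) :
    ∃ C, 0 ≤ C ∧ ∀ (r₀ L : ℝ), 0 < r₀ → 0 < L → ∀ ψ χ χ' : ℝ → ℝ,
    (∀ r, r₀ ≤ r → HasDerivAt ψ (χ r) r) → (∀ r, r₀ ≤ r → HasDerivAt χ (χ' r) r) →
    SymbolOn r₀ K (a - 1) b B χ' → (∀ r, r₀ ≤ r → c * (r ^ a * bracket r ^ b) ≤ χ r) →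
    ∀ (p q D : ℝ) (h : ℝ → ℝ), p + q < -1 → SymbolOn r₀ K p q D h →
    ‖oscInt r₀ L ψ h‖ ≤ C * D * ibpBound r₀ L a b K p q := by
  induction K with
  | zero =>
    refine ⟨1, zero_le_one, fun r₀ L hr hL ψ χ χ' hψ hχ hs hlow p q D h hpq hh => ?_⟩
    rw [one_mul, ibpBound, ← integral_const_mul]
    refine norm_integral_le_of_norm_le
      ((integrableOn_Ioi_rpow_mul_bracket hr hpq).const_mul D) ?_
    refine (ae_restrict_iff' measurableSet_Ioi).2 (Filter.Eventually.of_forall fun r hr' => ?_)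
    rw [norm_mul_exp_I]
    exact hh.bound r (le_of_lt hr')
  | succ K ih =>
    obtain ⟨C, hC0, hC⟩ := ih
    -- One derivative of `u = h/χ` is spent now and `K` must remain for the induction, so `1/χ` is
    -- needed with `K + 1` derivatives.
    obtain ⟨E, hE⟩ := SymbolOn.exists_inv (K + 1) a b c B hc
    refine ⟨max 0 (2 ^ (K + 1) * E) * max 1 C, by positivity,
      fun r₀ L hr hL ψ χ χ' hψ hχ hs hlow p q D h hpq hh => ?_⟩
    have hinv := hE r₀ hr χ χ' hχ hs hlow
    have hu := (hh.mul hr hinv).mono_const (C' := max 0 (2 ^ (K + 1) * E) * D) hr (by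
      have := mul_le_mul_of_nonneg_right (le_max_right 0 (2 ^ (K + 1) * E)) (hh.const_nonneg hr)
      linarith)
    obtain ⟨hub, u', hud, hus⟩ := id hu
    have hD := hu.const_nonneg hr
    have hpos : ∀ r, r₀ ≤ r → χ r ≠ 0 := fun r hr' => by
      have : 0 < c * (r ^ a * bracket r ^ b) := mul_pos hc (mul_pos
        (Real.rpow_pos_of_pos (hr.trans_le hr') _) (Real.rpow_pos_of_pos (bracket_pos _) _))
      exact (this.trans_le (hlow r hr')).ne'
    have hψc : ContinuousOn (fun r => L * ψ r) (Set.Ici r₀) := fun r hr' =>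
      ((hψ r hr').continuousAt.const_mul L).continuousWithinAt
    have heq : ∀ r ∈ Set.Ioi r₀, h r * (χ r)⁻¹ * χ r = h r := fun r hr' =>
      inv_mul_cancel_right₀ (hpos r (le_of_lt hr')) _
    have hosc : oscInt r₀ L ψ h = oscInt r₀ L ψ (fun r => h r * (χ r)⁻¹ * χ r) :=
      setIntegral_congr_fun measurableSet_Ioi fun r hr' => by simp only [heq r hr']
    have hus0 : SymbolOn r₀ 0 (p + -a - 1) (q + -b) (max 0 (2 ^ (K + 1) * E) * D) u' :=
      -- Each integration by parts lowers `p + q` by `a + b + 1`; the assumption `0 ≤ a + b` keeps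
      -- every new integrand integrable at infinity.
      ⟨hus.continuousOn, hus.bound⟩
    have h1 := norm_oscInt_le hr hL hψ hud (by linarith) hub hus0
      ((hh.integrableOn hr hpq hψc).congr_fun
        (fun r hr' => by simp only [heq r hr']) measurableSet_Ioi)
    have h2 := hC r₀ L hr hL ψ χ χ' hψ hχ hs.of_succ hlow _ _ _ u' (by linarith) hus
    rw [hosc]
    refine h1.trans ?_
    rw [ibpBound]
    have h3 := hub r₀ le_rfl
    set W := r₀ ^ (p - a) * bracket r₀ ^ (q - b) with hW
    have hW0 : 0 ≤ W := SymbolOn.weight_nonneg hr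
    have hI : 0 ≤ ibpBound r₀ L a b K (p - a - 1) (q - b) := ibpBound_nonneg hr hL _ _ _ _ _
    rw [← sub_eq_add_neg, ← sub_eq_add_neg] at h2
    rw [← sub_eq_add_neg, ← sub_eq_add_neg, ← hW] at h3
    set G := max 0 (2 ^ (K + 1) * E) * D with hG
    set I := ibpBound r₀ L a b K (p - a - 1) (q - b)
    have e1 : G * W ≤ max 1 C * (G * W) := le_mul_of_one_le_left (by positivity) (le_max_left _ _)
    have e2 : C * G * I ≤ max 1 C * G * I := by
      gcongr
      exact le_max_right _ _
    calc L⁻¹ * (|h r₀ * (χ r₀)⁻¹| + ‖oscInt r₀ L ψ u'‖)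
        ≤ L⁻¹ * (G * W + C * G * I) := by gcongr
      _ ≤ L⁻¹ * (max 1 C * (G * W) + max 1 C * G * I) := by gcongr
      _ = _ := by rw [hG]; ring


/-! ### The radial oscillatory integrals -/

/-- The dispersion relation as a function of the radius. -/
noncomputable def disp (r : ℝ) : ℝ := r * bracket r

/-- The derivative of `disp`. -/
noncomputable def dispDeriv (r : ℝ) : ℝ := bracket r + r ^ 2 / bracket r

lemma phi1_eq_disp (ξ : E5) : phi1 ξ = disp ‖ξ‖ := rfl

lemma continuous_disp : Continuous disp := continuous_id.mul continuous_bracket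

lemma hasDerivAt_disp (r : ℝ) : HasDerivAt disp (dispDeriv r) r := by
  have h := (hasDerivAt_id r).mul (hasDerivAt_bracket r)
  convert! h using 1
  simp only [dispDeriv, id]
  ring

lemma hasDerivAt_disp_add_mul (c r : ℝ) :
    HasDerivAt (fun r => disp r + c * r) (dispDeriv r + c) r := by
  convert! (hasDerivAt_disp r).add ((hasDerivAt_id r).const_mul c) using 1
  simp

/-- The second derivative of the dispersion relation is `3r/⟨r⟩ - r³/⟨r⟩³`. Its symbol constant does
not depend on `r₀`, which matters because the cuts below vary with `L` and `δ`. -/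
lemma exists_hasDerivAt_dispDeriv (K : ℕ) : ∃ B, ∃ d : ℝ → ℝ, ∀ r₀, 0 < r₀ →
    (∀ r, r₀ ≤ r → HasDerivAt dispDeriv (d r) r) ∧ SymbolOn r₀ K 1 (-1) B d := by
  obtain ⟨C, hC⟩ := SymbolOn.exists_rpow_mul_bracket K 1 (-1)
  obtain ⟨D, hD⟩ := SymbolOn.exists_rpow_mul_bracket K 3 (-3)
  refine ⟨|3| * C + |-1| * D, fun r => 3 * (r ^ (1 : ℝ) * bracket r ^ (-1 : ℝ)) +
    (-1) * (r ^ (3 : ℝ) * bracket r ^ (-3 : ℝ)), fun r₀ hr => ⟨fun r hr' => ?_, ?_⟩⟩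
  · have h := (hasDerivAt_bracket r).add
      ((hasDerivAt_pow 2 r).div (hasDerivAt_bracket r) (bracket_pos r).ne')
    convert! h using 1
    have hb := (bracket_pos r).ne'
    beta_reduce
    rw [Real.rpow_one, Real.rpow_neg (bracket_pos r).le, Real.rpow_neg (bracket_pos r).le,
      Real.rpow_one, show (3 : ℝ) = ((3 : ℕ) : ℝ) by norm_num, Real.rpow_natCast, Real.rpow_natCast]
    push_cast
    field_simp
    ring
  · exact ((hC r₀ hr).const_mul 3).add (((((hD r₀ hr).congr_exp (p' := 1 + 2) (q' := -1 - 2)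
      (by norm_num) (by norm_num)).weaken hr (by norm_num))).const_mul (-1))

/-- A consequence of `⟨r⟩ ≤ 1 + r²/2`. The speed of sound is `1` and the excess over it is quadratic
at low frequency, so a source of speed `1 + δ` is resonant only with frequencies of order at most
`√δ`. -/
lemma dispDeriv_lower {r : ℝ} : 1 + 3 / 2 * (r ^ 2 / bracket r) ≤ dispDeriv r := by
  have h1 := bracket_pos r
  have h2 := bracket_sq r
  have h3 : bracket r ≤ 1 + r ^ 2 / 2 := by
    unfold bracket
    rw [Real.sqrt_le_left (by positivity)]
    nlinarith [sq_nonneg (r ^ 2)]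
  unfold dispDeriv
  have h4 : r ^ 2 / bracket r = bracket r - 1 / bracket r := by
    field_simp
    linarith
  have h5 : bracket r + 1 / 2 * (r ^ 2 / bracket r) - 1 - (r ^ 2 / bracket r) =
      (1 + r ^ 2 / 2 - bracket r) / bracket r := by
    field_simp
    nlinarith
  have h6 : 0 ≤ (1 + r ^ 2 / 2 - bracket r) / bracket r := div_nonneg (by linarith) h1.le
  linarith

lemma norm_setIntegral_Ioc_le {p q r₀ L : ℝ} {ψ : ℝ → ℝ} (hp : 0 ≤ p) (hr : 0 < r₀)
    (hr2 : r₀ ≤ 2) :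
    ‖∫ r in Set.Ioc 0 r₀, ((r ^ p * bracket r ^ q : ℝ) : ℂ) *
      Complex.exp (Complex.I * ((L * ψ r : ℝ) : ℂ))‖ ≤ bracket 2 ^ |q| * r₀ ^ (p + 1) := by
  have h := norm_setIntegral_le_of_norm_le_const (μ := volume) (s := Set.Ioc 0 r₀)
    (C := bracket 2 ^ |q| * r₀ ^ p)
    (f := fun r => ((r ^ p * bracket r ^ q : ℝ) : ℂ) *
      Complex.exp (Complex.I * ((L * ψ r : ℝ) : ℂ))) (by simp) (fun r hr' => by
      rw [norm_mul_exp_I, abs_of_nonneg (SymbolOn.weight_nonneg hr'.1), mul_comm]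
      exact mul_le_mul (bracket_rpow_le q hr'.1.le (hr'.2.trans hr2))
        (Real.rpow_le_rpow hr'.1.le hr'.2 hp) (Real.rpow_nonneg hr'.1.le _)
        (Real.rpow_nonneg (bracket_pos _).le _))
  refine h.trans (le_of_eq ?_)
  rw [Real.rpow_add_one hr.ne', Measure.real, Real.volume_Ioc, sub_zero,
    ENNReal.toReal_ofReal hr.le]
  ring

lemma integrableOn_osc {p q L : ℝ} {ψ : ℝ → ℝ} (hp : -1 < p) (hpq : p + q < -1)
    (hψ : Continuous ψ) :
    IntegrableOn (fun r => ((r ^ p * bracket r ^ q : ℝ) : ℂ) *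
      Complex.exp (Complex.I * ((L * ψ r : ℝ) : ℂ))) (Set.Ioi 0) := by
  refine (integrableOn_Ioi_zero_rpow_mul_bracket hp hpq).mono' ?_ ?_
  · refine ContinuousOn.aestronglyMeasurable ?_ measurableSet_Ioi
    exact (Complex.continuous_ofReal.comp_continuousOn (continuousOn_rpow_mul_bracket p q)).mul
      (by fun_prop)
  · refine (ae_restrict_iff' measurableSet_Ioi).2 (Filter.Eventually.of_forall fun r hr' => ?_)
    rw [norm_mul_exp_I, abs_of_nonneg (SymbolOn.weight_nonneg hr')]

lemma norm_oscInt_zero_le_split {p q r₀ L : ℝ} {ψ : ℝ → ℝ} (hp : 0 ≤ p) (hpq : p + q < -1)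
    (hr : 0 < r₀) (hr2 : r₀ ≤ 2) (hψ : Continuous ψ) :
    ‖oscInt 0 L ψ (fun r => r ^ p * bracket r ^ q)‖ ≤ bracket 2 ^ |q| * r₀ ^ (p + 1) +
      ‖oscInt r₀ L ψ (fun r => r ^ p * bracket r ^ q)‖ := by
  have hi := integrableOn_osc (L := L) (by linarith : -1 < p) hpq hψ
  have h : oscInt 0 L ψ (fun r => r ^ p * bracket r ^ q) =
      (∫ r in Set.Ioc 0 r₀, ((r ^ p * bracket r ^ q : ℝ) : ℂ) *
        Complex.exp (Complex.I * ((L * ψ r : ℝ) : ℂ))) +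
      oscInt r₀ L ψ (fun r => r ^ p * bracket r ^ q) := by
    unfold oscInt
    rw [← Set.Ioc_union_Ioi_eq_Ioi hr.le]
    exact setIntegral_union Set.Ioc_disjoint_Ioi_same measurableSet_Ioi
      (hi.mono_set Set.Ioc_subset_Ioi_self) (hi.mono_set (Set.Ioi_subset_Ioi hr.le))
  rw [h]
  exact (norm_add_le _ _).trans (add_le_add_left (norm_setIntegral_Ioc_le hp hr hr2) _)

lemma setIntegral_weight_le {p q r₀ : ℝ} (hp : -1 < p) (hpq : p + q < -1) (hr : 0 < r₀) :
    ∫ r in Set.Ioi r₀, r ^ p * bracket r ^ q ≤ ∫ r in Set.Ioi 0, r ^ p * bracket r ^ q :=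
  setIntegral_mono_set (integrableOn_Ioi_zero_rpow_mul_bracket hp hpq)
    ((ae_restrict_iff' measurableSet_Ioi).2 (Filter.Eventually.of_forall fun _ h =>
      SymbolOn.weight_nonneg h)) (Set.Ioi_subset_Ioi hr.le).eventuallyLE

/-- Away from the velocities of the dispersion relation. -/
lemma exists_oscInt_le_slow {p q : ℝ} (hp : 3 < p) (hpq : p + q < -1) : ∃ C, 0 ≤ C ∧
    ∀ L c : ℝ, 1 ≤ L → |c| ≤ 1 / 2 →
    ‖oscInt 0 L (fun r => disp r + c * r) (fun r => r ^ p * bracket r ^ q)‖ ≤ C * L⁻¹ ^ 4 := by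
  obtain ⟨B, d, hd⟩ := exists_hasDerivAt_dispDeriv 4
  obtain ⟨C, hC0, hC⟩ := exists_norm_oscInt_le 4 0 1 (1 / 2) B (by norm_num) (by norm_num)
  obtain ⟨D, hD⟩ := SymbolOn.exists_rpow_mul_bracket 4 p q
  set Q := bracket 2 ^ |q|
  set I := ∫ r in Set.Ioi 0, r ^ (p - 4) * bracket r ^ (q - 4) with hI
  have hI0 : 0 ≤ I := setIntegral_nonneg measurableSet_Ioi fun r hr => SymbolOn.weight_nonneg hr
  have hD0 : 0 ≤ D := (hD 1 one_pos).const_nonneg one_pos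
  set Z := bracket 2 ^ |q - 1| + bracket 2 ^ |q - 2| + bracket 2 ^ |q - 3| + bracket 2 ^ |q - 4|
  have hb0 : ∀ x y : ℝ, 0 ≤ bracket x ^ y := fun x y => Real.rpow_nonneg (bracket_pos x).le _
  have hQ0 : 0 ≤ Q := hb0 _ _
  have hZ0 : 0 ≤ Z := by
    have := hb0 2
    exact add_nonneg (add_nonneg (add_nonneg (this _) (this _)) (this _)) (this _)
  refine ⟨Q + C * D * (Z + I), by positivity, fun L c hL hc => ?_⟩
  have hL0 : 0 < L := by linarith
  -- Below `1/L` the trivial bound already gives `L^(-(p+1)) ≤ L⁻⁴`. Above it the derivative of the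
  -- phase is at least `⟨r⟩/2`, and the `k`-th boundary term, `k = 0, …, 3`, is of size `L^(-k-1)
  -- r₀^(p-k) ≤ L⁻⁴`.
  set r₀ := L⁻¹ with hr₀
  have hr : 0 < r₀ := inv_pos.2 hL0
  have hr1 : r₀ ≤ 1 := inv_le_one_of_one_le₀ hL
  refine (norm_oscInt_zero_le_split (by linarith) hpq hr (by linarith)
    (continuous_disp.add (continuous_const.mul continuous_id))).trans ?_
  have h1 := hC r₀ L hr hL0 (fun r => disp r + c * r) (fun r => dispDeriv r + c) d
    (fun r _ => hasDerivAt_disp_add_mul c r)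
    (fun r hr' => ((hd r₀ hr).1 r hr').add_const c)
    (((hd r₀ hr).2.congr_exp (p' := 0 - 1 + 2) (q' := 1 - 2) (by norm_num) (by norm_num)).weaken hr
      (by norm_num)) (fun r hr' => by
      rw [Real.rpow_zero, one_mul, Real.rpow_one]
      have h2 := dispDeriv_lower (r := r)
      have h3 := bracket_pos r
      have h4 : r ^ 2 / bracket r = bracket r - 1 / bracket r := by
        have := bracket_sq r
        field_simp
        linarith
      have h5 : 1 / bracket r ≤ 1 := (div_le_one h3).2 (one_le_bracket r)
      have h6 := (abs_le.1 hc).1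
      have h7 := one_le_bracket r
      have h8 : 0 ≤ r ^ 2 / bracket r := by positivity
      linarith)
    p q D _ hpq (hD r₀ hr)
  have hw : ∀ k : ℝ, 0 ≤ k → ∀ x y : ℝ, x = p - k → r₀ ^ x * bracket r₀ ^ y ≤
      L⁻¹ ^ (3 - k) * bracket 2 ^ |y| := fun k hk x y hx => by
    refine mul_le_mul ?_ (bracket_rpow_le _ hr.le (by linarith)) (hb0 _ _) (by positivity)
    exact Real.rpow_le_rpow_of_exponent_ge hr hr1 (by linarith)
  have e0 : r₀ ^ (p + 1) ≤ L⁻¹ ^ 4 := by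
    rw [← Real.rpow_natCast]
    exact Real.rpow_le_rpow_of_exponent_ge hr hr1 (by norm_num; linarith)
  have hint := setIntegral_weight_le (p := p - 4) (q := q - 4) (by linarith) (by linarith) hr
  have h2 : ibpBound r₀ L 0 1 4 p q ≤ L⁻¹ ^ 4 * (Z + I) := by
    have w0 := hw 0 le_rfl (p - 0) (q - 1) rfl
    have w1 := hw 1 (by norm_num) (p - 0 - 1 - 0) (q - 1 - 1) (by ring)
    have w2 := hw 2 (by norm_num) (p - 0 - 1 - 0 - 1 - 0) (q - 1 - 1 - 1) (by ring)
    have w3 := hw 3 (by norm_num) (p - 0 - 1 - 0 - 1 - 0 - 1 - 0) (q - 1 - 1 - 1 - 1) (by ring)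
    rw [show (3 : ℝ) - 0 = ((3 : ℕ) : ℝ) by norm_num, Real.rpow_natCast] at w0
    rw [show (3 : ℝ) - 1 = ((2 : ℕ) : ℝ) by norm_num, Real.rpow_natCast] at w1
    rw [show (3 : ℝ) - 2 = ((1 : ℕ) : ℝ) by norm_num, Real.rpow_natCast] at w2
    rw [show (3 : ℝ) - 3 = ((0 : ℕ) : ℝ) by norm_num, Real.rpow_natCast] at w3
    have w4 : ∫ r in Set.Ioi r₀, r ^ (p - 0 - 1 - 0 - 1 - 0 - 1 - 0 - 1) *
        bracket r ^ (q - 1 - 1 - 1 - 1) ≤ I := by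
      rw [show p - 0 - 1 - 0 - 1 - 0 - 1 - 0 - 1 = p - 4 by ring,
        show q - 1 - 1 - 1 - 1 = q - 4 by ring]
      exact hint
    simp only [ibpBound]
    have hm := mul_le_mul_of_nonneg_left (add_le_add w3 w4) (inv_nonneg.2 hL0.le)
    have hm := mul_le_mul_of_nonneg_left (add_le_add w2 hm) (inv_nonneg.2 hL0.le)
    have hm := mul_le_mul_of_nonneg_left (add_le_add w1 hm) (inv_nonneg.2 hL0.le)
    have hm := mul_le_mul_of_nonneg_left (add_le_add w0 hm) (inv_nonneg.2 hL0.le)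
    refine hm.trans (le_of_eq ?_)
    simp only [Z, show q - 1 - 1 = q - 2 by ring, show q - 2 - 1 = q - 3 by ring,
      show q - 3 - 1 = q - 4 by ring]
    ring
  have h3 : C * D * ibpBound r₀ L 0 1 4 p q ≤ C * D * (L⁻¹ ^ 4 * (Z + I)) :=
    mul_le_mul_of_nonneg_left h2 (mul_nonneg hC0 hD0)
  have h4 : Q * r₀ ^ (p + 1) ≤ Q * L⁻¹ ^ 4 := mul_le_mul_of_nonneg_left e0 (hb0 _ _)
  calc _ ≤ Q * L⁻¹ ^ 4 + C * D * (L⁻¹ ^ 4 * (Z + I)) := add_le_add h4 (h1.trans h3)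
    _ = _ := by ring

/-- For velocities up to `1 + δ`, just above the speed of sound. -/
lemma exists_oscInt_le_sonic {p q : ℝ} (hp : 5 < p) (hpq : p + q < -1) : ∃ C, 0 ≤ C ∧
    ∀ L c δ : ℝ, 1 ≤ L → 0 < δ → δ ≤ 1 → -(1 + δ) ≤ c →
    ‖oscInt 0 L (fun r => disp r + c * r) (fun r => r ^ p * bracket r ^ q)‖ ≤
      C * (δ ^ ((p + 1) / 2) + L⁻¹ ^ 2) := by
  obtain ⟨B, d, hd⟩ := exists_hasDerivAt_dispDeriv 2
  obtain ⟨C, hC0, hC⟩ := exists_norm_oscInt_le 2 2 (-1) (1 / 2) B (by norm_num) (by norm_num)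
  obtain ⟨D, hD⟩ := SymbolOn.exists_rpow_mul_bracket 2 p q
  set Q := bracket 2 ^ |q|
  set I := ∫ r in Set.Ioi 0, r ^ (p - 6) * bracket r ^ (q + 2) with hI
  have hI0 : 0 ≤ I := setIntegral_nonneg measurableSet_Ioi fun r hr => SymbolOn.weight_nonneg hr
  have hD0 : 0 ≤ D := (hD 1 one_pos).const_nonneg one_pos
  set Y := bracket 2 ^ |q + 1|
  set Z := (2 : ℝ) ^ (p - 5) * bracket 2 ^ |q + 2|
  have hb0 : ∀ x y : ℝ, 0 ≤ bracket x ^ y := fun x y => Real.rpow_nonneg (bracket_pos x).le _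
  have hY0 : 0 ≤ Y := hb0 _ _
  have hZ0 : 0 ≤ Z := mul_nonneg (by positivity) (hb0 _ _)
  have hQ0 : 0 ≤ Q := hb0 _ _
  refine ⟨(Q + C * D * Y) * 2 ^ (p + 1) + C * D * (Y + Z + I), by positivity,
    fun L c δ hL hδ hδ1 hc => ?_⟩
  have hL0 : 0 < L := by linarith
  -- Below `2√δ` the phase may be stationary and only the size `r₀^(p+1) ∼ δ^((p+1)/2)` is used.
  -- Above it `r²/⟨r⟩ ≥ δ`, so the derivative `φ' + c` is at least half of `r²/⟨r⟩`.
  set r₀ := 2 * √δ with hr₀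
  have hs1 : √δ ≤ 1 := Real.sqrt_le_one.2 hδ1
  have hr : 0 < r₀ := mul_pos two_pos (Real.sqrt_pos.2 hδ)
  have hr2 : r₀ ≤ 2 := by linarith
  have hrsq : r₀ ^ 2 = 4 * δ := by rw [hr₀, mul_pow, Real.sq_sqrt hδ.le]; norm_num
  have hrp : r₀ ^ (p + 1) = 2 ^ (p + 1) * δ ^ ((p + 1) / 2) := by
    rw [hr₀, Real.mul_rpow two_pos.le (Real.sqrt_nonneg _), Real.sqrt_eq_rpow, ← Real.rpow_mul hδ.le]
    ring_nf
  refine (norm_oscInt_zero_le_split (by linarith) hpq hr hr2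
    (continuous_disp.add (continuous_const.mul continuous_id))).trans ?_
  have h1 := hC r₀ L hr hL0 (fun r => disp r + c * r) (fun r => dispDeriv r + c) d
    (fun r _ => hasDerivAt_disp_add_mul c r)
    (fun r hr' => ((hd r₀ hr).1 r hr').add_const c)
    ((hd r₀ hr).2.congr_exp (by norm_num) (by norm_num)) (fun r hr' => by
      have h2 := dispDeriv_lower (r := r)
      have h3 := bracket_pos r
      have h9 := bracket_sq r
      rw [Real.rpow_two, Real.rpow_neg_one, ← div_eq_mul_inv]
      have h4 : r₀ ^ 2 ≤ r ^ 2 := by gcongr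
      have h5 : δ ≤ r ^ 2 / bracket r := by
        rw [le_div_iff₀ h3]
        -- For `⟨r⟩ ≤ 2` use `r² ≥ 4δ`; for `⟨r⟩ > 2` use `r² = ⟨r⟩² - 1 ≥ ⟨r⟩` and `δ ≤ 1`.
        rcases le_or_gt (bracket r) 2 with h | h
        · nlinarith
        · nlinarith
      linarith)
    p q D _ hpq (hD r₀ hr)
  have hint := setIntegral_weight_le (p := p - 6) (q := q + 2) (by linarith) (by linarith) hr
  -- The first boundary term is balanced at `r₀³ = 1/L`: for larger `r₀` it is dominated by the part
  -- below the cut, for smaller `r₀` by `L⁻²`, because `p - 2 ≥ 3`.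
  have e1 : L⁻¹ * r₀ ^ (p - 2) ≤ r₀ ^ (p + 1) + L⁻¹ ^ 2 := by
    rcases le_or_gt L⁻¹ (r₀ ^ 3) with h | h
    · have : L⁻¹ * r₀ ^ (p - 2) ≤ r₀ ^ 3 * r₀ ^ (p - 2) :=
        mul_le_mul_of_nonneg_right h (Real.rpow_nonneg hr.le _)
      rw [← Real.rpow_natCast, ← Real.rpow_add hr] at this
      have e : ((3 : ℕ) : ℝ) + (p - 2) = p + 1 := by push_cast; ring
      rw [e] at this
      have : 0 ≤ L⁻¹ ^ 2 := by positivity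
      linarith
    · have hr1 : r₀ ≤ 1 := by
        by_contra h'
        push Not at h'
        have : 1 < r₀ ^ 3 := one_lt_pow₀ h' (by norm_num)
        have := inv_le_one_of_one_le₀ hL
        linarith
      have : r₀ ^ (p - 2) ≤ r₀ ^ (3 : ℝ) :=
        Real.rpow_le_rpow_of_exponent_ge hr hr1 (by linarith)
      rw [show (3 : ℝ) = ((3 : ℕ) : ℝ) by norm_num, Real.rpow_natCast] at this
      have h5 : L⁻¹ * r₀ ^ (p - 2) ≤ L⁻¹ * L⁻¹ :=
        mul_le_mul_of_nonneg_left (this.trans h.le) (inv_nonneg.2 hL0.le)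
      have : 0 ≤ r₀ ^ (p + 1) := Real.rpow_nonneg hr.le _
      nlinarith
  have h2 : ibpBound r₀ L 2 (-1) 2 p q ≤ Y * (r₀ ^ (p + 1) + L⁻¹ ^ 2) + L⁻¹ ^ 2 * (Z + I) := by
    have w0 : r₀ ^ (p - 2) * bracket r₀ ^ (q - -1) ≤ r₀ ^ (p - 2) * Y := by
      refine mul_le_mul_of_nonneg_left ?_ (Real.rpow_nonneg hr.le _)
      rw [sub_neg_eq_add]
      exact bracket_rpow_le _ hr.le hr2
    have w1 : r₀ ^ (p - 2 - 1 - 2) * bracket r₀ ^ (q - -1 - -1) ≤ Z := by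
      rw [show q - -1 - -1 = q + 2 by ring, show p - 2 - 1 - 2 = p - 5 by ring]
      exact mul_le_mul (Real.rpow_le_rpow hr.le hr2 (by linarith))
        (bracket_rpow_le _ hr.le hr2) (hb0 _ _) (by positivity)
    have w2 : ∫ r in Set.Ioi r₀, r ^ (p - 2 - 1 - 2 - 1) * bracket r ^ (q - -1 - -1) ≤ I := by
      rw [show p - 2 - 1 - 2 - 1 = p - 6 by ring, show q - -1 - -1 = q + 2 by ring]
      exact hint
    simp only [ibpBound]
    have hm := mul_le_mul_of_nonneg_left (add_le_add w1 w2) (inv_nonneg.2 hL0.le)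
    have hm := mul_le_mul_of_nonneg_left (add_le_add w0 hm) (inv_nonneg.2 hL0.le)
    have hm2 := mul_le_mul_of_nonneg_left e1 hY0
    nlinarith
  have h3 : C * D * ibpBound r₀ L 2 (-1) 2 p q ≤ _ :=
    mul_le_mul_of_nonneg_left h2 (mul_nonneg hC0 hD0)
  have hA : 0 ≤ L⁻¹ ^ 2 := by positivity
  have hΔ : 0 ≤ δ ^ ((p + 1) / 2) := Real.rpow_nonneg hδ.le _
  rw [hrp] at h3 ⊢
  set P2 : ℝ := 2 ^ (p + 1)
  have hP2 : 0 ≤ P2 := by positivity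
  set S := δ ^ ((p + 1) / 2)
  set A := L⁻¹ ^ 2
  have hCD : 0 ≤ C * D := mul_nonneg hC0 hD0
  calc _ ≤ Q * (P2 * S) + C * D * (Y * (P2 * S + A) + A * (Z + I)) := by
        exact add_le_add le_rfl (h1.trans h3)
    _ ≤ Q * (P2 * S) + C * D * (Y * (P2 * S + A) + A * (Z + I)) +
        ((Q + C * D * Y) * P2 * A + C * D * (Y + Z + I) * S) := by
        have : 0 ≤ (Q + C * D * Y) * P2 * A + C * D * (Y + Z + I) * S := by positivity
        linarith
    _ = _ := by ring


/-! ### Integration of zonal functions on `ℝ⁵` -/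

lemma lintegral_fun_norm {E : Type*} [NormedAddCommGroup E] [NormedSpace ℝ E] [MeasurableSpace E]
    [BorelSpace E] [FiniteDimensional ℝ E] [Nontrivial E] (μ : Measure E) [μ.IsAddHaarMeasure]
    {f : ℝ → ℝ≥0∞} (hf : Measurable f) :
    ∫⁻ x, f ‖x‖ ∂μ = μ.toSphere Set.univ *
      ∫⁻ y in Set.Ioi 0, ENNReal.ofReal (y ^ (Module.finrank ℝ E - 1)) * f y := by
  calc ∫⁻ x, f ‖x‖ ∂μ = ∫⁻ x : ({(0)}ᶜ : Set E), f ‖x.1‖ ∂(μ.comap (↑)) := by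
        rw [lintegral_subtype_comap (measurableSet_singleton _).compl fun x => f ‖x‖,
          restrict_compl_singleton]
    _ = ∫⁻ p, f p.2 ∂μ.toSphere.prod (.volumeIoiPow (Module.finrank ℝ E - 1)) := by
        have := (μ.measurePreserving_homeomorphUnitSphereProd).lintegral_comp_emb
          (Homeomorph.measurableEmbedding _) (f ∘ Subtype.val ∘ Prod.snd)
        simpa using this
    _ = μ.toSphere Set.univ *
        ∫⁻ x : Set.Ioi (0 : ℝ), f x ∂(.volumeIoiPow (Module.finrank ℝ E - 1)) := by
        rw [lintegral_prod _ (by fun_prop)]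
        dsimp only
        rw [lintegral_const, mul_comm]
    _ = _ := by
        congr 1
        rw [Measure.volumeIoiPow, lintegral_withDensity_eq_lintegral_mul _ (by fun_prop)
          (by fun_prop)]
        exact lintegral_subtype_comap measurableSet_Ioi
          fun y => ENNReal.ofReal (y ^ (Module.finrank ℝ E - 1)) * f y

/-- Split `ℝ⁵ = ℝ × ℝ⁴`, use spherical coordinates in `ℝ⁴` to reduce to the pair (axial coordinate,
distance to the axis), then polar coordinates in that half-plane. -/
lemma lintegral_zonal {f : ℝ × ℝ → ℝ≥0∞} (hf : Measurable f) :
    ∫⁻ ξ : E5, f (‖ξ‖, ξ 0) =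
      (volume : Measure (EuclideanSpace ℝ (Fin 4))).toSphere Set.univ *
      ∫⁻ p in polarCoord.target, ENNReal.ofReal (p.1 * (p.1 * Real.sin p.2) ^ 3) *
        f (p.1, p.1 * Real.cos p.2) := by
  set c := (volume : Measure (EuclideanSpace ℝ (Fin 4))).toSphere Set.univ
  -- The density `ENNReal.ofReal (y ^ 3)` vanishes for `y ≤ 0`, so the half-plane can be replaced by
  -- the whole plane, on which polar coordinates are available.
  let g : ℝ × ℝ → ℝ≥0∞ := fun p => ENNReal.ofReal (p.2 ^ 3) * f (√(p.1 ^ 2 + p.2 ^ 2), p.1)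
  have hg : Measurable g := by fun_prop
  have h1 : ∫⁻ ξ : E5, f (‖ξ‖, ξ 0) = ∫⁻ q : ℝ × (Fin 4 → ℝ),
      f (√(q.1 ^ 2 + ‖(WithLp.toLp 2 q.2 : EuclideanSpace ℝ (Fin 4))‖ ^ 2), q.1) := by
    have e1 := (EuclideanSpace.volume_preserving_symm_measurableEquiv_toLp (Fin 5))
    have e2 := volume_preserving_piFinSuccAbove (fun _ : Fin 5 => ℝ) 0
    rw [← (e2.comp e1).lintegral_comp_emb ((MeasurableEquiv.measurableEmbedding _).comp
      (MeasurableEquiv.measurableEmbedding _))]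
    refine lintegral_congr fun ξ => ?_
    have h0 : ‖ξ‖ = √((ξ 0) ^ 2 + ‖(WithLp.toLp 2 (fun i : Fin 4 => ξ i.succ) :
        EuclideanSpace ℝ (Fin 4))‖ ^ 2) := by
      rw [EuclideanSpace.norm_eq, EuclideanSpace.norm_eq, Real.sq_sqrt (by positivity),
        Fin.sum_univ_succ]
      simp
    rw [h0]
    rfl
  have h2 : ∀ s : ℝ, ∫⁻ η : Fin 4 → ℝ,
      f (√(s ^ 2 + ‖(WithLp.toLp 2 η : EuclideanSpace ℝ (Fin 4))‖ ^ 2), s) =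
      c * ∫⁻ y, g (s, y) := by
    intro s
    have e1 := (EuclideanSpace.volume_preserving_symm_measurableEquiv_toLp (Fin 4)).symm
    have e3 := e1.lintegral_comp_emb (MeasurableEquiv.measurableEmbedding _)
      (fun η => f (√(s ^ 2 + ‖η‖ ^ 2), s))
    have e4 := lintegral_fun_norm (volume : Measure (EuclideanSpace ℝ (Fin 4)))
      (f := fun y => f (√(s ^ 2 + y ^ 2), s)) (by fun_prop)
    refine e3.trans (e4.trans ?_)
    congr 1
    simp only [finrank_euclideanSpace, Fintype.card_fin]
    rw [← lintegral_indicator measurableSet_Ioi]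
    refine lintegral_congr fun y => ?_
    by_cases hy : 0 < y
    · simp [g, hy]
    · rw [Set.indicator_of_notMem (by simpa using hy)]
      have : y ^ 3 ≤ 0 := by
        push Not at hy
        exact Odd.pow_nonpos (by decide) hy
      simp [g, ENNReal.ofReal_of_nonpos this]
  rw [h1, Measure.volume_eq_prod, lintegral_prod _ (by fun_prop)]
  simp_rw [h2]
  rw [lintegral_const_mul _ (by fun_prop), ← lintegral_prod _ (by fun_prop),
    ← Measure.volume_eq_prod, ← lintegral_comp_polarCoord_symm]
  congr 1
  refine setLIntegral_congr_fun (measurableSet_Ioi.prod measurableSet_Ioo) fun p hp => ?_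
  have hp1 : 0 < p.1 := hp.1
  simp only [polarCoord_symm_apply, g, smul_eq_mul]
  rw [← mul_assoc, ← ENNReal.ofReal_mul hp1.le]
  congr 3
  rw [show (p.1 * Real.cos p.2) ^ 2 + (p.1 * Real.sin p.2) ^ 2 = p.1 ^ 2 by
    linear_combination p.1 ^ 2 * Real.sin_sq_add_cos_sq p.2, Real.sqrt_sq hp1.le]

/-- Integration of functions of `(‖ξ‖, ξ₀)` over `ℝ⁵` in polar coordinates. -/
lemma exists_integral_zonal : ∃ κ : ℝ, 0 ≤ κ ∧ ∀ F : ℝ × ℝ → ℂ, Measurable F →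
    ∫ ξ : E5, F (‖ξ‖, ξ 0) = (κ : ℂ) * ∫ p : ℝ × ℝ,
      ((p.1 ^ 4 * Real.sin p.2 ^ 3 : ℝ) : ℂ) * F (p.1, p.1 * Real.cos p.2)
        ∂((volume.restrict (Set.Ioi 0)).prod (volume.restrict (Set.Ioo 0 Real.pi))) := by
  set c := (volume : Measure (EuclideanSpace ℝ (Fin 4))).toSphere Set.univ
  refine ⟨c.toReal, ENNReal.toReal_nonneg, fun F hF => ?_⟩
  let d : ℝ × ℝ → ℝ≥0∞ := fun p => ENNReal.ofReal (p.1 * (p.1 * Real.sin p.2) ^ 3)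
  have hd : Measurable d := by fun_prop
  let ν : Measure (ℝ × ℝ) := c • ((volume.restrict polarCoord.target).withDensity d)
  let S : ℝ × ℝ → ℝ × ℝ := fun p => (p.1, p.1 * Real.cos p.2)
  let T : E5 → ℝ × ℝ := fun ξ => (‖ξ‖, ξ 0)
  have hS : Measurable S := by fun_prop
  have hT : Measurable T := by fun_prop
  -- Comparing image measures, and not integrals, yields the formula for every measurable `F`,
  -- integrable or not.
  have hm : Measure.map T volume = Measure.map S ν := by
    refine Measure.ext_of_lintegral _ fun f hf => ?_
    rw [lintegral_map hf hT, lintegral_map hf hS, lintegral_smul_measure,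
      lintegral_withDensity_eq_lintegral_mul _ hd (g := fun p => f (S p)) (hf.comp hS)]
    exact lintegral_zonal hf
  have h1 : ∫ ξ : E5, F (‖ξ‖, ξ 0) = ∫ p, F (S p) ∂ν := by
    rw [← integral_map hS.aemeasurable hF.aestronglyMeasurable, ← hm,
      integral_map hT.aemeasurable hF.aestronglyMeasurable]
  rw [h1, integral_smul_measure, integral_withDensity_eq_integral_toReal_smul hd
    (Filter.Eventually.of_forall fun p => ENNReal.ofReal_lt_top), Complex.real_smul]
  congr 1
  rw [Measure.prod_restrict, ← Measure.volume_eq_prod]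
  -- Angles in `(-π, 0]` carry no mass: there `sin ≤ 0` and the truncated density is zero.
  rw [setIntegral_eq_of_subset_of_forall_sdiff_eq_zero (s := Set.Ioi 0 ×ˢ Set.Ioo 0 Real.pi)
    (t := polarCoord.target) (measurableSet_Ioi.prod measurableSet_Ioo)]
  · refine setIntegral_congr_fun (measurableSet_Ioi.prod measurableSet_Ioo) fun p hp => ?_
    have h2 : 0 < p.1 := hp.1
    have h3 : 0 < Real.sin p.2 := Real.sin_pos_of_pos_of_lt_pi hp.2.1 hp.2.2
    simp only [d, S]
    rw [ENNReal.toReal_ofReal (by positivity), Complex.real_smul]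
    congr 2
    ring
  · exact Set.prod_mono le_rfl (Set.Ioo_subset_Ioo_left (by linarith [Real.pi_pos]))
  · intro p hp
    have h2 : 0 < p.1 := hp.1.1
    have h3 : p.2 ≤ 0 := by
      by_contra h
      push Not at h
      exact hp.2 ⟨h2, h, hp.1.2.2⟩
    have h4 : Real.sin p.2 ≤ 0 := Real.sin_nonpos_of_nonpos_of_neg_pi_le h3 hp.1.2.1.le
    have h5 : p.1 * (p.1 * Real.sin p.2) ^ 3 ≤ 0 := mul_nonpos_of_nonneg_of_nonpos h2.le
      (Odd.pow_nonpos (by decide) (mul_nonpos_of_nonneg_of_nonpos h2.le h4))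
    simp [d, ENNReal.ofReal_of_nonpos h5]

/-- The Fourier transform of a zonal weight on the sphere is elementary in dimension five. -/
lemma exists_angular_integral (c₀ c₂ c₄ : ℝ) (hc : c₀ + c₂ + c₄ = 0) : ∃ a b : ℕ → ℂ,
    ∀ l : ℝ, l ≠ 0 →
    ∫ θ in Set.Ioo 0 Real.pi,
      ((Real.sin θ * (c₀ + c₂ * Real.cos θ ^ 2 + c₄ * Real.cos θ ^ 4) : ℝ) : ℂ) *
        Complex.exp (Complex.I * ((l * Real.cos θ : ℝ) : ℂ)) =
      ∑ k ∈ Finset.Icc 2 5, ((l : ℂ) ^ k)⁻¹ *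
        (a k * Complex.exp (Complex.I * (l : ℂ)) + b k * Complex.exp (-(Complex.I * (l : ℂ)))) := by
  have hI : Complex.I ≠ 0 := Complex.I_ne_zero
  refine ⟨fun k => if k = 2 then -(2 * c₂ + 4 * c₄) / Complex.I ^ 2 else
      if k = 3 then (2 * c₂ + 12 * c₄) / Complex.I ^ 3 else
      if k = 4 then -(24 * c₄) / Complex.I ^ 4 else 24 * c₄ / Complex.I ^ 5,
    fun k => if k = 2 then -(2 * c₂ + 4 * c₄) / Complex.I ^ 2 else
      if k = 3 then -(2 * c₂ + 12 * c₄) / Complex.I ^ 3 else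
      if k = 4 then -(24 * c₄) / Complex.I ^ 4 else -(24 * c₄) / Complex.I ^ 5, fun l hl => ?_⟩
  have hl' : (l : ℂ) ≠ 0 := by exact_mod_cast hl
  set z : ℂ := Complex.I * l with hz
  have hz0 : z ≠ 0 := mul_ne_zero hI hl'
  -- The antiderivative in `m = cos θ` obtained by repeated integration by parts; it stops at `z⁻⁵`
  -- because the polynomial has degree four.
  let F : ℂ → ℂ := fun m => Complex.exp (z * m) *
    ((c₀ + c₂ * m ^ 2 + c₄ * m ^ 4) / z - (2 * c₂ * m + 4 * c₄ * m ^ 3) / z ^ 2 +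
      (2 * c₂ + 12 * c₄ * m ^ 2) / z ^ 3 - 24 * c₄ * m / z ^ 4 + 24 * c₄ / z ^ 5)
  have hF : ∀ m, HasDerivAt F ((c₀ + c₂ * m ^ 2 + c₄ * m ^ 4) * Complex.exp (z * m)) m := by
    intro m
    have e1 : HasDerivAt (fun m : ℂ => Complex.exp (z * m)) (Complex.exp (z * m) * (z * 1)) m :=
      ((hasDerivAt_id m).const_mul z).cexp
    have p2 := hasDerivAt_pow (𝕜 := ℂ) 2 m
    have p3 := hasDerivAt_pow (𝕜 := ℂ) 3 m
    have p4 := hasDerivAt_pow (𝕜 := ℂ) 4 m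
    have q0 := (((p2.const_mul (c₂ : ℂ)).const_add (c₀ : ℂ)).add (p4.const_mul (c₄ : ℂ))).div_const z
    have q1 := (((hasDerivAt_id m).const_mul (2 * c₂ : ℂ)).add
      (p3.const_mul (4 * c₄ : ℂ))).div_const (z ^ 2)
    have q2 := ((p2.const_mul (12 * c₄ : ℂ)).const_add (2 * c₂ : ℂ)).div_const (z ^ 3)
    have q3 := ((hasDerivAt_id m).const_mul (24 * c₄ : ℂ)).div_const (z ^ 4)
    have h := e1.mul ((((q0.sub q1).add q2).sub q3).add_const (24 * c₄ / z ^ 5))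
    convert! h using 1
    simp
    field_simp
    ring
  have hG : ∀ θ : ℝ, HasDerivAt (fun θ : ℝ => -F ((Real.cos θ : ℝ) : ℂ))
      (((Real.sin θ * (c₀ + c₂ * Real.cos θ ^ 2 + c₄ * Real.cos θ ^ 4) : ℝ) : ℂ) *
        Complex.exp (Complex.I * ((l * Real.cos θ : ℝ) : ℂ))) θ := by
    intro θ
    have h := ((hF _).comp θ (Real.hasDerivAt_cos θ).ofReal_comp).neg
    convert! h using 1
    rw [hz]
    push_cast
    ring_nf
  rw [← integral_Ioc_eq_integral_Ioo, ← intervalIntegral.integral_of_le Real.pi_pos.le,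
    intervalIntegral.integral_eq_sub_of_hasDerivAt (fun θ _ => hG θ)
      (Continuous.intervalIntegrable (by fun_prop) _ _)]
  -- The weight vanishes at both poles `m = ±1`, which removes the contribution of order `z⁻¹`;
  -- hence the sum starts at `k = 2`.
  have hc' : (c₀ : ℂ) = -c₂ - c₄ := by
    rw [← Complex.ofReal_neg, ← Complex.ofReal_sub]
    congr 1
    linarith
  rw [show Finset.Icc 2 5 = {2, 3, 4, 5} by decide]
  simp only [Real.cos_pi, Real.cos_zero, F]
  simp only [hc', Complex.ofReal_neg, Complex.ofReal_one, mul_one, mul_neg]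
  clear hF hG F
  clear_value z
  generalize Complex.I = J at hI hz ⊢
  subst hz
  simp
  field_simp
  ring


/-! ### The zonal kernels -/

lemma norm_oscInt_zero_le {p q L : ℝ} (ψ : ℝ → ℝ) (hp : -1 < p) (hpq : p + q < -1) :
    ‖oscInt 0 L ψ (fun r => r ^ p * bracket r ^ q)‖ ≤
      ∫ r in Set.Ioi 0, r ^ p * bracket r ^ q := by
  refine norm_integral_le_of_norm_le (integrableOn_Ioi_zero_rpow_mul_bracket hp hpq) ?_
  refine (ae_restrict_iff' measurableSet_Ioi).2 (Filter.Eventually.of_forall fun r hr' => ?_)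
  rw [norm_mul_exp_I, abs_of_nonneg (SymbolOn.weight_nonneg hr')]

lemma exp_I_add (x y : ℝ) : Complex.exp (Complex.I * ((x + y : ℝ) : ℂ)) =
    Complex.exp (Complex.I * (x : ℂ)) * Complex.exp (Complex.I * (y : ℂ)) := by
  rw [Complex.ofReal_add, mul_add, Complex.exp_add]

lemma exp_I_sub (x y : ℝ) : Complex.exp (Complex.I * ((x - y : ℝ) : ℂ)) =
    Complex.exp (Complex.I * (x : ℂ)) * Complex.exp (-(Complex.I * (y : ℂ))) := by
  rw [Complex.ofReal_sub, mul_sub, sub_eq_add_neg, Complex.exp_add]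

/-- The polar form of a zonal oscillatory integrand. -/
noncomputable def polarIntegrand (P q L ρ c₀ c₂ c₄ : ℝ) (p : ℝ × ℝ) : ℂ :=
  ((p.1 ^ P * bracket p.1 ^ q * (Real.sin p.2 *
    (c₀ + c₂ * Real.cos p.2 ^ 2 + c₄ * Real.cos p.2 ^ 4)) : ℝ) : ℂ) *
    Complex.exp (Complex.I * ((L * disp p.1 + ρ * (p.1 * Real.cos p.2) : ℝ) : ℂ))

lemma abs_angular_le (c₀ c₂ c₄ θ : ℝ) :
    |Real.sin θ * (c₀ + c₂ * Real.cos θ ^ 2 + c₄ * Real.cos θ ^ 4)| ≤ |c₀| + |c₂| + |c₄| := by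
  have h1 := Real.abs_sin_le_one θ
  have h2 := Real.abs_cos_le_one θ
  have h3 : |Real.cos θ ^ 2| ≤ 1 := by rw [abs_pow]; exact pow_le_one₀ (abs_nonneg _) h2
  have h4 : |Real.cos θ ^ 4| ≤ 1 := by rw [abs_pow]; exact pow_le_one₀ (abs_nonneg _) h2
  have h5 : |c₀ + c₂ * Real.cos θ ^ 2 + c₄ * Real.cos θ ^ 4| ≤ |c₀| + |c₂| + |c₄| := by
    refine (abs_add_three _ _ _).trans ?_
    rw [abs_mul, abs_mul]
    gcongr
    · exact mul_le_of_le_one_right (abs_nonneg _) h3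
    · exact mul_le_of_le_one_right (abs_nonneg _) h4
  rw [abs_mul]
  calc _ ≤ 1 * (|c₀| + |c₂| + |c₄|) := mul_le_mul h1 h5 (abs_nonneg _) zero_le_one
    _ = _ := one_mul _

lemma integrable_polarIntegrand {P q : ℝ} (hP : -1 < P) (hPq : P + q < -1) (L ρ c₀ c₂ c₄ : ℝ) :
    Integrable (polarIntegrand P q L ρ c₀ c₂ c₄)
      ((volume.restrict (Set.Ioi 0)).prod (volume.restrict (Set.Ioo 0 Real.pi))) := by
  have h1 : Integrable (fun r : ℝ => r ^ P * bracket r ^ q) (volume.restrict (Set.Ioi 0)) :=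
    integrableOn_Ioi_zero_rpow_mul_bracket hP hPq
  have h2 : Integrable (fun _ : ℝ => |c₀| + |c₂| + |c₄|)
      (volume.restrict (Set.Ioo 0 Real.pi)) := integrable_const _
  refine (h1.mul_prod h2).mono' ?_ ?_
  · have := continuous_bracket.measurable
    have := continuous_disp.measurable
    unfold polarIntegrand
    refine Measurable.aestronglyMeasurable ?_
    fun_prop
  · rw [Measure.prod_restrict]
    refine (ae_restrict_iff' (measurableSet_Ioi.prod measurableSet_Ioo)).2
      (Filter.Eventually.of_forall fun p hp => ?_)
    rw [polarIntegrand, norm_mul_exp_I, abs_mul, abs_of_nonneg (SymbolOn.weight_nonneg hp.1)]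
    exact mul_le_mul_of_nonneg_left (abs_angular_le _ _ _ _) (SymbolOn.weight_nonneg hp.1)

/-- For a fixed angle the phase is `L(φ(r) + cr)` with `c = ρ cos θ / L`. This order of integration
is the useful one for `ρ ≤ L/2`, when `|c| ≤ 1/2` for all angles. -/
lemma integral_polarIntegrand_radial_first {P q : ℝ} (hP : -1 < P) (hPq : P + q < -1) {L : ℝ}
    (hL : 0 < L) (ρ c₀ c₂ c₄ : ℝ) :
    ∫ p, polarIntegrand P q L ρ c₀ c₂ c₄ p
      ∂((volume.restrict (Set.Ioi 0)).prod (volume.restrict (Set.Ioo 0 Real.pi))) =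
    ∫ θ in Set.Ioo 0 Real.pi, ((Real.sin θ * (c₀ + c₂ * Real.cos θ ^ 2 + c₄ * Real.cos θ ^ 4) : ℝ)
      : ℂ) * oscInt 0 L (fun r => disp r + ρ * Real.cos θ / L * r)
        (fun r => r ^ P * bracket r ^ q) := by
  rw [integral_prod_symm _ (integrable_polarIntegrand hP hPq L ρ c₀ c₂ c₄)]
  refine integral_congr_ae (Filter.Eventually.of_forall fun θ => ?_)
  simp only [polarIntegrand, oscInt]
  rw [← integral_const_mul]
  refine integral_congr_ae (Filter.Eventually.of_forall fun r => ?_)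
  simp only
  rw [show L * (disp r + ρ * Real.cos θ / L * r) = L * disp r + ρ * (r * Real.cos θ) by
    field_simp]
  push_cast
  ring

/-- The exact angular integral at `l = ρr` trades `k` powers of `r` for `ρ^(-k)` and leaves the two
extreme velocities `±ρ/L`. The condition `4 < P` keeps `r^(P-5)` integrable at the origin. -/
lemma integral_polarIntegrand_angular_first {P q : ℝ} (hP : 4 < P) (hPq : P + q < -1)
    {c₀ c₂ c₄ : ℝ} (hc : c₀ + c₂ + c₄ = 0) : ∃ a b : ℕ → ℂ, ∀ L ρ : ℝ, 0 < L → 0 < ρ →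
    ∫ p, polarIntegrand P q L ρ c₀ c₂ c₄ p
      ∂((volume.restrict (Set.Ioi 0)).prod (volume.restrict (Set.Ioo 0 Real.pi))) =
    ∑ k ∈ Finset.Icc 2 5, ((ρ : ℂ) ^ k)⁻¹ *
      (a k * oscInt 0 L (fun r => disp r + ρ / L * r) (fun r => r ^ (P - k) * bracket r ^ q) +
       b k * oscInt 0 L (fun r => disp r + -(ρ / L) * r)
        (fun r => r ^ (P - k) * bracket r ^ q)) := by
  obtain ⟨a, b, hab⟩ := exists_angular_integral c₀ c₂ c₄ hc
  refine ⟨a, b, fun L ρ hL hρ => ?_⟩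
  rw [integral_prod _ (integrable_polarIntegrand (by linarith) hPq L ρ c₀ c₂ c₄)]
  have hosc : ∀ c : ℝ, ∀ k ∈ Finset.Icc 2 5, IntegrableOn
      (fun r => ((r ^ (P - (k : ℕ)) * bracket r ^ q : ℝ) : ℂ) *
        Complex.exp (Complex.I * ((L * (disp r + c * r) : ℝ) : ℂ))) (Set.Ioi 0) := by
    intro c k hk
    have h1 : (k : ℝ) ≤ 5 := by exact_mod_cast (Finset.mem_Icc.1 hk).2
    have h2 : (2 : ℝ) ≤ k := by exact_mod_cast (Finset.mem_Icc.1 hk).1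
    exact integrableOn_osc (ψ := fun r => disp r + c * r) (by linarith) (by linarith)
      (continuous_disp.add (continuous_const.mul continuous_id))
  have hpoint : ∀ r ∈ Set.Ioi (0 : ℝ),
      ∫ θ in Set.Ioo 0 Real.pi, polarIntegrand P q L ρ c₀ c₂ c₄ (r, θ) =
      ∑ k ∈ Finset.Icc 2 5, ((ρ : ℂ) ^ k)⁻¹ *
        (a k * (((r ^ (P - (k : ℕ)) * bracket r ^ q : ℝ) : ℂ) *
          Complex.exp (Complex.I * ((L * (disp r + ρ / L * r) : ℝ) : ℂ))) +
        b k * (((r ^ (P - (k : ℕ)) * bracket r ^ q : ℝ) : ℂ) *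
          Complex.exp (Complex.I * ((L * (disp r + -(ρ / L) * r) : ℝ) : ℂ)))) := by
    intro r hr
    have hr0 : (0 : ℝ) < r := hr
    have e1 : ∀ θ, polarIntegrand P q L ρ c₀ c₂ c₄ (r, θ) =
        (((r ^ P * bracket r ^ q : ℝ) : ℂ) * Complex.exp (Complex.I * ((L * disp r : ℝ) : ℂ))) *
        (((Real.sin θ * (c₀ + c₂ * Real.cos θ ^ 2 + c₄ * Real.cos θ ^ 4) : ℝ) : ℂ) *
          Complex.exp (Complex.I * ((ρ * r * Real.cos θ : ℝ) : ℂ))) := by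
      intro θ
      simp only [polarIntegrand]
      rw [show L * disp r + ρ * (r * Real.cos θ) = L * disp r + ρ * r * Real.cos θ by ring]
      rw [exp_I_add]
      push_cast
      ring
    simp_rw [e1]
    rw [integral_const_mul, hab (ρ * r) (mul_pos hρ hr0).ne', Finset.mul_sum]
    refine Finset.sum_congr rfl fun k _ => ?_
    rw [Real.rpow_sub hr0, Real.rpow_natCast]
    rw [show L * (disp r + ρ / L * r) = L * disp r + ρ * r by field_simp,
      show L * (disp r + -(ρ / L) * r) = L * disp r - ρ * r by field_simp; ring]
    rw [exp_I_add, exp_I_sub]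
    have : (r : ℂ) ≠ 0 := by exact_mod_cast hr0.ne'
    have : (ρ : ℂ) ≠ 0 := by exact_mod_cast hρ.ne'
    push_cast
    field_simp
    ring
  rw [setIntegral_congr_fun measurableSet_Ioi hpoint, integral_finsetSum]
  · refine Finset.sum_congr rfl fun k hk => ?_
    rw [integral_const_mul, integral_add ((hosc _ k hk).const_mul _) ((hosc _ k hk).const_mul _),
      integral_const_mul, integral_const_mul]
    rfl
  · exact fun k hk => (((hosc _ k hk).const_mul _).add ((hosc _ k hk).const_mul _)).const_mul _

/-- The decay rate of the kernels: `L⁻² min(1, δ)^(2n+3) + L^(-7/2)`. -/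
noncomputable def kernelRate (n L δ : ℝ) : ℝ :=
  L⁻¹ ^ 2 * min 1 δ ^ (2 * n + 3) + L⁻¹ ^ ((7 : ℝ) / 2)

lemma inv_pow_four_le {L : ℝ} (hL : 1 ≤ L) : L⁻¹ ^ 4 ≤ L⁻¹ ^ ((7 : ℝ) / 2) := by
  have h0 : 0 < L⁻¹ := by positivity
  rw [← Real.rpow_natCast]
  exact Real.rpow_le_rpow_of_exponent_ge h0 (inv_le_one_of_one_le₀ hL) (by norm_num)

lemma kernelRate_nonneg {n L δ : ℝ} (hL : 0 ≤ L) (hδ : 0 ≤ δ) : 0 ≤ kernelRate n L δ := by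
  have : 0 ≤ min 1 δ := le_min zero_le_one hδ
  unfold kernelRate
  positivity

/-- The sonic estimate requires a positive `δ`. Enlarging `δ` to at least `1/L` costs `L^(-(2n+5))`,
which is within the error `L^(-7/2)`. -/
lemma sonic_rate_le {n L δ : ℝ} (hn : 1 / 4 < n) (hL : 1 ≤ L) (hδ : 0 ≤ δ) (hδ1 : δ ≤ 1) :
    L⁻¹ ^ 2 * max δ L⁻¹ ^ (2 * n + 3) ≤ kernelRate n L δ := by
  have h0 : 0 < L⁻¹ := by positivity
  have h1 : L⁻¹ ≤ 1 := inv_le_one_of_one_le₀ hL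
  unfold kernelRate
  rw [min_eq_right hδ1]
  rcases max_cases δ L⁻¹ with ⟨h, _⟩ | ⟨h, _⟩ <;> rw [h]
  · have : 0 ≤ L⁻¹ ^ ((7 : ℝ) / 2) := by positivity
    linarith
  · have h2 : L⁻¹ ^ 2 * L⁻¹ ^ (2 * n + 3) = L⁻¹ ^ (2 * n + 5) := by
      rw [← Real.rpow_natCast, ← Real.rpow_add h0]
      congr 1
      push_cast
      ring
    have h3 : L⁻¹ ^ (2 * n + 5) ≤ L⁻¹ ^ ((7 : ℝ) / 2) :=
      Real.rpow_le_rpow_of_exponent_ge h0 h1 (by linarith)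
    have : 0 ≤ L⁻¹ ^ 2 * δ ^ (2 * n + 3) := by positivity
    linarith

/-- The power `4n + 7` collects `4n + 1` from the weight, `2` from the quadratic factor and `4` from
the Jacobian. After the leading angular term it is `4n + 5`, and the sonic estimate turns this into
`δ^((4n+6)/2) = δ^(2n+3)`. -/
lemma exists_polar_integral_le {n q : ℝ} (hn : 1 / 4 < n) (hq : 4 * n + 8 < q) (c₀ c₂ c₄ : ℝ)
    (hc : c₀ + c₂ + c₄ = 0) : ∃ C, 0 ≤ C ∧ ∀ L δ ρ : ℝ, 1 ≤ L → 0 ≤ δ → 0 ≤ ρ →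
    ρ ≤ L * (1 + δ) →
    ‖∫ p, polarIntegrand (4 * n + 7) (-q) L ρ c₀ c₂ c₄ p
      ∂((volume.restrict (Set.Ioi 0)).prod (volume.restrict (Set.Ioo 0 Real.pi)))‖ ≤
      C * kernelRate n L δ := by
  obtain ⟨C₁, hC₁0, hC₁⟩ := exists_oscInt_le_slow (p := 4 * n + 7) (q := -q) (by linarith)
    (by linarith)
  obtain ⟨C₂, hC₂0, hC₂⟩ := exists_oscInt_le_sonic (p := 4 * n + 7 - (2 : ℕ)) (q := -q)
    (by push_cast; linarith) (by push_cast; linarith)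
  -- The requirement `5 < 4n + 4` is exactly `n > 1/4`.
  obtain ⟨C₃, hC₃0, hC₃⟩ := exists_oscInt_le_sonic (p := 4 * n + 7 - (3 : ℕ)) (q := -q)
    (by push_cast; linarith) (by push_cast; linarith)
  obtain ⟨a, b, hab⟩ := integral_polarIntegrand_angular_first (P := 4 * n + 7) (q := -q)
    (by linarith) (by linarith) hc
  let Tr : ℕ → ℝ := fun k => ∫ r in Set.Ioi 0, r ^ (4 * n + 7 - (k : ℕ)) * bracket r ^ (-q)
  have hTr0 : ∀ k, 0 ≤ Tr k := fun k =>
    setIntegral_nonneg measurableSet_Ioi fun r hr => SymbolOn.weight_nonneg hr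
  set w := |c₀| + |c₂| + |c₄|
  let B : ℕ → ℝ := fun k => 32 * (‖a k‖ + ‖b k‖) * (Tr k + 2 * C₂ + 2 * C₃)
  have hB0 : ∀ k, 0 ≤ B k := fun k => by have := hTr0 k; positivity
  refine ⟨w * C₁ * Real.pi + ∑ k ∈ Finset.Icc 2 5, B k,
    add_nonneg (by positivity) (Finset.sum_nonneg fun k _ => hB0 k), fun L δ ρ hL hδ hρ hρL => ?_⟩
  have hL0 : 0 < L := by linarith
  have hi0 : 0 < L⁻¹ := by positivity
  have hi1 : L⁻¹ ≤ 1 := inv_le_one_of_one_le₀ hL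
  have hR := kernelRate_nonneg (n := n) hL0.le hδ
  have hmin : 0 ≤ min 1 δ := le_min zero_le_one hδ
  have h4R : L⁻¹ ^ 4 ≤ kernelRate n L δ := by
    have := inv_pow_four_le hL
    have : 0 ≤ L⁻¹ ^ 2 * min 1 δ ^ (2 * n + 3) := by positivity
    unfold kernelRate
    linarith
  have hS0 : 0 ≤ ∑ k ∈ Finset.Icc 2 5, B k := Finset.sum_nonneg fun k _ => hB0 k
  rw [add_mul]
  rcases le_or_gt ρ (L / 2) with hcase | hcase
  · rw [integral_polarIntegrand_radial_first (by linarith) (by linarith) hL0]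
    have h1 := norm_setIntegral_le_of_norm_le_const (μ := volume) (s := Set.Ioo 0 Real.pi)
      (C := w * (C₁ * L⁻¹ ^ 4)) (f := fun θ =>
        ((Real.sin θ * (c₀ + c₂ * Real.cos θ ^ 2 + c₄ * Real.cos θ ^ 4) : ℝ) : ℂ) *
        oscInt 0 L (fun r => disp r + ρ * Real.cos θ / L * r)
        (fun r => r ^ (4 * n + 7) * bracket r ^ (-q))) (by simp) (fun θ _ => by
          rw [norm_mul, Complex.norm_real, Real.norm_eq_abs]
          refine mul_le_mul (abs_angular_le _ _ _ _) (hC₁ L _ hL ?_) (norm_nonneg _)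
            (by positivity)
          rw [abs_div, abs_mul, abs_of_nonneg hρ, abs_of_pos hL0, div_le_iff₀ hL0]
          have := Real.abs_cos_le_one θ
          nlinarith [abs_nonneg (Real.cos θ)])
    rw [Measure.real, Real.volume_Ioo, sub_zero, ENNReal.toReal_ofReal Real.pi_pos.le] at h1
    have h2 : w * (C₁ * L⁻¹ ^ 4) * Real.pi ≤ w * C₁ * Real.pi * kernelRate n L δ := by
      have : 0 ≤ w * C₁ * Real.pi := by positivity
      nlinarith
    have := mul_nonneg hS0 hR
    linarith
  · have hρ0 : 0 < ρ := by linarith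
    rw [hab L ρ hL0 hρ0]
    have hρinv : ρ⁻¹ ≤ 2 * L⁻¹ := by
      rw [inv_le_comm₀ hρ0 (by positivity), mul_inv, inv_inv]
      linarith
    have hρk : ∀ k ∈ Finset.Icc 2 5, ‖((ρ : ℂ) ^ k)⁻¹‖ ≤ 32 * L⁻¹ ^ k := by
      intro k hk
      rw [norm_inv, norm_pow, Complex.norm_real, Real.norm_of_nonneg hρ, ← inv_pow]
      refine (pow_le_pow_left₀ (by positivity) hρinv k).trans ?_
      rw [mul_pow]
      refine mul_le_mul_of_nonneg_right ?_ (by positivity)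
      calc (2 : ℝ) ^ k ≤ 2 ^ 5 := pow_le_pow_right₀ (by norm_num) (Finset.mem_Icc.1 hk).2
        _ = 32 := by norm_num
    have hosc : ∀ c : ℝ, -(1 + δ) ≤ c → ∀ k ∈ Finset.Icc 2 5,
        L⁻¹ ^ k * ‖oscInt 0 L (fun r => disp r + c * r)
          (fun r => r ^ (4 * n + 7 - (k : ℕ)) * bracket r ^ (-q))‖ ≤
        (Tr k + 2 * C₂ + 2 * C₃) * kernelRate n L δ := by
      intro c hc k hk
      have hk5 : (k : ℝ) ≤ 5 := by exact_mod_cast (Finset.mem_Icc.1 hk).2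
      have hk2 : (2 : ℝ) ≤ k := by exact_mod_cast (Finset.mem_Icc.1 hk).1
      have htriv : ‖oscInt 0 L (fun r => disp r + c * r)
          (fun r => r ^ (4 * n + 7 - (k : ℕ)) * bracket r ^ (-q))‖ ≤ Tr k :=
        norm_oscInt_zero_le _ (by linarith) (by linarith)
      have hCR : 0 ≤ (2 * C₂ + 2 * C₃) * kernelRate n L δ := by positivity
      have hT := hTr0 k
      have htriv2 : L⁻¹ ^ k ≤ kernelRate n L δ → L⁻¹ ^ k * ‖oscInt 0 L (fun r => disp r + c * r)
          (fun r => r ^ (4 * n + 7 - (k : ℕ)) * bracket r ^ (-q))‖ ≤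
          (Tr k + 2 * C₂ + 2 * C₃) * kernelRate n L δ := fun h => by
        have := mul_le_mul h htriv (norm_nonneg _) hR
        linarith
      -- Terms with `k ≥ 4` already carry `L⁻⁴`. For `k = 2, 3` the sonic estimate is needed if `δ ≤
      -- 1`; if `δ > 1` the rate is at least `L⁻²` and the trivial bound is enough.
      by_cases hk4 : 4 ≤ k
      · exact htriv2 ((pow_le_pow_of_le_one hi0.le hi1 hk4).trans h4R)
      by_cases hδ1 : δ ≤ 1
      · have hd0 : 0 < max δ L⁻¹ := lt_max_of_lt_right hi0
        have hd1 : max δ L⁻¹ ≤ 1 := max_le hδ1 hi1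
        have hs := sonic_rate_le hn hL hδ hδ1
        have hcd : -(1 + max δ L⁻¹) ≤ c := by
          have := le_max_left δ L⁻¹
          linarith
        have hTR : 0 ≤ Tr k * kernelRate n L δ := mul_nonneg hT hR
        obtain rfl | rfl : k = 2 ∨ k = 3 := by
          have := (Finset.mem_Icc.1 hk).1
          omega
        · have h1 := hC₂ L c _ hL hd0 hd1 hcd
          rw [show (4 * n + 7 - ((2 : ℕ) : ℝ) + 1) / 2 = 2 * n + 3 by push_cast; ring] at h1
          have h2 := mul_le_mul_of_nonneg_left h1 (by positivity : 0 ≤ L⁻¹ ^ 2)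
          have h3 : L⁻¹ ^ 2 * (C₂ * (max δ L⁻¹ ^ (2 * n + 3) + L⁻¹ ^ 2)) =
              C₂ * (L⁻¹ ^ 2 * max δ L⁻¹ ^ (2 * n + 3) + L⁻¹ ^ 4) := by ring
          have h5 := mul_le_mul_of_nonneg_left (add_le_add hs h4R) hC₂0
          have : 0 ≤ C₃ * kernelRate n L δ := mul_nonneg hC₃0 hR
          linarith
        · have h1 := hC₃ L c _ hL hd0 hd1 hcd
          rw [show (4 * n + 7 - ((3 : ℕ) : ℝ) + 1) / 2 = 2 * n + 5 / 2 by push_cast; ring] at h1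
          have h2 := mul_le_mul_of_nonneg_left h1 (by positivity : 0 ≤ L⁻¹ ^ 3)
          -- For `k = 3` the power of `δ` is too small by `1/2`; the additional factor `1/L`, at
          -- most the square root of `max δ L⁻¹`, makes up for it.
          have h6 : L⁻¹ * max δ L⁻¹ ^ (2 * n + 5 / 2) ≤ max δ L⁻¹ ^ (2 * n + 3) := by
            rw [show 2 * n + 3 = 1 / 2 + (2 * n + 5 / 2) by ring, Real.rpow_add hd0 (1 / 2)]
            refine mul_le_mul_of_nonneg_right ((le_max_right δ L⁻¹).trans ?_) (by positivity)
            conv_lhs => rw [← Real.rpow_one (max δ L⁻¹)]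
            exact Real.rpow_le_rpow_of_exponent_ge hd0 hd1 (by norm_num)
          have h7 : L⁻¹ ^ 5 ≤ L⁻¹ ^ 4 := pow_le_pow_of_le_one hi0.le hi1 (by norm_num)
          have h3 : L⁻¹ ^ 3 * (C₃ * (max δ L⁻¹ ^ (2 * n + 5 / 2) + L⁻¹ ^ 2)) =
              C₃ * (L⁻¹ ^ 2 * (L⁻¹ * max δ L⁻¹ ^ (2 * n + 5 / 2)) + L⁻¹ ^ 5) := by ring
          have h8 := mul_le_mul_of_nonneg_left h6 (by positivity : 0 ≤ L⁻¹ ^ 2)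
          have h5 := mul_le_mul_of_nonneg_left
            (add_le_add (h8.trans hs) (h7.trans h4R)) hC₃0
          have : 0 ≤ C₂ * kernelRate n L δ := mul_nonneg hC₂0 hR
          linarith
      · refine htriv2 ?_
        have : L⁻¹ ^ k ≤ L⁻¹ ^ 2 := pow_le_pow_of_le_one hi0.le hi1 (Finset.mem_Icc.1 hk).1
        have h9 : 0 ≤ L⁻¹ ^ ((7 : ℝ) / 2) := by positivity
        unfold kernelRate
        rw [min_eq_left (le_of_not_ge hδ1), Real.one_rpow, mul_one]
        linarith
    have hρL' : ρ / L ≤ 1 + δ := by rwa [div_le_iff₀' hL0]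
    have hρ0' : 0 ≤ ρ / L := by positivity
    have hsum : ‖∑ k ∈ Finset.Icc 2 5, ((ρ : ℂ) ^ k)⁻¹ *
      (a k * oscInt 0 L (fun r => disp r + ρ / L * r)
          (fun r => r ^ (4 * n + 7 - (k : ℕ)) * bracket r ^ (-q)) +
       b k * oscInt 0 L (fun r => disp r + -(ρ / L) * r)
        (fun r => r ^ (4 * n + 7 - (k : ℕ)) * bracket r ^ (-q)))‖ ≤
        ∑ k ∈ Finset.Icc 2 5, B k * kernelRate n L δ := by
      refine (norm_sum_le _ _).trans (Finset.sum_le_sum fun k hk => ?_)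
      rw [norm_mul]
      have o1 := hosc (ρ / L) (by linarith) k hk
      have o2 := hosc (-(ρ / L)) (by linarith) k hk
      set x := ‖oscInt 0 L (fun r => disp r + ρ / L * r)
          (fun r => r ^ (4 * n + 7 - (k : ℕ)) * bracket r ^ (-q))‖ with hx
      set y := ‖oscInt 0 L (fun r => disp r + -(ρ / L) * r)
          (fun r => r ^ (4 * n + 7 - (k : ℕ)) * bracket r ^ (-q))‖ with hy
      calc _ ≤ 32 * L⁻¹ ^ k * (‖a k‖ * x + ‖b k‖ * y) := by
            refine mul_le_mul (hρk k hk) ?_ (norm_nonneg _) (by positivity)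
            refine (norm_add_le _ _).trans ?_
            rw [norm_mul, norm_mul]
        _ = 32 * (‖a k‖ * (L⁻¹ ^ k * x) + ‖b k‖ * (L⁻¹ ^ k * y)) := by ring
        _ ≤ 32 * (‖a k‖ * ((Tr k + 2 * C₂ + 2 * C₃) * kernelRate n L δ) +
            ‖b k‖ * ((Tr k + 2 * C₂ + 2 * C₃) * kernelRate n L δ)) := by gcongr
        _ = _ := by simp only [B]; ring
    rw [← Finset.sum_mul] at hsum
    have : 0 ≤ w * C₁ * Real.pi * kernelRate n L δ := by positivity
    linarith


/-! ### The quadratic kernels -/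

/-- The radial weight `r^(4n+1) ⟨r⟩^(-q)`. -/
noncomputable def radialWeight (n q r : ℝ) : ℝ := r ^ (4 * n + 1) * bracket r ^ (-q)

lemma radialWeight_nonneg {n q r : ℝ} (hr : 0 ≤ r) : 0 ≤ radialWeight n q r :=
  mul_nonneg (Real.rpow_nonneg hr _) (Real.rpow_nonneg (bracket_pos r).le _)

lemma measurable_radialWeight (n q : ℝ) : Measurable (radialWeight n q) := by
  have := continuous_bracket.measurable
  unfold radialWeight
  fun_prop

lemma integrable_radialWeight {n q : ℝ} (hn : 1 / 4 < n) (hq : 4 * n + 8 < q) :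
    Integrable (fun ξ : E5 => radialWeight n q ‖ξ‖ * ‖ξ‖ ^ 2) := by
  refine (integrable_fun_norm_addHaar (volume : Measure E5)
    (f := fun r => radialWeight n q r * r ^ 2)).2 ?_
  have h := integrableOn_Ioi_zero_rpow_mul_bracket (p := 4 * n + 7) (q := -q) (by linarith)
    (by linarith)
  refine h.congr_fun (fun r hr => ?_) measurableSet_Ioi
  have hr0 : (0 : ℝ) < r := hr
  simp only [finrank_euclideanSpace, Fintype.card_fin, smul_eq_mul, radialWeight]
  rw [show 4 * n + 7 = 4 * n + 1 + ((6 : ℕ) : ℝ) by push_cast; ring, Real.rpow_add hr0,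
    Real.rpow_natCast]
  ring

/-- The integrand of `quadKernel`. -/
noncomputable def quadIntegrand (n q L : ℝ) (a c z ξ : E5) : ℂ :=
  ((radialWeight n q ‖ξ‖ * (inner ℝ a ξ * inner ℝ c ξ) : ℝ) : ℂ) *
    Complex.exp (Complex.I * ((L * disp ‖ξ‖ + inner ℝ z ξ : ℝ) : ℂ))

/-- The Fourier transform of the oscillating weight `(a·ξ)(c·ξ) |ξ|^(4n+1) ⟨ξ⟩^(-q) e^{iLφ}`. -/
noncomputable def quadKernel (n q L : ℝ) (a c z : E5) : ℂ := ∫ ξ, quadIntegrand n q L a c z ξ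

lemma measurable_quadIntegrand (n q L : ℝ) (a c z : E5) :
    Measurable (quadIntegrand n q L a c z) := by
  have := measurable_radialWeight n q
  have := continuous_disp.measurable
  unfold quadIntegrand
  fun_prop

lemma norm_quadIntegrand_le (n q L : ℝ) (a c z ξ : E5) :
    ‖quadIntegrand n q L a c z ξ‖ ≤ ‖a‖ * ‖c‖ * (radialWeight n q ‖ξ‖ * ‖ξ‖ ^ 2) := by
  have hw := radialWeight_nonneg (n := n) (q := q) (norm_nonneg ξ)
  rw [quadIntegrand, norm_mul_exp_I, abs_mul, abs_mul, abs_of_nonneg hw]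
  have h1 := abs_real_inner_le_norm a ξ
  have h2 := abs_real_inner_le_norm c ξ
  have h3 := mul_le_mul h1 h2 (abs_nonneg _) (by positivity)
  calc _ ≤ radialWeight n q ‖ξ‖ * (‖a‖ * ‖ξ‖ * (‖c‖ * ‖ξ‖)) := mul_le_mul_of_nonneg_left h3 hw
    _ = _ := by ring

lemma integrable_quadIntegrand {n q : ℝ} (hn : 1 / 4 < n) (hq : 4 * n + 8 < q) (L : ℝ)
    (a c z : E5) : Integrable (quadIntegrand n q L a c z) :=
  ((integrable_radialWeight hn hq).const_mul (‖a‖ * ‖c‖)).mono'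
    (measurable_quadIntegrand n q L a c z).aestronglyMeasurable
    (Filter.Eventually.of_forall fun ξ => norm_quadIntegrand_le n q L a c z ξ)

lemma norm_quadKernel_le {n q : ℝ} (hn : 1 / 4 < n) (hq : 4 * n + 8 < q) (L : ℝ) (a c z : E5) :
    ‖quadKernel n q L a c z‖ ≤
      ‖a‖ * ‖c‖ * ∫ ξ : E5, radialWeight n q ‖ξ‖ * ‖ξ‖ ^ 2 := by
  rw [← integral_const_mul]
  exact norm_integral_le_of_norm_le ((integrable_radialWeight hn hq).const_mul (‖a‖ * ‖c‖))
    (Filter.Eventually.of_forall fun ξ => norm_quadIntegrand_le n q L a c z ξ)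

lemma quadKernel_map (n q L : ℝ) (R : E5 ≃ₗᵢ[ℝ] E5) (a c z : E5) :
    quadKernel n q L (R a) (R c) (R z) = quadKernel n q L a c z := by
  have h := R.measurePreserving.integral_comp R.toHomeomorph.measurableEmbedding
    (quadIntegrand n q L (R a) (R c) (R z))
  rw [quadKernel, ← h, quadKernel]
  refine integral_congr_ae (Filter.Eventually.of_forall fun ξ => ?_)
  simp [quadIntegrand, LinearIsometryEquiv.inner_map_map]

lemma quadKernel_sum {n q : ℝ} (hn : 1 / 4 < n) (hq : 4 * n + 8 < q) (L : ℝ) (a c z : E5) :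
    quadKernel n q L a c z = ∑ j, ∑ k, ((a j * c k : ℝ) : ℂ) *
      quadKernel n q L (EuclideanSpace.single j 1) (EuclideanSpace.single k 1) z := by
  have hi := fun j k : Fin 5 => (integrable_quadIntegrand hn hq L
    (EuclideanSpace.single j 1) (EuclideanSpace.single k 1) z).const_mul ((a j * c k : ℝ) : ℂ)
  simp only [quadKernel, ← integral_const_mul]
  simp_rw [← integral_finsetSum _ fun k _ => hi _ k]
  rw [← integral_finsetSum _ fun j _ => integrable_finsetSum _ fun k _ => hi j k]
  refine integral_congr_ae (Filter.Eventually.of_forall fun ξ => ?_)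
  have e1 : inner ℝ a ξ * inner ℝ c ξ = ∑ j, ∑ k, a j * c k * (ξ j * ξ k) := by
    simp only [PiLp.inner_apply, RCLike.inner_apply, conj_trivial, Finset.sum_mul_sum]
    exact Finset.sum_congr rfl fun j _ => Finset.sum_congr rfl fun k _ => by ring
  simp only [quadIntegrand, e1, EuclideanSpace.inner_single_left, map_one, one_mul]
  push_cast
  simp only [Finset.mul_sum, Finset.sum_mul]
  exact Finset.sum_congr rfl fun j _ => Finset.sum_congr rfl fun k _ => by ring

/-- At least one of `j`, `k` is not the axis of `z`; the reflection that flips this coordinate fixes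
`z` and changes the sign of the integrand. -/
lemma quadKernel_offDiag (n q L ρ : ℝ) {j k : Fin 5} (hjk : j ≠ k) :
    quadKernel n q L (EuclideanSpace.single j 1) (EuclideanSpace.single k 1)
      (EuclideanSpace.single 0 ρ) = 0 := by
  have hflip : ∀ m : Fin 5, m ≠ 0 → ∃ R : E5 ≃ₗᵢ[ℝ] E5,
      R (EuclideanSpace.single m 1) = -EuclideanSpace.single m 1 ∧
      ∀ i, i ≠ m → ∀ x : ℝ, R (EuclideanSpace.single i x) = EuclideanSpace.single i x := by
    intro m hm
    refine ⟨(ℝ ∙ (EuclideanSpace.single m 1 : E5))ᗮ.reflection, ?_, fun i hi x => ?_⟩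
    · exact Submodule.reflection_orthogonalComplement_singleton_eq_neg _
    · refine Submodule.reflection_mem_subspace_eq_self ?_
      rw [Submodule.mem_orthogonal_singleton_iff_inner_right]
      simp [EuclideanSpace.inner_single_left, hi.symm]
  by_cases hj : j = 0
  · have hk : k ≠ 0 := fun h => hjk (hj.trans h.symm)
    obtain ⟨R, h1, h2⟩ := hflip k hk
    have h := quadKernel_map n q L R (EuclideanSpace.single j 1) (EuclideanSpace.single k 1)
      (EuclideanSpace.single 0 ρ)
    rw [h1, h2 j hjk, h2 0 hk.symm] at h
    have h3 : quadKernel n q L (EuclideanSpace.single j 1) (-EuclideanSpace.single k 1)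
        (EuclideanSpace.single 0 ρ) = -quadKernel n q L (EuclideanSpace.single j 1)
        (EuclideanSpace.single k 1) (EuclideanSpace.single 0 ρ) := by
      rw [quadKernel, quadKernel, ← integral_neg]
      refine integral_congr_ae (Filter.Eventually.of_forall fun ξ => ?_)
      simp [quadIntegrand, inner_neg_left]
    rw [h3] at h
    exact self_eq_neg.1 h.symm
  · obtain ⟨R, h1, h2⟩ := hflip j hj
    have h := quadKernel_map n q L R (EuclideanSpace.single j 1) (EuclideanSpace.single k 1)
      (EuclideanSpace.single 0 ρ)
    rw [h1, h2 k hjk.symm, h2 0 (Ne.symm hj)] at h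
    have h3 : quadKernel n q L (-EuclideanSpace.single j 1) (EuclideanSpace.single k 1)
        (EuclideanSpace.single 0 ρ) = -quadKernel n q L (EuclideanSpace.single j 1)
        (EuclideanSpace.single k 1) (EuclideanSpace.single 0 ρ) := by
      rw [quadKernel, quadKernel, ← integral_neg]
      refine integral_congr_ae (Filter.Eventually.of_forall fun ξ => ?_)
      simp [quadIntegrand, inner_neg_left]
    rw [h3] at h
    exact self_eq_neg.1 h.symm

/-- The reflection that exchanges the two transverse axes fixes `z`. -/
lemma quadKernel_diag_eq (n q L ρ : ℝ) {j k : Fin 5} (hj : j ≠ 0) (hk : k ≠ 0) :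
    quadKernel n q L (EuclideanSpace.single j 1) (EuclideanSpace.single j 1)
      (EuclideanSpace.single 0 ρ) =
    quadKernel n q L (EuclideanSpace.single k 1) (EuclideanSpace.single k 1)
      (EuclideanSpace.single 0 ρ) := by
  set R := (ℝ ∙ ((EuclideanSpace.single j 1 : E5) - EuclideanSpace.single k 1))ᗮ.reflection
  have h1 : R (EuclideanSpace.single j 1) = EuclideanSpace.single k 1 :=
    Submodule.reflection_sub (by simp)
  have h2 : R (EuclideanSpace.single 0 ρ) = EuclideanSpace.single 0 ρ := by
    refine Submodule.reflection_mem_subspace_eq_self ?_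
    rw [Submodule.mem_orthogonal_singleton_iff_inner_right]
    simp [inner_sub_left, EuclideanSpace.inner_single_left, hj, hk]
  have h := quadKernel_map n q L R (EuclideanSpace.single j 1) (EuclideanSpace.single j 1)
    (EuclideanSpace.single 0 ρ)
  rw [h1, h2] at h
  exact h.symm

/-- The kernels along an axis with a weight `(e₀ |ξ|² + e₂ ξ₀²)`. -/
lemma exists_axis_kernel_le {n q : ℝ} (hn : 1 / 4 < n) (hq : 4 * n + 8 < q) (e₀ e₂ : ℝ) :
    ∃ C, 0 ≤ C ∧ ∀ L δ ρ : ℝ, 1 ≤ L → 0 ≤ δ → 0 ≤ ρ → ρ ≤ L * (1 + δ) →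
    ‖∫ ξ : E5, ((radialWeight n q ‖ξ‖ * (e₀ * ‖ξ‖ ^ 2 + e₂ * ξ 0 ^ 2) : ℝ) : ℂ) *
      Complex.exp (Complex.I * ((L * disp ‖ξ‖ + ρ * ξ 0 : ℝ) : ℂ))‖ ≤ C * kernelRate n L δ := by
  obtain ⟨κ, hκ, hzonal⟩ := exists_integral_zonal
  obtain ⟨C, hC, hbound⟩ := exists_polar_integral_le hn hq e₀ (e₂ - e₀) (-e₂) (by ring)
  refine ⟨κ * C, by positivity, fun L δ ρ hL hδ hρ hρL => ?_⟩
  have := measurable_radialWeight n q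
  have := continuous_disp.measurable
  have h1 := hzonal (fun p => ((radialWeight n q p.1 * (e₀ * p.1 ^ 2 + e₂ * p.2 ^ 2) : ℝ) : ℂ) *
    Complex.exp (Complex.I * ((L * disp p.1 + ρ * p.2 : ℝ) : ℂ))) (by fun_prop)
  have h2 : ∀ᵐ p : ℝ × ℝ ∂((volume.restrict (Set.Ioi 0)).prod
      (volume.restrict (Set.Ioo 0 Real.pi))), ((p.1 ^ 4 * Real.sin p.2 ^ 3 : ℝ) : ℂ) *
      (((radialWeight n q p.1 * (e₀ * p.1 ^ 2 + e₂ * (p.1 * Real.cos p.2) ^ 2) : ℝ) : ℂ) *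
      Complex.exp (Complex.I * ((L * disp p.1 + ρ * (p.1 * Real.cos p.2) : ℝ) : ℂ))) =
      polarIntegrand (4 * n + 7) (-q) L ρ e₀ (e₂ - e₀) (-e₂) p := by
    rw [Measure.prod_restrict]
    refine (ae_restrict_iff' (measurableSet_Ioi.prod measurableSet_Ioo)).2
      (Filter.Eventually.of_forall fun p hp => ?_)
    have hr0 : (0 : ℝ) < p.1 := hp.1
    rw [polarIntegrand, ← mul_assoc, ← Complex.ofReal_mul]
    congr 2
    rw [radialWeight, show 4 * n + 7 = 4 * n + 1 + ((6 : ℕ) : ℝ) by push_cast; ring,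
      Real.rpow_add hr0 (4 * n + 1), Real.rpow_natCast]
    have hs : Real.sin p.2 ^ 3 = Real.sin p.2 * (1 - Real.cos p.2 ^ 2) := by
      rw [← Real.sin_sq]; ring
    rw [hs]
    ring
  rw [h1, integral_congr_ae h2, norm_mul, Complex.norm_real, Real.norm_of_nonneg hκ, mul_assoc]
  exact mul_le_mul_of_nonneg_left (hbound L δ ρ hL hδ hρ hρL) hκ

/-- By rotation invariance `z` may be put on the first axis. There the quadratic form is diagonal
with four equal transverse entries, so it is determined by two zonal integrals: its axial entry,
with weight `ξ₀²`, and its trace, with weight `|ξ|²`. -/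
lemma exists_quadKernel_le {n q : ℝ} (hn : 1 / 4 < n) (hq : 4 * n + 8 < q) :
    ∃ C, 0 ≤ C ∧ ∀ L δ : ℝ, 1 ≤ L → 0 ≤ δ → ∀ a c z : E5, ‖z‖ ≤ L * (1 + δ) →
    ‖quadKernel n q L a c z‖ ≤ C * (‖a‖ * ‖c‖ * kernelRate n L δ) := by
  obtain ⟨C₁, hC₁0, hC₁⟩ := exists_axis_kernel_le hn hq 1 0
  obtain ⟨C₂, hC₂0, hC₂⟩ := exists_axis_kernel_le hn hq 0 1
  refine ⟨5 * (C₁ + 2 * C₂), by positivity, fun L δ hL hδ a c z hz => ?_⟩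
  have hR := kernelRate_nonneg (n := n) (by linarith : 0 ≤ L) hδ
  set v : E5 := EuclideanSpace.single 0 ‖z‖ with hv
  have hvz : ‖v‖ = ‖z‖ := by simp [hv]
  set R := (ℝ ∙ (z - v))ᗮ.reflection with hRdef
  have hRz : R z = v := Submodule.reflection_sub hvz.symm
  rw [← quadKernel_map n q L R a c z, hRz]
  set a' := R a
  set c' := R c
  have ha' : ‖a'‖ = ‖a‖ := R.norm_map a
  have hc' : ‖c'‖ = ‖c‖ := R.norm_map c
  let D : Fin 5 → ℂ := fun j => quadKernel n q L (EuclideanSpace.single j 1)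
    (EuclideanSpace.single j 1) v
  have h0 : ‖D 0‖ ≤ C₂ * kernelRate n L δ := by
    refine le_trans (le_of_eq ?_) (hC₂ L δ ‖z‖ hL hδ (norm_nonneg z) hz)
    congr 1
    refine integral_congr_ae (Filter.Eventually.of_forall fun ξ => ?_)
    simp [quadIntegrand, hv, EuclideanSpace.inner_single_left, pow_two]
  have htr : ‖∑ j, D j‖ ≤ C₁ * kernelRate n L δ := by
    refine le_trans (le_of_eq ?_) (hC₁ L δ ‖z‖ hL hδ (norm_nonneg z) hz)
    congr 1
    simp only [D, quadKernel]
    rw [← integral_finsetSum _ fun j _ => integrable_quadIntegrand hn hq _ _ _ _]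
    refine integral_congr_ae (Filter.Eventually.of_forall fun ξ => ?_)
    simp only [quadIntegrand, hv, EuclideanSpace.inner_single_left, EuclideanSpace.norm_sq_eq,
      map_one, one_mul, zero_mul, add_zero, conj_trivial, Real.norm_eq_abs, sq_abs]
    push_cast
    rw [← Finset.sum_mul, Finset.mul_sum]
    simp only [pow_two]
  have hD : ∀ j, ‖D j‖ ≤ (C₁ + 2 * C₂) * kernelRate n L δ := by
    intro j
    by_cases hj : j = 0
    · subst hj
      have : 0 ≤ (C₁ + C₂) * kernelRate n L δ := by positivity
      linarith
    · have h4 : 4 * D j = (∑ i, D i) - D 0 := by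
        rw [Fin.sum_univ_five]
        have e := fun k (hk : k ≠ 0) => quadKernel_diag_eq n q L ‖z‖ (j := k) (k := j) hk hj
        have e1 : D 1 = D j := e 1 (by decide)
        have e2 : D 2 = D j := e 2 (by decide)
        have e3 : D 3 = D j := e 3 (by decide)
        have e4 : D 4 = D j := e 4 (by decide)
        rw [e1, e2, e3, e4]
        ring
      have h5 := congrArg norm h4
      rw [norm_mul] at h5
      have h6 := norm_sub_le (∑ i, D i) (D 0)
      have h7 : ‖(4 : ℂ)‖ = 4 := by norm_num
      have := norm_nonneg (D j)
      have : 0 ≤ C₂ * kernelRate n L δ := by positivity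
      rw [h7] at h5
      linarith
  have hsum : quadKernel n q L a' c' v = ∑ j, ((a' j * c' j : ℝ) : ℂ) * D j := by
    rw [quadKernel_sum hn hq]
    refine Finset.sum_congr rfl fun j _ => ?_
    rw [Finset.sum_eq_single j]
    · intro k _ hk
      rw [hv, quadKernel_offDiag n q L ‖z‖ hk.symm, mul_zero]
    · simp
  rw [hsum]
  refine (norm_sum_le _ _).trans ?_
  have hterm : ∀ j ∈ Finset.univ, ‖((a' j * c' j : ℝ) : ℂ) * D j‖ ≤
      ‖a‖ * ‖c‖ * ((C₁ + 2 * C₂) * kernelRate n L δ) := by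
    intro j _
    rw [norm_mul, Complex.norm_real, norm_mul, ← ha', ← hc']
    exact mul_le_mul (mul_le_mul (PiLp.norm_apply_le a' j) (PiLp.norm_apply_le c' j)
      (norm_nonneg _) (norm_nonneg _)) (hD j) (norm_nonneg _) (by positivity)
  refine (Finset.sum_le_sum hterm).trans (le_of_eq ?_)
  rw [Finset.sum_const, Finset.card_univ, Fintype.card_fin]
  simp only [nsmul_eq_mul]
  push_cast
  ring

/-- The decay rate of the kernels, regularized at `L = 0`. -/
noncomputable def decayRate (n L δ : ℝ) : ℝ :=
  (1 + L) ^ (-2 : ℝ) * min 1 δ ^ (2 * n + 3) + (1 + L) ^ (-(7 / 2) : ℝ)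

lemma decayRate_nonneg {n L δ : ℝ} (hL : 0 ≤ L) (hδ : 0 ≤ δ) : 0 ≤ decayRate n L δ := by
  have : 0 ≤ min 1 δ := le_min zero_le_one hδ
  unfold decayRate
  positivity

/-- The decay of the kernels, for all times. -/
lemma exists_quadKernel_le_decayRate {n q : ℝ} (hn : 1 / 4 < n) (hq : 4 * n + 8 < q) :
    ∃ C, 0 ≤ C ∧ ∀ L δ : ℝ, 0 ≤ L → 0 ≤ δ → ∀ a c z : E5, ‖z‖ ≤ L * (1 + δ) →
    ‖quadKernel n q L a c z‖ ≤ C * (‖a‖ * ‖c‖ * decayRate n L δ) := by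
  obtain ⟨C, hC0, hC⟩ := exists_quadKernel_le hn hq
  set I := ∫ ξ : E5, radialWeight n q ‖ξ‖ * ‖ξ‖ ^ 2
  have hI : 0 ≤ I := integral_nonneg fun ξ =>
    mul_nonneg (radialWeight_nonneg (norm_nonneg ξ)) (by positivity)
  refine ⟨16 * C + 16 * I, by positivity, fun L δ hL hδ a c z hz => ?_⟩
  have hm : 0 ≤ min 1 δ := le_min zero_le_one hδ
  have h16 : (2 : ℝ) ^ ((7 : ℝ) / 2) ≤ 16 := by
    calc (2 : ℝ) ^ ((7 : ℝ) / 2) ≤ 2 ^ (4 : ℝ) :=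
          Real.rpow_le_rpow_of_exponent_le (by norm_num) (by norm_num)
      _ = 16 := by norm_num
  have hD := decayRate_nonneg (n := n) hL hδ
  have hac : 0 ≤ ‖a‖ * ‖c‖ := by positivity
  -- For `L ≥ 1` the quantities `L` and `1 + L` are comparable; for `L < 1` the rate is bounded
  -- below and absolute convergence suffices.
  rcases le_or_gt 1 L with h1 | h1
  · have hL0 : 0 < L := by linarith
    have hi : L⁻¹ ≤ 2 * (1 + L)⁻¹ := by
      rw [inv_le_comm₀ hL0 (by positivity), mul_inv, inv_inv]
      linarith
    have hrate : kernelRate n L δ ≤ 16 * decayRate n L δ := by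
      have e1 : L⁻¹ ^ 2 ≤ 16 * (1 + L) ^ (-2 : ℝ) := by
        have := pow_le_pow_left₀ (by positivity) hi 2
        rw [Real.rpow_neg (by positivity), Real.rpow_two, ← inv_pow]
        have h0 : 0 ≤ (1 + L)⁻¹ ^ 2 := by positivity
        rw [mul_pow] at this
        linarith
      have e2 : L⁻¹ ^ ((7 : ℝ) / 2) ≤ 16 * (1 + L) ^ (-(7 / 2) : ℝ) := by
        have := Real.rpow_le_rpow (by positivity) hi (by norm_num : (0 : ℝ) ≤ 7 / 2)
        rw [Real.mul_rpow (by norm_num) (by positivity)] at this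
        rw [Real.rpow_neg (by positivity), ← Real.inv_rpow (by positivity)]
        exact this.trans (mul_le_mul_of_nonneg_right h16 (by positivity))
      have e3 := mul_le_mul_of_nonneg_right e1 (by positivity : 0 ≤ min 1 δ ^ (2 * n + 3))
      unfold kernelRate decayRate
      linarith
    have e4 := hC L δ h1 hδ a c z hz
    have e5 := mul_le_mul_of_nonneg_left (mul_le_mul_of_nonneg_left hrate hac) hC0
    have : 0 ≤ 16 * I * (‖a‖ * ‖c‖ * decayRate n L δ) := by positivity
    linarith
  · have e1 := norm_quadKernel_le hn hq L a c z
    have e2 : 1 ≤ 16 * decayRate n L δ := by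
      have h2 : (2 : ℝ) ^ (-(7 / 2) : ℝ) ≤ (1 + L) ^ (-(7 / 2) : ℝ) :=
        Real.rpow_le_rpow_of_nonpos (by linarith) (by linarith) (by norm_num)
      have h3 : 1 ≤ 16 * (2 : ℝ) ^ (-(7 / 2) : ℝ) := by
        rw [Real.rpow_neg (by norm_num), ← div_eq_mul_inv, le_div_iff₀ (by positivity), one_mul]
        exact h16
      have : 0 ≤ (1 + L) ^ (-2 : ℝ) * min 1 δ ^ (2 * n + 3) := by positivity
      unfold decayRate
      linarith
    have e3 := mul_le_mul_of_nonneg_left e2 (mul_nonneg hac hI)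
    have : 0 ≤ 16 * C * (‖a‖ * ‖c‖ * decayRate n L δ) := by positivity
    linarith


/-! ### Functions of polynomial growth with their derivatives -/

/-- Functions which grow at most like `(1 + |x|)^p` together with their first `K` derivatives. -/
def GrowthClass (p : ℝ) : ℕ → (E5 → ℝ) → Prop
  | 0, v => Continuous v ∧ ∃ C, ∀ x, |v x| ≤ C * (1 + ‖x‖) ^ p
  | K + 1, v => (Continuous v ∧ ∃ C, ∀ x, |v x| ≤ C * (1 + ‖x‖) ^ p) ∧
      ∀ i : Fin 5, ∃ v' : E5 → ℝ,
        (∀ x, HasLineDerivAt ℝ v (v' x) x (EuclideanSpace.single i 1)) ∧ GrowthClass p K v'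

namespace GrowthClass

variable {p q : ℝ} {K : ℕ} {u v : E5 → ℝ}

lemma one_add_norm_pos (x : E5) : 0 < 1 + ‖x‖ := by positivity

lemma base (hv : GrowthClass p K v) : Continuous v ∧ ∃ C, ∀ x, |v x| ≤ C * (1 + ‖x‖) ^ p := by
  cases K with
  | zero => exact hv
  | succ K => exact hv.1

lemma of_succ (hv : GrowthClass p (K + 1) v) : GrowthClass p K v := by
  induction K generalizing v with
  | zero => exact hv.1
  | succ K ih =>
    refine ⟨hv.1, fun i => ?_⟩
    obtain ⟨v', h1, h2⟩ := hv.2 i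
    exact ⟨v', h1, ih h2⟩

lemma mono (hpq : p ≤ q) (hv : GrowthClass p K v) : GrowthClass q K v := by
  have key : ∀ {v : E5 → ℝ}, (Continuous v ∧ ∃ C, ∀ x, |v x| ≤ C * (1 + ‖x‖) ^ p) →
      Continuous v ∧ ∃ C, ∀ x, |v x| ≤ C * (1 + ‖x‖) ^ q := by
    rintro v ⟨h1, C, hC⟩
    refine ⟨h1, |C|, fun x => (hC x).trans ?_⟩
    have h2 : (1 + ‖x‖) ^ p ≤ (1 + ‖x‖) ^ q :=
      Real.rpow_le_rpow_of_exponent_le (by linarith [norm_nonneg x]) hpq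
    exact mul_le_mul (le_abs_self C) h2 (Real.rpow_nonneg (one_add_norm_pos x).le _)
      (abs_nonneg C)
  induction K generalizing v with
  | zero => exact key hv
  | succ K ih =>
    refine ⟨key hv.1, fun i => ?_⟩
    obtain ⟨v', h1, h2⟩ := hv.2 i
    exact ⟨v', h1, ih h2⟩

lemma add (hu : GrowthClass p K u) (hv : GrowthClass p K v) :
    GrowthClass p K (fun x => u x + v x) := by
  have key : ∀ {u v : E5 → ℝ}, (Continuous u ∧ ∃ C, ∀ x, |u x| ≤ C * (1 + ‖x‖) ^ p) →
      (Continuous v ∧ ∃ C, ∀ x, |v x| ≤ C * (1 + ‖x‖) ^ p) →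
      Continuous (fun x => u x + v x) ∧ ∃ C, ∀ x, |u x + v x| ≤ C * (1 + ‖x‖) ^ p := by
    rintro u v ⟨h1, C, hC⟩ ⟨h2, D, hD⟩
    refine ⟨h1.add h2, C + D, fun x => ?_⟩
    linarith [abs_add_le (u x) (v x), hC x, hD x]
  induction K generalizing u v with
  | zero => exact key hu hv
  | succ K ih =>
    refine ⟨key hu.1 hv.1, fun i => ?_⟩
    obtain ⟨u', h1, h2⟩ := hu.2 i
    obtain ⟨v', h3, h4⟩ := hv.2 i
    exact ⟨fun x => u' x + v' x, fun x => HasDerivAt.add (h1 x) (h3 x), ih h2 h4⟩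

lemma mul (hu : GrowthClass p K u) (hv : GrowthClass q K v) :
    GrowthClass (p + q) K (fun x => u x * v x) := by
  have key : ∀ {u v : E5 → ℝ}, (Continuous u ∧ ∃ C, ∀ x, |u x| ≤ C * (1 + ‖x‖) ^ p) →
      (Continuous v ∧ ∃ C, ∀ x, |v x| ≤ C * (1 + ‖x‖) ^ q) →
      Continuous (fun x => u x * v x) ∧ ∃ C, ∀ x, |u x * v x| ≤ C * (1 + ‖x‖) ^ (p + q) := by
    rintro u v ⟨h1, C, hC⟩ ⟨h2, D, hD⟩
    refine ⟨h1.mul h2, C * D, fun x => ?_⟩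
    rw [abs_mul, Real.rpow_add (one_add_norm_pos x)]
    calc _ ≤ C * (1 + ‖x‖) ^ p * (D * (1 + ‖x‖) ^ q) :=
          mul_le_mul (hC x) (hD x) (abs_nonneg _) ((abs_nonneg _).trans (hC x))
      _ = _ := by ring
  induction K generalizing u v with
  | zero => exact key hu hv
  | succ K ih =>
    refine ⟨key hu.1 hv.1, fun i => ?_⟩
    obtain ⟨u', h1, h2⟩ := hu.2 i
    obtain ⟨v', h3, h4⟩ := hv.2 i
    refine ⟨fun x => u' x * v x + u x * v' x, fun x => ?_,
      (ih h2 hv.of_succ).add (ih hu.of_succ h4)⟩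
    have h := HasDerivAt.mul (h1 x) (h3 x)
    rw [HasLineDerivAt]
    convert! h using 1
    simp

lemma const (c : ℝ) (K : ℕ) : GrowthClass 0 K (fun _ => c) := by
  induction K generalizing c with
  | zero => exact ⟨continuous_const, |c|, fun x => by simp⟩
  | succ K ih =>
    exact ⟨⟨continuous_const, |c|, fun x => by simp⟩,
      fun i => ⟨fun _ => 0, fun x => hasDerivAt_const _ _, ih 0⟩⟩

lemma coord (j : Fin 5) (K : ℕ) : GrowthClass 1 K (fun x => x j) := by
  have hb : Continuous (fun x : E5 => x j) ∧ ∃ C, ∀ x : E5, |x j| ≤ C * (1 + ‖x‖) ^ (1 : ℝ) := by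
    refine ⟨by fun_prop, 1, fun x => ?_⟩
    rw [Real.rpow_one, one_mul]
    have := PiLp.norm_apply_le x j
    rw [Real.norm_eq_abs] at this
    linarith
  cases K with
  | zero => exact hb
  | succ K =>
    refine ⟨hb, fun i => ⟨fun _ => (EuclideanSpace.single i (1 : ℝ) : E5) j, fun x => ?_,
      (const _ K).mono zero_le_one⟩⟩
    have h := ((hasDerivAt_id (0 : ℝ)).mul_const
      ((EuclideanSpace.single i (1 : ℝ) : E5) j)).const_add (x j)
    simpa [HasLineDerivAt] using h

lemma sum {ι : Type*} (s : Finset ι) {f : ι → E5 → ℝ} (hp : 0 ≤ p)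
    (hf : ∀ i ∈ s, GrowthClass p K (f i)) : GrowthClass p K (fun x => ∑ i ∈ s, f i x) := by
  classical
  induction s using Finset.induction_on with
  | empty => simpa using (const 0 K).mono hp
  | insert a s ha ih =>
    simp only [Finset.sum_insert ha]
    exact (hf a (by simp)).add (ih fun i hi => hf i (by simp [hi]))

/-- Derivatives are `-v' v⁻²`, of order `p - 2p = -p`, and the induction hypothesis applies to
`v⁻¹`. -/
lemma inv {c : ℝ} (hc : 0 < c) (hv : GrowthClass p K v) (hlow : ∀ x, c * (1 + ‖x‖) ^ p ≤ v x) :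
    GrowthClass (-p) K (fun x => (v x)⁻¹) := by
  have hpos : ∀ x, 0 < v x := fun x =>
    (mul_pos hc (Real.rpow_pos_of_pos (one_add_norm_pos x) _)).trans_le (hlow x)
  have hb : Continuous (fun x => (v x)⁻¹) ∧ ∃ C, ∀ x, |(v x)⁻¹| ≤ C * (1 + ‖x‖) ^ (-p) := by
    refine ⟨hv.base.1.inv₀ fun x => (hpos x).ne', c⁻¹, fun x => ?_⟩
    rw [abs_of_pos (inv_pos.2 (hpos x)), Real.rpow_neg (one_add_norm_pos x).le, ← mul_inv]
    exact inv_anti₀ (mul_pos hc (Real.rpow_pos_of_pos (one_add_norm_pos x) _)) (hlow x)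
  induction K with
  | zero => exact hb
  | succ K ih =>
    refine ⟨hb, fun i => ?_⟩
    obtain ⟨v', h1, h2⟩ := hv.2 i
    have hi := ih hv.of_succ
    refine ⟨fun x => -1 * (v' x * ((v x)⁻¹ * (v x)⁻¹)), fun x => ?_, ?_⟩
    · have h := HasDerivAt.inv (h1 x) (by simpa using (hpos x).ne')
      have hx := (hpos x).ne'
      simp only [zero_smul, add_zero] at h
      rw [HasLineDerivAt]
      convert! h using 1
      field_simp
    · have h3 := (const (-1) K).mul (h2.mul (hi.mul hi))
      rwa [show 0 + (p + (-p + -p)) = -p by ring] at h3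

/-- The weight relating `V` and `(1 + |x|⁴) V`. -/
lemma inv_one_add_norm_pow_four (K : ℕ) :
    GrowthClass (-4) K (fun x => (1 + ‖x‖ ^ 4)⁻¹) := by
  have h2 : GrowthClass (1 + 1) K (fun x : E5 => ∑ i, x i * x i) :=
    sum _ (by norm_num) fun i _ => (coord i K).mul (coord i K)
  have h4 : GrowthClass 4 K (fun x : E5 => 1 + ‖x‖ ^ 4) := by
    have h3 := ((const 1 K).mono (by norm_num : (0 : ℝ) ≤ 1 + 1 + (1 + 1))).add (h2.mul h2)
    rw [show (1 : ℝ) + 1 + (1 + 1) = 4 by norm_num] at h3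
    convert h3 using 2 with x
    have : ‖x‖ ^ 2 = ∑ i, x i * x i := by
      rw [EuclideanSpace.norm_sq_eq]
      simp [← pow_two]
    rw [← this]
    ring
  -- The constant comes from the convexity inequality `(1 + x)⁴ ≤ 8(1 + x⁴)`.
  refine h4.inv (c := 1 / 8) (by norm_num) fun x => ?_
  have hx := norm_nonneg x
  rw [show (4 : ℝ) = ((4 : ℕ) : ℝ) by norm_num, Real.rpow_natCast]
  nlinarith [sq_nonneg (‖x‖ - 1), sq_nonneg (‖x‖ ^ 2 - 1), mul_nonneg hx (sq_nonneg (‖x‖ - 1)),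
    sq_nonneg (‖x‖ ^ 2 - ‖x‖)]

end GrowthClass

/-! ### Fourier transforms of weighted square-integrable functions -/

/-- The Fourier transform of complex-valued functions, with the convention of `paperFourier`. -/
noncomputable def cFourier (F : E5 → ℂ) (ξ : E5) : ℂ :=
  ∫ x : E5, Complex.exp (-(Complex.I * ((inner ℝ x ξ : ℝ) : ℂ))) * F x

lemma norm_exp_neg_I (x : ℝ) : ‖Complex.exp (-(Complex.I * (x : ℂ)))‖ = 1 := by
  rw [← mul_neg, ← Complex.ofReal_neg, mul_comm, Complex.norm_exp_ofReal_mul_I]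

/-- Square-integrable functions. -/
abbrev L2 : Type := Lp ℂ 2 (volume : Measure E5)

/-- Pairing with a fixed square-integrable function is continuous. -/
lemma exists_cFourier_functional {u : E5 → ℝ} (hu : MemLp u 2 volume) (ξ : E5) :
    ∃ Λ : L2 →L[ℂ] ℂ, ∀ f : L2, Λ f = cFourier (fun x => (u x : ℂ) * f x) ξ := by
  have hk : MemLp (fun x : E5 => (starRingEnd ℂ)
      (Complex.exp (-(Complex.I * ((inner ℝ x ξ : ℝ) : ℂ))) * (u x : ℂ))) 2 volume := by
    refine MemLp.of_le hu ?_ (Filter.Eventually.of_forall fun x => ?_)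
    · have h1 : AEStronglyMeasurable (fun x : E5 => (u x : ℂ)) volume :=
        Complex.continuous_ofReal.comp_aestronglyMeasurable hu.1
      have h2 : AEStronglyMeasurable (fun x : E5 =>
          Complex.exp (-(Complex.I * ((inner ℝ x ξ : ℝ) : ℂ)))) volume :=
        Continuous.aestronglyMeasurable (by fun_prop)
      exact Complex.continuous_conj.comp_aestronglyMeasurable (h2.mul h1)
    · rw [RCLike.norm_conj, norm_mul, norm_exp_neg_I, one_mul, Complex.norm_real]
  refine ⟨innerSL ℂ hk.toLp, fun f => ?_⟩
  rw [innerSL_apply_apply, L2.inner_def, cFourier]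
  refine integral_congr_ae ?_
  filter_upwards [hk.coeFn_toLp] with x hx
  rw [hx, RCLike.inner_apply, starRingEnd_self_apply]
  ring

/-- The square of the weight is `(1 + |x|)⁻⁸`, and `8 > 5`. -/
lemma memLp_of_le_weight {u : E5 → ℝ} (hu : Continuous u) {C : ℝ}
    (hC : ∀ x, |u x| ≤ C * (1 + ‖x‖) ^ (-4 : ℝ)) : MemLp u 2 volume := by
  rw [memLp_two_iff_integrable_sq hu.aestronglyMeasurable]
  have h := (integrable_one_add_norm (E := E5) (μ := volume) (r := 8)
    (by simp; norm_num)).const_mul (C ^ 2)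
  refine h.mono' (hu.pow 2).aestronglyMeasurable (Filter.Eventually.of_forall fun x => ?_)
  rw [Real.norm_eq_abs, abs_pow]
  refine (pow_le_pow_left₀ (abs_nonneg _) (hC x) 2).trans (le_of_eq ?_)
  rw [mul_pow, ← Real.rpow_natCast ((1 + ‖x‖) ^ (-4 : ℝ)),
    ← Real.rpow_mul (GrowthClass.one_add_norm_pos x).le]
  norm_num

lemma memLp_mul {m : E5 → ℂ} (hm : Continuous m) {C : ℝ} (hC : ∀ ξ, ‖m ξ‖ ≤ C) (H : L2) :
    MemLp (fun ξ => m ξ * H ξ) 2 volume :=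
  MemLp.of_le_mul (Lp.memLp H) (hm.aestronglyMeasurable.mul (Lp.aestronglyMeasurable H))
    (c := C) (Filter.Eventually.of_forall fun ξ => by
      rw [norm_mul]; exact mul_le_mul_of_nonneg_right (hC ξ) (norm_nonneg _))

/-- Multiplication by a bounded continuous function, on `L²`. -/
noncomputable def mulL2 (m : E5 → ℂ) (hm : Continuous m) (C : ℝ) (hC : ∀ ξ, ‖m ξ‖ ≤ C) :
    L2 →L[ℂ] L2 :=
  LinearMap.mkContinuous
    { toFun := fun H => (memLp_mul hm hC H).toLp
      map_add' := fun H G => by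
        rw [← MemLp.toLp_add]
        refine MemLp.toLp_congr _ _ ?_
        filter_upwards [Lp.coeFn_add H G] with ξ hξ
        rw [hξ, Pi.add_apply, Pi.add_apply, mul_add]
      map_smul' := fun c H => by
        rw [RingHom.id_apply, ← MemLp.toLp_const_smul]
        refine MemLp.toLp_congr _ _ ?_
        filter_upwards [Lp.coeFn_smul c H] with ξ hξ
        rw [hξ, Pi.smul_apply, Pi.smul_apply, smul_eq_mul, smul_eq_mul, mul_left_comm] }
    C fun H => by
      refine Lp.norm_le_mul_norm_of_ae_le_mul ?_
      filter_upwards [(memLp_mul hm hC H).coeFn_toLp] with ξ hξ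
      change ‖(memLp_mul hm hC H).toLp _ ξ‖ ≤ _
      rw [hξ, norm_mul]
      exact mul_le_mul_of_nonneg_right (hC ξ) (norm_nonneg _)

lemma coeFn_mulL2 (m : E5 → ℂ) (hm : Continuous m) (C : ℝ) (hC : ∀ ξ, ‖m ξ‖ ≤ C) (H : L2) :
    mulL2 m hm C hC H =ᵐ[volume] fun ξ => m ξ * H ξ :=
  (memLp_mul hm hC H).coeFn_toLp

lemma norm_mulL2_le (m : E5 → ℂ) (hm : Continuous m) (C : ℝ) (hC : ∀ ξ, ‖m ξ‖ ≤ C) (H : L2) :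
    ‖mulL2 m hm C hC H‖ ≤ C * ‖H‖ := by
  refine Lp.norm_le_mul_norm_of_ae_le_mul ?_
  filter_upwards [coeFn_mulL2 m hm C hC H] with ξ hξ
  rw [hξ, norm_mul]
  exact mul_le_mul_of_nonneg_right (hC ξ) (norm_nonneg _)

lemma mulL2_comm (m m' : E5 → ℂ) (hm : Continuous m) (hm' : Continuous m') (C C' : ℝ)
    (hC : ∀ ξ, ‖m ξ‖ ≤ C) (hC' : ∀ ξ, ‖m' ξ‖ ≤ C') :
    Commute (mulL2 m hm C hC) (mulL2 m' hm' C' hC') := by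
  ext1 H
  refine Lp.ext ?_
  change (mulL2 m hm C hC (mulL2 m' hm' C' hC' H) : E5 → ℂ) =ᵐ[volume]
    (mulL2 m' hm' C' hC' (mulL2 m hm C hC H) : E5 → ℂ)
  filter_upwards [coeFn_mulL2 m hm C hC H, coeFn_mulL2 m' hm' C' hC' H,
    coeFn_mulL2 m hm C hC (mulL2 m' hm' C' hC' H), coeFn_mulL2 m' hm' C' hC' (mulL2 m hm C hC H)]
    with ξ h1 h2 h3 h4
  rw [h3, h4, h1, h2]
  ring


/-! ### Trading weights for derivatives under the Fourier transform -/

/-- The symbol `(1 + |ξ|²)^{-1/2}`. -/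
noncomputable def invBracket (ξ : E5) : ℝ := (1 + ‖ξ‖ ^ 2) ^ (-1 / 2 : ℝ)

lemma invBracket_pos (ξ : E5) : 0 < invBracket ξ := by unfold invBracket; positivity

lemma hasTemperateGrowth_invBracket : invBracket.HasTemperateGrowth :=
  Function.hasTemperateGrowth_one_add_norm_sq_rpow E5 _

lemma continuous_invBracket : Continuous invBracket :=
  hasTemperateGrowth_invBracket.1.continuous

lemma invBracket_sq (ξ : E5) : invBracket ξ ^ 2 = (1 + ‖ξ‖ ^ 2)⁻¹ := by
  unfold invBracket
  rw [← Real.rpow_natCast, ← Real.rpow_mul (by positivity), ← Real.rpow_neg_one]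
  norm_num

lemma invBracket_le_one (ξ : E5) : invBracket ξ ≤ 1 :=
  Real.rpow_le_one_of_one_le_of_nonpos (by nlinarith [norm_nonneg ξ]) (by norm_num)

lemma abs_coord_mul_invBracket_le_one (i : Fin 5) (ξ : E5) : |ξ i| * invBracket ξ ≤ 1 := by
  have h1 : |ξ i| ≤ ‖ξ‖ := by simpa using PiLp.norm_apply_le ξ i
  have h2 : ‖ξ‖ * invBracket ξ ≤ 1 := by
    have h3 := invBracket_sq ξ
    have h4 : (‖ξ‖ * invBracket ξ) ^ 2 ≤ 1 := by
      rw [mul_pow, h3, ← div_eq_mul_inv, div_le_one (by positivity)]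
      linarith
    exact (abs_le_one_iff_mul_self_le_one.2 (by nlinarith)) |> fun h => (le_abs_self _).trans h
  exact (mul_le_mul_of_nonneg_right h1 (invBracket_pos ξ).le).trans h2

/-- Multiplication by `(1 + |ξ|²)^{-1/2}` on `L²`. -/
noncomputable def bracketOp : L2 →L[ℂ] L2 :=
  mulL2 (fun ξ => (invBracket ξ : ℂ)) (by have := continuous_invBracket; fun_prop) 1 fun ξ => by
    rw [Complex.norm_real, Real.norm_eq_abs, abs_of_pos (invBracket_pos ξ)]
    exact invBracket_le_one ξ

/-- Multiplication by `2πi ξ_i (1 + |ξ|²)^{-1/2}` on `L²`. -/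
noncomputable def rieszOp (i : Fin 5) : L2 →L[ℂ] L2 :=
  mulL2 (fun ξ => 2 * Real.pi * Complex.I * (((ξ i : ℝ) : ℂ) * (invBracket ξ : ℂ)))
    (by have := continuous_invBracket; fun_prop) (2 * Real.pi) fun ξ => by
      rw [norm_mul, norm_mul, norm_mul, norm_mul, Complex.norm_I, Complex.norm_real,
        Complex.norm_real, Complex.norm_real, Real.norm_eq_abs, Real.norm_eq_abs (ξ i),
        Real.norm_eq_abs (invBracket ξ), abs_of_pos (invBracket_pos ξ), abs_of_pos Real.pi_pos]
      norm_num
      have := abs_coord_mul_invBracket_le_one i ξ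
      nlinarith [Real.pi_pos]

lemma bracketOp_comm_rieszOp (i : Fin 5) : Commute bracketOp (rieszOp i) := mulL2_comm _ _ _ _ _ _ _ _

/-- The symbol has temperate growth, so the operator preserves Schwartz functions. Integration by
parts can then be done on these and extended by density. -/
lemma bracketOp_toLp (S : SchwartzMap E5 ℂ) :
    bracketOp (S.toLp 2) = (SchwartzMap.smulLeftCLM ℂ invBracket S).toLp 2 := by
  refine Lp.ext ?_
  filter_upwards [coeFn_mulL2 (fun ξ => (invBracket ξ : ℂ))
      (by have := continuous_invBracket; fun_prop) 1 (fun ξ => by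
    rw [Complex.norm_real, Real.norm_eq_abs, abs_of_pos (invBracket_pos ξ)]
    exact invBracket_le_one ξ) (S.toLp 2),
    S.coeFn_toLp 2 volume, (SchwartzMap.smulLeftCLM ℂ invBracket S).coeFn_toLp 2 volume]
    with ξ h1 h2 h3
  rw [h3, SchwartzMap.smulLeftCLM_apply_apply hasTemperateGrowth_invBracket]
  refine Eq.trans h1 ?_
  rw [h2]
  rfl

open LineDeriv in
lemma fourierInv_rieszOp_toLp (i : Fin 5) (S : SchwartzMap E5 ℂ) :
    𝓕⁻ (rieszOp i (S.toLp 2)) =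
      (∂_{(EuclideanSpace.single i (1 : ℝ) : E5)}
        (𝓕⁻ (SchwartzMap.smulLeftCLM ℂ invBracket S) : SchwartzMap E5 ℂ)).toLp 2 := by
  rw [SchwartzMap.lineDerivOp_fourierInv_eq, ← SchwartzMap.toLp_fourierInv_eq]
  congr 1
  refine Lp.ext ?_
  have h1 : rieszOp i (S.toLp 2) =ᵐ[volume] fun ξ =>
      2 * Real.pi * Complex.I * (((ξ i : ℝ) : ℂ) * (invBracket ξ : ℂ)) * (S.toLp 2 volume : L2) ξ :=
    coeFn_mulL2 _ _ _ _ _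
  filter_upwards [h1, S.coeFn_toLp 2 volume, SchwartzMap.coeFn_toLp ((2 * Real.pi * Complex.I) •
    SchwartzMap.smulLeftCLM ℂ (inner ℝ · (EuclideanSpace.single i (1 : ℝ) : E5))
      (SchwartzMap.smulLeftCLM ℂ invBracket S)) 2 volume] with ξ h1 h2 h3
  rw [h3, h1, h2, smul_apply, SchwartzMap.smulLeftCLM_apply_apply (by fun_prop),
    SchwartzMap.smulLeftCLM_apply_apply hasTemperateGrowth_invBracket]
  simp [EuclideanSpace.inner_single_right]
  ring

-- Integrate by parts along the `i`-th direction: the derivative falls on the exponential, on `v` or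
-- on `g`. Boundedness of `v` and `v'` is enough since `g` is a Schwartz function.
open LineDeriv in
lemma cFourier_lineDeriv_schwartz {v v' : E5 → ℝ} {i : Fin 5} (hv : Continuous v)
    (hv' : Continuous v') {C : ℝ} (hC : ∀ x, |v x| ≤ C) (hC' : ∀ x, |v' x| ≤ C)
    (hd : ∀ x, HasLineDerivAt ℝ v (v' x) x (EuclideanSpace.single i 1))
    (g : SchwartzMap E5 ℂ) (ξ : E5) :
    cFourier (fun x => (v' x : ℂ) * g x) ξ +
        cFourier (fun x => (v x : ℂ) * (∂_{(EuclideanSpace.single i (1 : ℝ) : E5)} g) x) ξ =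
      Complex.I * ((ξ i : ℝ) : ℂ) * cFourier (fun x => (v x : ℂ) * g x) ξ := by
  set e : E5 := EuclideanSpace.single i (1 : ℝ)
  set E : E5 → ℂ := fun x => Complex.exp (-(Complex.I * ((inner ℝ x ξ : ℝ) : ℂ))) with hE
  have hEc : Continuous E := by fun_prop
  have hint : ∀ {w : E5 → ℝ} (_ : Continuous w) (_ : ∀ x, |w x| ≤ C) (G : SchwartzMap E5 ℂ),
      Integrable (fun x => E x * ((w x : ℂ) * G x)) volume := by
    intro w hw hwC G
    have := (G.integrable (μ := volume)).bdd_mul (f := fun x => E x * (w x : ℂ)) (c := C)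
      (Continuous.aestronglyMeasurable (by fun_prop)) (Filter.Eventually.of_forall fun x => by
        rw [norm_mul, norm_exp_neg_I, one_mul, Complex.norm_real]; exact hwC x)
    simpa only [mul_assoc] using this
  have hi1 := hint hv' hC' g
  have hi2 := hint hv hC (∂_{e} g)
  have hi3 := hint hv hC g
  have hinner : ∀ x, HasLineDerivAt ℝ (fun x : E5 => (inner ℝ x ξ : ℝ)) (ξ i) x e := fun x => by
    have h := (hasFDerivAt_id (𝕜 := ℝ) x).inner ℝ (hasFDerivAt_const ξ x)
    have h2 := h.hasLineDerivAt e
    simpa [e, EuclideanSpace.inner_single_left] using h2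
  have hf : ∀ x, HasLineDerivAt ℝ (fun x => E x * (v x : ℂ))
      (-(Complex.I * ((ξ i : ℝ) : ℂ)) * (E x * (v x : ℂ)) + E x * (v' x : ℂ)) x e := fun x => by
    have h1 := HasDerivAt.cexp (((HasDerivAt.ofReal_comp (hinner x)).const_mul Complex.I).neg)
    have h2 := h1.mul (HasDerivAt.ofReal_comp (hd x))
    rw [HasLineDerivAt]
    convert! h2 using 1
    simp [hE]
    ring
  have hg : ∀ x, HasLineDerivAt ℝ g ((∂_{e} g : SchwartzMap E5 ℂ) x) x e := fun x => by
    rw [SchwartzMap.lineDerivOp_apply]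
    exact (g.differentiableAt.hasFDerivAt.hasLineDerivAt e).lineDifferentiableAt.hasLineDerivAt
  have key := integral_bilinear_hasLineDerivAt_right_eq_neg_left_of_integrable
    (μ := (volume : Measure E5)) (v := e) (B := ContinuousLinearMap.mul ℝ ℂ)
    (f := fun x => E x * (v x : ℂ))
    (f' := fun x => -(Complex.I * ((ξ i : ℝ) : ℂ)) * (E x * (v x : ℂ)) + E x * (v' x : ℂ))
    (g := g) (g' := fun x => (∂_{e} g : SchwartzMap E5 ℂ) x)
    (by
      simp only [ContinuousLinearMap.mul_apply', mul_assoc, add_mul]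
      exact (hi3.const_mul _).add hi1)
    (by simpa only [ContinuousLinearMap.mul_apply', mul_assoc] using hi2)
    (by simpa only [ContinuousLinearMap.mul_apply', mul_assoc] using hi3)
    (fun x _ => hf x) (fun x _ => hg x)
  simp only [ContinuousLinearMap.mul_apply', mul_assoc, add_mul] at key
  rw [integral_add (hi3.const_mul _) hi1, integral_const_mul] at key
  change (∫ x, E x * ((v' x : ℂ) * g x)) +
    (∫ x, E x * ((v x : ℂ) * (∂_{e} g : SchwartzMap E5 ℂ) x)) = _ * ∫ x, E x * ((v x : ℂ) * g x)
  rw [key]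
  ring

lemma le_of_weight {v : E5 → ℝ} {C : ℝ} (hC : ∀ x, |v x| ≤ C * (1 + ‖x‖) ^ (-4 : ℝ)) (x : E5) :
    |v x| ≤ |C| :=
  (hC x).trans <| (mul_le_mul_of_nonneg_right (le_abs_self C) (by positivity)).trans <|
    mul_le_of_le_one_right (abs_nonneg C)
      (Real.rpow_le_one_of_one_le_of_nonpos (by linarith [norm_nonneg x]) (by norm_num))

/-- Integration by parts, with one derivative falling on a function whose Fourier transform has
been divided by `(1 + |ξ|²)^{1/2}`. -/
lemma cFourier_lineDeriv {v v' : E5 → ℝ} {i : Fin 5} (hv : Continuous v)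
    (hv' : Continuous v') {C C' : ℝ} (hC : ∀ x, |v x| ≤ C * (1 + ‖x‖) ^ (-4 : ℝ))
    (hC' : ∀ x, |v' x| ≤ C' * (1 + ‖x‖) ^ (-4 : ℝ))
    (hd : ∀ x, HasLineDerivAt ℝ v (v' x) x (EuclideanSpace.single i 1)) (H : L2) (ξ : E5) :
    cFourier (fun x => (v' x : ℂ) * (𝓕⁻ (bracketOp H) : L2) x) ξ +
        cFourier (fun x => (v x : ℂ) * (𝓕⁻ (rieszOp i H) : L2) x) ξ =
      Complex.I * ((ξ i : ℝ) : ℂ) * cFourier (fun x => (v x : ℂ) * (𝓕⁻ (bracketOp H) : L2) x) ξ := by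
  obtain ⟨Λ, hΛ⟩ := exists_cFourier_functional (memLp_of_le_weight hv hC) ξ
  obtain ⟨Λ', hΛ'⟩ := exists_cFourier_functional (memLp_of_le_weight hv' hC') ξ
  rw [← hΛ', ← hΛ, ← hΛ]
  have hcont : Continuous fun f : L2 => (𝓕⁻ f : L2) :=
    ContinuousFourierInv.continuous_fourierInv
  -- At fixed `ξ` both sides are continuous in `H` for the `L²` norm, because `v` and `v'` are
  -- square-integrable; so it suffices to take Schwartz functions.
  refine congrFun (DenseRange.equalizer (SchwartzMap.denseRange_toLpCLM (E := E5) (F := ℂ) (p := 2)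
    (μ := volume) ENNReal.ofNat_ne_top)
    (?_ : Continuous fun H => Λ' (𝓕⁻ (bracketOp H)) + Λ (𝓕⁻ (rieszOp i H)))
    (?_ : Continuous fun H => Complex.I * ((ξ i : ℝ) : ℂ) * Λ (𝓕⁻ (bracketOp H))) ?_) H
  · exact (Λ'.continuous.comp (hcont.comp bracketOp.continuous)).add
      (Λ.continuous.comp (hcont.comp (rieszOp i).continuous))
  · exact continuous_const.mul (Λ.continuous.comp (hcont.comp bracketOp.continuous))
  · funext S
    simp only [Function.comp_apply, SchwartzMap.toLpCLM_apply]
    rw [bracketOp_toLp, fourierInv_rieszOp_toLp, SchwartzMap.toLp_fourierInv_eq, hΛ, hΛ, hΛ']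
    set g : SchwartzMap E5 ℂ := 𝓕⁻ (SchwartzMap.smulLeftCLM ℂ invBracket S)
    have hcongr : ∀ (w : E5 → ℝ) (G : SchwartzMap E5 ℂ),
        cFourier (fun x => (w x : ℂ) * (G.toLp 2 volume : L2) x) ξ =
          cFourier (fun x => (w x : ℂ) * G x) ξ := fun w G => by
      refine integral_congr_ae ?_
      filter_upwards [G.coeFn_toLp 2 volume] with x hx
      rw [hx]
    rw [hcongr, hcongr, hcongr]
    exact cFourier_lineDeriv_schwartz hv hv' (C := max |C| |C'|)
      (fun x => (le_of_weight hC x).trans (le_max_left _ _))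
      (fun x => (le_of_weight hC' x).trans (le_max_right _ _)) hd g ξ

/-- The symbols of the operators `1` and `∂_i`. -/
def wordSymbol (ξ : E5) : Option (Fin 5) → ℂ
  | none => 1
  | some i => Complex.I * ((ξ i : ℝ) : ℂ)

lemma norm_fourierInv_L2 (H : L2) : ‖(𝓕⁻ H : L2)‖ = ‖H‖ := by
  rw [← Lp.norm_fourier_eq, FourierTransform.fourier_fourierInv_eq]

lemma continuous_weight : Continuous fun x : E5 => (1 + ‖x‖) ^ (-4 : ℝ) :=
  (continuous_const.add continuous_norm).rpow_const fun x =>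
    Or.inl (GrowthClass.one_add_norm_pos x).ne'

lemma memLp_weight : MemLp (fun x : E5 => (1 + ‖x‖) ^ (-4 : ℝ)) 2 volume :=
  memLp_of_le_weight continuous_weight (C := 1) fun x => by
    rw [one_mul, abs_of_pos (Real.rpow_pos_of_pos (GrowthClass.one_add_norm_pos x) _)]

lemma cFourier_weight_add (f g : L2) (ξ : E5) :
    cFourier (fun x => (((1 + ‖x‖) ^ (-4 : ℝ) : ℝ) : ℂ) * (f + g : L2) x) ξ =
      cFourier (fun x => (((1 + ‖x‖) ^ (-4 : ℝ) : ℝ) : ℂ) * f x) ξ +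
        cFourier (fun x => (((1 + ‖x‖) ^ (-4 : ℝ) : ℝ) : ℂ) * g x) ξ := by
  obtain ⟨Λ, hΛ⟩ := exists_cFourier_functional memLp_weight ξ
  rw [← hΛ, ← hΛ, ← hΛ, map_add]

/-- A product of coordinates, times the Fourier transform of a rapidly decaying multiple of a
function with that many square-integrable derivatives, is the Fourier transform of a rapidly
decaying multiple of a square-integrable function. -/
lemma exists_word_bound (w : List (Option (Fin 5))) {v : E5 → ℝ}
    (hv : GrowthClass (-4) w.length v) :
    ∃ C, 0 ≤ C ∧ ∀ H : L2, ∃ f : L2, ‖f‖ ≤ C * ‖H‖ ∧ ∀ ξ,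
      cFourier (fun x => (((1 + ‖x‖) ^ (-4 : ℝ) : ℝ) : ℂ) * f x) ξ =
        (w.map (wordSymbol ξ)).prod *
          cFourier (fun x => (v x : ℂ) * (𝓕⁻ ((bracketOp ^ w.length) H) : L2) x) ξ := by
  induction w generalizing v with
  | nil =>
    obtain ⟨hc, C, hC⟩ := hv.base
    -- With no derivative left, `v` is the weight times this bounded function, which is absorbed
    -- into `f`.
    have hm : Continuous fun x : E5 => (((1 + ‖x‖) ^ 4 * v x : ℝ) : ℂ) := by fun_prop
    have hmC : ∀ x : E5, ‖(((1 + ‖x‖) ^ 4 * v x : ℝ) : ℂ)‖ ≤ C := fun x => by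
      have h0 := GrowthClass.one_add_norm_pos x
      rw [Complex.norm_real, Real.norm_eq_abs, abs_mul, abs_of_pos (by positivity)]
      refine (mul_le_mul_of_nonneg_left (hC x) (by positivity)).trans (le_of_eq ?_)
      rw [Real.rpow_neg h0.le, show (4 : ℝ) = ((4 : ℕ) : ℝ) by norm_num, Real.rpow_natCast]
      field_simp
    have hC0 : 0 ≤ C := (norm_nonneg _).trans (hmC 0)
    refine ⟨C, hC0, fun H => ⟨mulL2 _ hm C hmC (𝓕⁻ H), ?_, fun ξ => ?_⟩⟩
    · simpa only [norm_fourierInv_L2] using norm_mulL2_le _ hm C hmC (𝓕⁻ H)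
    · simp only [List.map_nil, List.prod_nil, one_mul, List.length_nil, pow_zero]
      refine integral_congr_ae ?_
      filter_upwards [coeFn_mulL2 _ hm C hmC (𝓕⁻ H)] with x hx
      have h0 := GrowthClass.one_add_norm_pos x
      rw [hx, one_apply_eq_self, ← mul_assoc (((1 + ‖x‖) ^ (-4 : ℝ) : ℝ) : ℂ),
        ← Complex.ofReal_mul, Real.rpow_neg h0.le, show (4 : ℝ) = ((4 : ℕ) : ℝ) by norm_num,
        Real.rpow_natCast, inv_mul_cancel_left₀ (by positivity)]
  | cons a w ih =>
    have hpow : ∀ H : L2, (bracketOp ^ (w.length + 1)) H = (bracketOp ^ w.length) (bracketOp H) :=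
      fun H => by rw [pow_succ]; rfl
    have hB : ∀ H : L2, ‖bracketOp H‖ ≤ 1 * ‖H‖ := fun H => norm_mulL2_le _ _ _ _ H
    obtain ⟨C, hC0, hC⟩ := ih hv.of_succ
    cases a with
    | none =>
      refine ⟨C, hC0, fun H => ?_⟩
      obtain ⟨f, hf1, hf2⟩ := hC (bracketOp H)
      refine ⟨f, hf1.trans (by nlinarith [hB H, norm_nonneg H]), fun ξ => ?_⟩
      rw [hf2, List.map_cons, List.prod_cons, wordSymbol, one_mul, List.length_cons, hpow]
    | some i =>
      -- Leibniz rule: the factor `iξ_i` differentiates either `v`, leaving an unused factor `(1 +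
      -- |ξ|²)^(-1/2)` of norm at most one, or the `L²` function, where that factor makes the
      -- derivative a bounded operator.
      obtain ⟨v', hd, hv'⟩ := hv.2 i
      obtain ⟨D, hD0, hD⟩ := ih hv'
      obtain ⟨hvc, c, hc⟩ := hv.base
      obtain ⟨hvc', c', hc'⟩ := hv'.base
      have hR : ∀ H : L2, ‖rieszOp i H‖ ≤ 2 * Real.pi * ‖H‖ := fun H => norm_mulL2_le _ _ _ _ H
      refine ⟨D + C * (2 * Real.pi), by positivity, fun H => ?_⟩
      obtain ⟨f, hf1, hf2⟩ := hD (bracketOp H)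
      obtain ⟨g, hg1, hg2⟩ := hC (rieszOp i H)
      refine ⟨f + g, (norm_add_le _ _).trans ?_, fun ξ => ?_⟩
      · have h1 := mul_le_mul_of_nonneg_left (hB H) hD0
        have h2 := mul_le_mul_of_nonneg_left (hR H) hC0
        nlinarith
      -- The multipliers commute, so the factors still needed for the remaining symbols can be moved
      -- past the one used here.
      · have hcomm : (bracketOp ^ w.length) (rieszOp i H) = rieszOp i ((bracketOp ^ w.length) H) :=
          congrArg (fun L : L2 →L[ℂ] L2 => L H) ((bracketOp_comm_rieszOp i).pow_left w.length)
        have hcomm' : (bracketOp ^ w.length) (bracketOp H) = bracketOp ((bracketOp ^ w.length) H) :=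
          congrArg (fun L : L2 →L[ℂ] L2 => L H) ((Commute.refl bracketOp).pow_left w.length)
        have h3 := cFourier_lineDeriv hvc hvc' hc hc' hd ((bracketOp ^ w.length) H) ξ
        rw [cFourier_weight_add, hf2, hg2, List.map_cons, List.prod_cons, wordSymbol,
          List.length_cons, hpow, ← mul_add, hcomm, hcomm', h3]
        ring


/-! ### From Sobolev norms to weighted integrability -/

lemma coeFn_bracketOp_pow (k : ℕ) (H : L2) :
    ((bracketOp ^ k) H : L2) =ᵐ[volume] fun ξ => ((invBracket ξ ^ k : ℝ) : ℂ) * H ξ := by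
  induction k with
  | zero => exact Filter.Eventually.of_forall fun ξ => by simp
  | succ k ih =>
    have h1 : (bracketOp ((bracketOp ^ k) H) : L2) =ᵐ[volume]
        fun ξ => (invBracket ξ : ℂ) * ((bracketOp ^ k) H : L2) ξ := coeFn_mulL2 _ _ _ _ _
    have h2 : (bracketOp ^ (k + 1)) H = bracketOp ((bracketOp ^ k) H) := by rw [pow_succ']; rfl
    rw [h2]
    filter_upwards [h1, ih] with ξ h3 h4
    rw [h3, h4]
    push_cast
    ring

lemma invBracket_pow_mul (k : ℕ) (ξ : E5) :
    invBracket ξ ^ k * (1 + ‖ξ‖ ^ 2) ^ ((k : ℝ) / 2) = 1 := by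
  have h : 0 < 1 + ‖ξ‖ ^ 2 := by positivity
  rw [invBracket, ← Real.rpow_natCast, ← Real.rpow_mul h.le, ← Real.rpow_add h]
  rw [show (-1 / 2 : ℝ) * k + k / 2 = 0 by ring, Real.rpow_zero]

/-- A function with finite Sobolev norm of order `s` is the inverse Fourier transform of a
square-integrable function divided by `(1 + |ξ|²)^{N/2}`, for `N ≤ s`. -/
lemma exists_eq_fourierInv_bracketOp_pow {s : ℝ} {N : ℕ} (hN : (N : ℝ) ≤ s) {g : E5 → ℝ}
    (hg : sobolevHNorm s g < ⊤) :
    ∃ H : L2, ‖H‖ ≤ (sobolevHNorm s g).toReal ∧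
      (𝓕⁻ ((bracketOp ^ N) H) : L2) =ᵐ[volume] fun x => (g x : ℂ) := by
  have hmem : MemLp (fun x => (g x : ℂ)) 2 (volume : Measure E5) := by
    by_contra hcon
    simp [sobolevHNorm, hcon] at hg
  set G : L2 := 𝓕 (hmem.toLp (fun x => (g x : ℂ)))
  set w : E5 → ℝ := fun ξ => (1 + (2 * Real.pi * ‖ξ‖) ^ 2) ^ (s / 2) with hw
  have hnorm : sobolevHNorm s g = eLpNorm (fun ξ => (w ξ : ℂ) * G ξ) 2 volume := by
    rw [sobolevHNorm, iInf_pos hmem]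
  have hwc : Continuous w := by
    refine Continuous.rpow_const (by fun_prop) fun ξ => Or.inl (by positivity)
  have hwG : MemLp (fun ξ => (w ξ : ℂ) * G ξ) 2 volume :=
    ⟨(Continuous.aestronglyMeasurable (by fun_prop)).mul (Lp.aestronglyMeasurable G), hnorm ▸ hg⟩
  have hbc : Continuous fun ξ : E5 => (1 + ‖ξ‖ ^ 2) ^ ((N : ℝ) / 2) :=
    Continuous.rpow_const (by fun_prop) fun ξ => Or.inl (by positivity)
  have hle : ∀ ξ, ‖(((1 + ‖ξ‖ ^ 2) ^ ((N : ℝ) / 2) : ℝ) : ℂ) * G ξ‖ ≤ ‖(w ξ : ℂ) * G ξ‖ := by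
    intro ξ
    rw [norm_mul, norm_mul, Complex.norm_real, Complex.norm_real,
      Real.norm_of_nonneg (by positivity), Real.norm_of_nonneg (by positivity)]
    refine mul_le_mul_of_nonneg_right ?_ (norm_nonneg _)
    -- The Sobolev weight uses the frequency `2πξ` and the operators use `ξ`; since `2π ≥ 1` the
    -- former dominates.
    have h1 : 1 + ‖ξ‖ ^ 2 ≤ 1 + (2 * Real.pi * ‖ξ‖) ^ 2 := by
      have h0 : ‖ξ‖ ≤ 2 * Real.pi * ‖ξ‖ :=
        le_mul_of_one_le_left (norm_nonneg _) (by nlinarith [Real.pi_gt_three])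
      have := pow_le_pow_left₀ (norm_nonneg ξ) h0 2
      linarith
    refine (Real.rpow_le_rpow (by positivity) h1 (by positivity)).trans ?_
    exact Real.rpow_le_rpow_of_exponent_le (by nlinarith [norm_nonneg ξ, Real.pi_pos]) (by linarith)
  have hH : MemLp (fun ξ => (((1 + ‖ξ‖ ^ 2) ^ ((N : ℝ) / 2) : ℝ) : ℂ) * G ξ) 2 volume :=
    hwG.of_le ((Continuous.aestronglyMeasurable (by fun_prop)).mul (Lp.aestronglyMeasurable G))
      (Filter.Eventually.of_forall hle)
  refine ⟨hH.toLp, ?_, ?_⟩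
  · rw [Lp.norm_toLp]
    exact ENNReal.toReal_mono hg.ne (hnorm ▸ eLpNorm_mono hle)
  · have hG : (bracketOp ^ N) hH.toLp = G := by
      refine Lp.ext ?_
      filter_upwards [coeFn_bracketOp_pow N hH.toLp, hH.coeFn_toLp] with ξ h1 h2
      rw [h1, h2, ← mul_assoc, ← Complex.ofReal_mul, invBracket_pow_mul, Complex.ofReal_one, one_mul]
    rw [hG, FourierTransform.fourierInv_fourier_eq]
    exact hmem.coeFn_toLp

/-- Cauchy–Schwarz, with `7/5 - 4 = -13/5` and `26/5 > 5`. In dimension five the decay `(1 + |x|)⁻⁴`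
against `L²` allows any weight of order less than `3/2`; the choice `7/5` makes the later error
`L^(-17/5)`. -/
lemma integrable_weighted_of_L2 (f : L2) :
    Integrable (fun x : E5 => (1 + ‖x‖) ^ (7 / 5 : ℝ) *
      ‖(((1 + ‖x‖) ^ (-4 : ℝ) : ℝ) : ℂ) * f x‖) volume ∧
    ∫ x : E5, (1 + ‖x‖) ^ (7 / 5 : ℝ) * ‖(((1 + ‖x‖) ^ (-4 : ℝ) : ℝ) : ℂ) * f x‖ ≤
      (∫ x : E5, (1 + ‖x‖) ^ (-(26 / 5) : ℝ)) ^ (1 / 2 : ℝ) * ‖f‖ := by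
  have hc : Continuous fun x : E5 => (1 + ‖x‖) ^ (-(13 / 5) : ℝ) :=
    Continuous.rpow_const (by fun_prop) fun x => Or.inl (GrowthClass.one_add_norm_pos x).ne'
  have hsq : ∀ x : E5, ((1 + ‖x‖) ^ (-(13 / 5) : ℝ)) ^ 2 = (1 + ‖x‖) ^ (-(26 / 5) : ℝ) := fun x => by
    rw [← Real.rpow_natCast, ← Real.rpow_mul (GrowthClass.one_add_norm_pos x).le]
    norm_num
  have hmem : MemLp (fun x : E5 => (1 + ‖x‖) ^ (-(13 / 5) : ℝ)) 2 volume := by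
    rw [memLp_two_iff_integrable_sq hc.aestronglyMeasurable]
    simp only [hsq]
    exact integrable_one_add_norm (by simp; norm_num)
  have heq : ∀ x : E5, (1 + ‖x‖) ^ (7 / 5 : ℝ) * ‖(((1 + ‖x‖) ^ (-4 : ℝ) : ℝ) : ℂ) * f x‖ =
      (1 + ‖x‖) ^ (-(13 / 5) : ℝ) * ‖f x‖ := fun x => by
    have h0 := GrowthClass.one_add_norm_pos x
    rw [norm_mul, Complex.norm_real, Real.norm_of_nonneg (by positivity), ← mul_assoc,
      ← Real.rpow_add h0]
    norm_num
  simp only [heq]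
  have hf := (Lp.memLp f).norm
  refine ⟨hmem.integrable_mul hf, ?_⟩
  have hhold : (2 : ℝ).HolderConjugate 2 := Real.HolderConjugate.two_two
  have h := integral_mul_le_Lp_mul_Lq_of_nonneg (μ := (volume : Measure E5)) hhold
    (f := fun x => (1 + ‖x‖) ^ (-(13 / 5) : ℝ)) (g := fun x => ‖f x‖)
    (Filter.Eventually.of_forall fun x => by dsimp; positivity)
    (Filter.Eventually.of_forall fun x => norm_nonneg _) (by simpa using hmem) (by simpa using hf)
  refine h.trans (le_of_eq ?_)
  congr 1
  · congr 1
    refine integral_congr_ae (Filter.Eventually.of_forall fun x => ?_)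
    have := hsq x
    simpa using this
  · rw [Lp.norm_def, MemLp.eLpNorm_eq_integral_rpow_norm (by norm_num) (by norm_num) (Lp.memLp f)]
    rw [ENNReal.toReal_ofReal (by positivity)]
    norm_num

lemma sobolevHNorm_toReal_le {n : ℝ} {V W : E5 → ℝ} (h : IsPotential n V W) :
    sobolevHNorm (4 * n + 4) (fun x => (1 + ‖x‖ ^ 4) * V x) < ⊤ ∧
      (sobolevHNorm (4 * n + 4) (fun x => (1 + ‖x‖ ^ 4) * V x)).toReal ≤
        (potentialNorm n V W).toReal := by
  have hle : sobolevHNorm (4 * n + 4) (fun x => (1 + ‖x‖ ^ 4) * V x) ≤ potentialNorm n V W :=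
    le_add_right le_add_self
  exact ⟨hle.trans_lt h.norm_lt_top, ENNReal.toReal_mono h.norm_lt_top.ne hle⟩

/-- Products of at most `4n + 4` coordinates with `V̂` are Fourier transforms of functions with a
weighted integrability controlled by the norm of the potential. -/
lemma exists_weighted_word (n : ℝ) {N : ℕ} (hN : (N : ℝ) ≤ 4 * n + 4) :
    ∃ C, 0 ≤ C ∧ ∀ V W, IsPotential n V W → ∀ w : Fin N → Option (Fin 5), ∃ F : E5 → ℂ,
      Measurable F ∧ Integrable (fun x => (1 + ‖x‖) ^ (7 / 5 : ℝ) * ‖F x‖) volume ∧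
      ∫ x, (1 + ‖x‖) ^ (7 / 5 : ℝ) * ‖F x‖ ≤ C * (potentialNorm n V W).toReal ∧
      ∀ ξ, cFourier F ξ = (∏ k, wordSymbol ξ (w k)) * paperFourier V ξ := by
  have hex : ∀ w : Fin N → Option (Fin 5), ∃ C, 0 ≤ C ∧ ∀ H : L2, ∃ f : L2, ‖f‖ ≤ C * ‖H‖ ∧ ∀ ξ,
      cFourier (fun x => (((1 + ‖x‖) ^ (-4 : ℝ) : ℝ) : ℂ) * f x) ξ =
        (∏ k, wordSymbol ξ (w k)) *
          cFourier (fun x => (((1 + ‖x‖ ^ 4)⁻¹ : ℝ) : ℂ) *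
            (𝓕⁻ ((bracketOp ^ N) H) : L2) x) ξ := fun w => by
    have h := exists_word_bound (List.ofFn w)
      (GrowthClass.inv_one_add_norm_pow_four (List.ofFn w).length)
    simpa only [List.length_ofFn, List.map_ofFn, List.prod_ofFn, Function.comp_apply] using h
  choose c hc0 hc using hex
  set I₀ : ℝ := (∫ x : E5, (1 + ‖x‖) ^ (-(26 / 5) : ℝ)) ^ (1 / 2 : ℝ)
  have hI₀ : 0 ≤ I₀ := Real.rpow_nonneg (integral_nonneg fun x => by positivity) _
  refine ⟨I₀ * ∑ w, c w, mul_nonneg hI₀ (Finset.sum_nonneg fun w _ => hc0 w),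
    fun V W hVW w => ?_⟩
  obtain ⟨hfin, hle⟩ := sobolevHNorm_toReal_le hVW
  obtain ⟨H, hH1, hH2⟩ := exists_eq_fourierInv_bracketOp_pow hN hfin
  obtain ⟨f, hf1, hf2⟩ := hc w H
  obtain ⟨hi1, hi2⟩ := integrable_weighted_of_L2 f
  refine ⟨_, ?_, hi1, hi2.trans ?_, fun ξ => (hf2 ξ).trans ?_⟩
  · have h1 := continuous_weight.measurable.complex_ofReal
    exact h1.mul (Lp.stronglyMeasurable f).measurable
  · have h1 : c w ≤ ∑ w, c w := Finset.single_le_sum (fun w _ => hc0 w) (Finset.mem_univ w)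
    have h2 : ‖f‖ ≤ (∑ w, c w) * (potentialNorm n V W).toReal :=
      hf1.trans (mul_le_mul h1 (hH1.trans hle) (norm_nonneg _) ((hc0 w).trans h1))
    exact (mul_le_mul_of_nonneg_left h2 hI₀).trans_eq (mul_assoc _ _ _).symm
  · congr 1
    refine integral_congr_ae ?_
    filter_upwards [hH2] with x hx
    rw [hx]
    have h0 : (1 + ‖x‖ ^ 4 : ℝ) ≠ 0 := by positivity
    rw [← Complex.ofReal_mul, inv_mul_cancel_left₀ h0]

/-- Including the symbol `1` among the letters makes the letters sum to `1 + |ξ|²`, so the words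
give its `N`-th power exactly, without cross terms. -/
lemma sum_norm_wordSymbol_sq (N : ℕ) (ξ : E5) :
    ∑ w : Fin N → Option (Fin 5), ‖∏ k, wordSymbol ξ (w k)‖ ^ 2 = (1 + ‖ξ‖ ^ 2) ^ N := by
  have h : ∑ a, ‖wordSymbol ξ a‖ ^ 2 = 1 + ‖ξ‖ ^ 2 := by
    rw [Fintype.sum_option, EuclideanSpace.norm_sq_eq]
    simp [wordSymbol]
  rw [← h, Fintype.sum_pow]
  simp only [norm_prod, Finset.prod_pow]


/-! ### Kernels weighted by the Fourier transform of the potential -/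

/-- The decay rate of the kernel of a potential, at distance `δ L` outside of the light cone. -/
noncomputable def sonicRate (n L δ : ℝ) : ℝ :=
  (1 + L) ^ (-2 : ℝ) * min 1 δ ^ (2 * n + 3) + (1 + L) ^ (-(17 / 5) : ℝ)

lemma sonicRate_nonneg {n L δ : ℝ} (hL : 0 ≤ L) (hδ : 0 ≤ δ) : 0 ≤ sonicRate n L δ := by
  have : 0 ≤ min 1 δ := le_min zero_le_one hδ
  unfold sonicRate
  positivity

lemma min_one_add_rpow_le {p : ℝ} (hp : 0 ≤ p) {a b : ℝ} (ha : 0 ≤ a) (hb : 0 ≤ b) :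
    min 1 (a + b) ^ p ≤ 2 ^ p * (min 1 a ^ p + min 1 b ^ p) := by
  have ha' : 0 ≤ min 1 a := le_min zero_le_one ha
  have hb' : 0 ≤ min 1 b := le_min zero_le_one hb
  have key : ∀ c, 0 ≤ c → min 1 (a + b) ≤ 2 * c → min 1 (a + b) ^ p ≤ 2 ^ p * c ^ p :=
    fun c hc h => by
      rw [← Real.mul_rpow (by norm_num) hc]
      exact Real.rpow_le_rpow (le_min zero_le_one (by linarith)) h hp
  rcases le_total a b with h | h
  · have h1 := key (min 1 b) hb' (by
      rcases le_total 1 b with h1 | h1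
      · rw [min_eq_left h1]; exact (min_le_left _ _).trans (by norm_num)
      · rw [min_eq_right h1]; exact (min_le_right _ _).trans (by linarith))
    have : 0 ≤ (2 : ℝ) ^ p * min 1 a ^ p := by positivity
    linarith
  · have h1 := key (min 1 a) ha' (by
      rcases le_total 1 a with h1 | h1
      · rw [min_eq_left h1]; exact (min_le_left _ _).trans (by norm_num)
      · rw [min_eq_right h1]; exact (min_le_right _ _).trans (by linarith))
    have : 0 ≤ (2 : ℝ) ^ p * min 1 b ^ p := by positivity
    linarith

/-- Moving the observation point by `d` raises the admissible excess velocity by `d/L`. As `2n + 3 ≥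
7/5`, this costs at most order `((1 + d)/(1 + L))^(7/5)`, which together with `L⁻²` gives
`L^(-17/5)`. -/
lemma decayRate_add_le {n L δ d : ℝ} (hn : 1 / 4 < n) (hL : 0 < L) (hδ : 0 ≤ δ) (hd : 0 ≤ d) :
    decayRate n L (δ + d / L) ≤
      (2 ^ (2 * n + 3) * (1 + 2 ^ (7 / 5 : ℝ)) + 1) * ((1 + d) ^ (7 / 5 : ℝ) * sonicRate n L δ) := by
  have h1L : 0 < 1 + L := by linarith
  have h1d : 0 < 1 + d := by linarith
  have hdL : 0 ≤ d / L := by positivity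
  have hm : 0 ≤ min 1 δ := le_min zero_le_one hδ
  have hm' : 0 ≤ min 1 (d / L) := le_min zero_le_one hdL
  set A := min 1 δ ^ (2 * n + 3)
  have hA : 0 ≤ A := by positivity
  have hsplit := min_one_add_rpow_le (p := 2 * n + 3) (by linarith) hδ hdL
  have hD : 1 ≤ (1 + d) ^ (7 / 5 : ℝ) := Real.one_le_rpow (by linarith) (by norm_num)
  have hη : min 1 (d / L) ^ (2 * n + 3) ≤
      2 ^ (7 / 5 : ℝ) * ((1 + d) ^ (7 / 5 : ℝ) * (1 + L) ^ (-(7 / 5) : ℝ)) := by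
    have h1 : min 1 (d / L) ^ (2 * n + 3) ≤ min 1 (d / L) ^ (7 / 5 : ℝ) :=
      Real.rpow_le_rpow_of_exponent_ge' hm' (min_le_left _ _) (by norm_num) (by linarith)
    -- The truncation at `1` makes the bound hold also for small `L`, where `d/L` is unbounded.
    have h2 : min 1 (d / L) ≤ 2 * ((1 + d) * (1 + L)⁻¹) := by
      rw [← div_eq_mul_inv, ← mul_div_assoc, le_div_iff₀ h1L]
      rcases le_total 1 L with h | h
      · have h3 : min 1 (d / L) * L ≤ d := by
          have := mul_le_mul_of_nonneg_right (min_le_right 1 (d / L)) hL.le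
          rwa [div_mul_cancel₀ _ hL.ne'] at this
        have h4 := min_le_left 1 (d / L)
        nlinarith
      · have h4 := min_le_left 1 (d / L)
        nlinarith
    refine h1.trans ((Real.rpow_le_rpow hm' h2 (by norm_num)).trans (le_of_eq ?_))
    rw [Real.mul_rpow (by norm_num) (by positivity), Real.mul_rpow h1d.le (by positivity),
      Real.inv_rpow h1L.le, Real.rpow_neg h1L.le]
  have hL1 : (1 + L) ^ (-2 : ℝ) * (1 + L) ^ (-(7 / 5) : ℝ) = (1 + L) ^ (-(17 / 5) : ℝ) := by
    rw [← Real.rpow_add h1L]; norm_num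
  have hL2 : (1 + L) ^ (-(7 / 2) : ℝ) ≤ (1 + L) ^ (-(17 / 5) : ℝ) :=
    Real.rpow_le_rpow_of_exponent_le (by linarith) (by norm_num)
  have hL0 : 0 ≤ (1 + L) ^ (-2 : ℝ) := by positivity
  have hL3 : 0 ≤ (1 + L) ^ (-(17 / 5) : ℝ) := by positivity
  set B := (1 + L) ^ (-(17 / 5) : ℝ)
  set D := (1 + d) ^ (7 / 5 : ℝ)
  set k := (2 : ℝ) ^ (2 * n + 3)
  set l := (2 : ℝ) ^ (7 / 5 : ℝ)
  have hk : 0 ≤ k := by positivity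
  have hl : 0 ≤ l := by positivity
  set E := (1 + L) ^ (-2 : ℝ)
  unfold decayRate sonicRate
  calc E * min 1 (δ + d / L) ^ (2 * n + 3) + (1 + L) ^ (-(7 / 2) : ℝ)
      ≤ E * (k * (A + l * (D * (1 + L) ^ (-(7 / 5) : ℝ)))) + B := by
        refine add_le_add (mul_le_mul_of_nonneg_left (hsplit.trans ?_) hL0) hL2
        exact mul_le_mul_of_nonneg_left (by linarith) hk
    _ = k * (E * A) + k * l * D * (E * (1 + L) ^ (-(7 / 5) : ℝ)) + B := by ring
    _ = k * (E * A) + k * l * D * B + B := by rw [hL1]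
    _ ≤ (k * (1 + l) + 1) * (D * (E * A + B)) := by
        have h1 : 0 ≤ E * A := mul_nonneg hL0 hA
        have h2 : k * (E * A) ≤ k * (D * (E * A)) :=
          mul_le_mul_of_nonneg_left (le_mul_of_one_le_left h1 hD) hk
        have h3 : B ≤ D * B := le_mul_of_one_le_left hL3 hD
        have h4 : 0 ≤ k * l * (D * (E * A)) := by positivity
        have h5 : 0 ≤ D * (E * A) := by positivity
        have h6 : 0 ≤ k * (D * B) := by positivity
        nlinarith

lemma continuous_cFourier {F : E5 → ℂ} (hF : Integrable F volume) : Continuous (cFourier F) := by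
  refine continuous_of_dominated (bound := fun x => ‖F x‖) (fun ξ => ?_) (fun ξ => ?_) hF.norm ?_
  · exact (Continuous.aestronglyMeasurable (by fun_prop)).mul hF.1
  · exact Filter.Eventually.of_forall fun x => by rw [norm_mul, norm_exp_neg_I, one_mul]
  · exact Filter.Eventually.of_forall fun x => by fun_prop

lemma norm_cFourier_le (F : E5 → ℂ) (ξ : E5) : ‖cFourier F ξ‖ ≤ ∫ x, ‖F x‖ :=
  (norm_integral_le_integral_norm _).trans_eq <| by
    simp only [norm_mul, norm_exp_neg_I, one_mul]

section Weighted

variable {F : E5 → ℂ}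

lemma integrable_of_weighted (hm : Measurable F)
    (hF : Integrable (fun x => (1 + ‖x‖) ^ (7 / 5 : ℝ) * ‖F x‖) volume) : Integrable F volume := by
  refine hF.mono' hm.aestronglyMeasurable (Filter.Eventually.of_forall fun x => ?_)
  exact le_mul_of_one_le_left (norm_nonneg _)
    (Real.one_le_rpow (by linarith [norm_nonneg x]) (by norm_num))

/-- The square modulus of a Fourier transform, integrated against an oscillating kernel. -/
lemma integral_norm_sq_cFourier_mul_quadIntegrand {n q : ℝ} (hn : 1 / 4 < n) (hq : 4 * n + 8 < q)
    (hF : Integrable F volume) (L : ℝ) (a c z : E5) :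
    ∫ ξ, ((‖cFourier F ξ‖ ^ 2 : ℝ) : ℂ) * quadIntegrand n q L a c z ξ =
      ∫ p : E5 × E5, F p.1 * (starRingEnd ℂ) (F p.2) * quadKernel n q L a c (z - p.1 + p.2) := by
  have hF' : Integrable (fun x => (starRingEnd ℂ) (F x)) volume :=
    ⟨Complex.continuous_conj.comp_aestronglyMeasurable hF.1,
      by simpa [HasFiniteIntegral] using hF.2⟩
  have hsq : ∀ ξ, ((‖cFourier F ξ‖ ^ 2 : ℝ) : ℂ) = ∫ p : E5 × E5,
      (Complex.exp (-(Complex.I * ((inner ℝ p.1 ξ : ℝ) : ℂ))) * F p.1) *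
      (Complex.exp (Complex.I * ((inner ℝ p.2 ξ : ℝ) : ℂ)) * (starRingEnd ℂ) (F p.2)) := fun ξ => by
    rw [Measure.volume_eq_prod, integral_prod_mul
      (fun x => Complex.exp (-(Complex.I * ((inner ℝ x ξ : ℝ) : ℂ))) * F x)
      (fun x => Complex.exp (Complex.I * ((inner ℝ x ξ : ℝ) : ℂ)) * (starRingEnd ℂ) (F x))]
    have h : ∫ x, Complex.exp (Complex.I * ((inner ℝ x ξ : ℝ) : ℂ)) * (starRingEnd ℂ) (F x) =
        (starRingEnd ℂ) (cFourier F ξ) := by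
      rw [cFourier, ← integral_conj]
      refine integral_congr_ae (Filter.Eventually.of_forall fun x => ?_)
      beta_reduce
      rw [map_mul, ← Complex.exp_conj]
      simp
    rw [h]
    change _ = cFourier F ξ * _
    rw [Complex.mul_conj, Complex.normSq_eq_norm_sq]
  simp only [hsq]
  simp only [← integral_mul_const]
  have hQ := integrable_quadIntegrand hn hq L a c z
  have hprod := hQ.mul_prod (hF.mul_prod hF')
  have hint : Integrable (fun r : E5 × (E5 × E5) =>
      (Complex.exp (-(Complex.I * ((inner ℝ r.2.1 r.1 : ℝ) : ℂ))) * F r.2.1) *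
      (Complex.exp (Complex.I * ((inner ℝ r.2.2 r.1 : ℝ) : ℂ)) * (starRingEnd ℂ) (F r.2.2)) *
      quadIntegrand n q L a c z r.1) (volume.prod (volume.prod volume)) := by
    have h := hprod.bdd_mul (c := 1) (f := fun r : E5 × (E5 × E5) =>
      Complex.exp (-(Complex.I * ((inner ℝ r.2.1 r.1 : ℝ) : ℂ))) *
        Complex.exp (Complex.I * ((inner ℝ r.2.2 r.1 : ℝ) : ℂ)))
      (Continuous.aestronglyMeasurable (by fun_prop)) (Filter.Eventually.of_forall fun r => by
        rw [norm_mul, norm_exp_neg_I, one_mul, mul_comm, Complex.norm_exp_ofReal_mul_I])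
    refine h.congr (Filter.Eventually.of_forall fun r => ?_)
    beta_reduce
    ring
  have hswap := integral_integral_swap (f := fun (ξ : E5) (p : E5 × E5) =>
      (Complex.exp (-(Complex.I * ((inner ℝ p.1 ξ : ℝ) : ℂ))) * F p.1) *
      (Complex.exp (Complex.I * ((inner ℝ p.2 ξ : ℝ) : ℂ)) * (starRingEnd ℂ) (F p.2)) *
      quadIntegrand n q L a c z ξ) hint
  refine hswap.trans (integral_congr_ae (Filter.Eventually.of_forall fun p => ?_))
  beta_reduce
  rw [quadKernel, ← integral_const_mul]
  refine integral_congr_ae (Filter.Eventually.of_forall fun ξ => ?_)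
  simp only [quadIntegrand, inner_add_left, inner_sub_left]
  have he : Complex.exp (Complex.I * ((L * disp ‖ξ‖ + (inner ℝ z ξ - inner ℝ p.1 ξ + inner ℝ p.2 ξ) : ℝ) : ℂ)) =
      Complex.exp (-(Complex.I * ((inner ℝ p.1 ξ : ℝ) : ℂ))) *
      Complex.exp (Complex.I * ((inner ℝ p.2 ξ : ℝ) : ℂ)) *
      Complex.exp (Complex.I * ((L * disp ‖ξ‖ + inner ℝ z ξ : ℝ) : ℂ)) := by
    rw [← Complex.exp_add, ← Complex.exp_add]
    congr 1
    push_cast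
    ring
  rw [he]
  ring

end Weighted


/-- The decay of an oscillating kernel weighted by the square modulus of a Fourier transform. -/
lemma exists_norm_integral_cFourier_sq_le {n q : ℝ} (hn : 1 / 4 < n) (hq : 4 * n + 8 < q) :
    ∃ C, 0 ≤ C ∧ ∀ F : E5 → ℂ, Measurable F →
      Integrable (fun x => (1 + ‖x‖) ^ (7 / 5 : ℝ) * ‖F x‖) volume →
      ∀ L δ, 0 < L → 0 ≤ δ → ∀ a c z : E5, ‖z‖ ≤ L * (1 + δ) →
      ‖∫ ξ, ((‖cFourier F ξ‖ ^ 2 : ℝ) : ℂ) * quadIntegrand n q L a c z ξ‖ ≤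
        C * (∫ x, (1 + ‖x‖) ^ (7 / 5 : ℝ) * ‖F x‖) ^ 2 * (‖a‖ * ‖c‖ * sonicRate n L δ) := by
  obtain ⟨C, hC0, hC⟩ := exists_quadKernel_le_decayRate hn hq
  set c₀ : ℝ := 2 ^ (2 * n + 3) * (1 + 2 ^ (7 / 5 : ℝ)) + 1 with hc₀
  have hc₀0 : 0 ≤ c₀ := by positivity
  refine ⟨C * c₀, mul_nonneg hC0 hc₀0, fun F hm hF L δ hL hδ a c z hz => ?_⟩
  rw [integral_norm_sq_cFourier_mul_quadIntegrand hn hq (integrable_of_weighted hm hF)]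
  set w : E5 → ℝ := fun x => (1 + ‖x‖) ^ (7 / 5 : ℝ) * ‖F x‖
  have hS := sonicRate_nonneg (n := n) hL.le hδ
  have hprod : Integrable (fun p : E5 × E5 =>
      C * c₀ * (‖a‖ * ‖c‖ * sonicRate n L δ) * (w p.1 * w p.2)) volume :=
    (hF.mul_prod hF).const_mul _
  refine (norm_integral_le_of_norm_le hprod (Filter.Eventually.of_forall fun p => ?_)).trans
    (le_of_eq ?_)
  -- The kernel is evaluated at `z - x + y`, within `d` of `z`; the resulting factor `(1 + d)^(7/5)`
  -- is split between `F(x)` and `F(y)`.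
  · set d := ‖p.1‖ + ‖p.2‖
    have hd : 0 ≤ d := by positivity
    have hz' : ‖z - p.1 + p.2‖ ≤ L * (1 + (δ + d / L)) := by
      have h1 : L * (1 + (δ + d / L)) = L * (1 + δ) + d := by field_simp; ring
      have h2 := (norm_add_le (z - p.1) p.2).trans (add_le_add_left (norm_sub_le z p.1) _)
      rw [h1]
      linarith
    have h1 := hC L (δ + d / L) hL.le (by positivity) a c _ hz'
    have h2 := decayRate_add_le hn hL hδ hd
    have h3 : (1 + d) ^ (7 / 5 : ℝ) ≤ (1 + ‖p.1‖) ^ (7 / 5 : ℝ) * (1 + ‖p.2‖) ^ (7 / 5 : ℝ) := by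
      rw [← Real.mul_rpow (by positivity) (by positivity)]
      refine Real.rpow_le_rpow (by positivity) ?_ (by norm_num)
      nlinarith [mul_nonneg (norm_nonneg p.1) (norm_nonneg p.2)]
    rw [norm_mul, norm_mul, RCLike.norm_conj]
    calc ‖F p.1‖ * ‖F p.2‖ * ‖quadKernel n q L a c (z - p.1 + p.2)‖
        ≤ ‖F p.1‖ * ‖F p.2‖ * (C * (‖a‖ * ‖c‖ * (c₀ * (((1 + ‖p.1‖) ^ (7 / 5 : ℝ) *
          (1 + ‖p.2‖) ^ (7 / 5 : ℝ)) * sonicRate n L δ)))) := by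
          refine mul_le_mul_of_nonneg_left (h1.trans ?_) (by positivity)
          refine mul_le_mul_of_nonneg_left (mul_le_mul_of_nonneg_left (h2.trans ?_)
            (by positivity)) hC0
          exact mul_le_mul_of_nonneg_left (mul_le_mul_of_nonneg_right h3 hS) hc₀0
      _ = _ := by ring
  · rw [integral_const_mul, Measure.volume_eq_prod, integral_prod_mul]
    ring

/-- The density `|Ŵ|² |ξ| / √(1 + |ξ|²)`. -/
noncomputable def potWeight (W : E5 → ℝ) (ξ : E5) : ℝ :=
  ‖paperFourier W ξ‖ ^ 2 * (‖ξ‖ / bracket ‖ξ‖)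

lemma potWeight_nonneg (W : E5 → ℝ) (ξ : E5) : 0 ≤ potWeight W ξ := by
  have := (bracket_pos ‖ξ‖).le
  unfold potWeight
  positivity

lemma continuous_potWeight {W : E5 → ℝ} (hW : Integrable W volume) : Continuous (potWeight W) := by
  have h1 : Continuous (paperFourier W) := continuous_cFourier hW.ofReal
  have h2 : Continuous fun ξ : E5 => bracket ‖ξ‖ := continuous_bracket.comp continuous_norm
  exact (h1.norm.pow 2).mul (continuous_norm.div h2 fun ξ => (bracket_pos _).ne')

/-- Multiply and divide `|V̂|²` by `⟨ξ⟩^(2N)`: the numerator is a sum of squared moduli of Fourier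
transforms, and the denominator, with the remaining `⟨ξ⟩⁻¹`, gives the radial weight with `q = 2N +
1`. -/
lemma potWeight_eq_sum {n : ℝ} (hn : 0 < n) {N : ℕ} {V W : E5 → ℝ} (hVW : IsFracLaplacian n V W)
    {F : (Fin N → Option (Fin 5)) → E5 → ℂ}
    (hF : ∀ w ξ, cFourier (F w) ξ = (∏ k, wordSymbol ξ (w k)) * paperFourier V ξ) (ξ : E5) :
    potWeight W ξ = ∑ w, ‖cFourier (F w) ξ‖ ^ 2 * radialWeight n (2 * N + 1) ‖ξ‖ := by
  have hb := bracket_pos ‖ξ‖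
  have h1 : ∑ w, ‖cFourier (F w) ξ‖ ^ 2 = (1 + ‖ξ‖ ^ 2) ^ N * ‖paperFourier V ξ‖ ^ 2 := by
    simp only [hF, norm_mul, mul_pow, ← Finset.sum_mul]
    rw [← sum_norm_wordSymbol_sq]
  rw [← Finset.sum_mul, h1, potWeight, hVW.2.2, norm_mul, Complex.norm_real,
    Real.norm_of_nonneg (by positivity), radialWeight, ← bracket_sq, ← pow_mul,
    Real.rpow_neg hb.le, show (2 * (N : ℝ) + 1) = ((2 * N + 1 : ℕ) : ℝ) by push_cast; ring,
    Real.rpow_natCast, pow_succ (bracket ‖ξ‖) (2 * N), mul_pow, ← Real.rpow_natCast (‖ξ‖ ^ (2 * n)),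
    ← Real.rpow_mul (norm_nonneg _), Real.rpow_add_one' (norm_nonneg _) (by positivity)]
  rw [show 2 * n * ((2 : ℕ) : ℝ) = 4 * n by push_cast; ring]
  have hb' : bracket ‖ξ‖ ≠ 0 := hb.ne'
  field_simp

/-- The oscillating kernel of a potential. -/
noncomputable def potKernel (W : E5 → ℝ) (θ L : ℝ) (a c z : E5) : ℂ :=
  ∫ ξ : E5, ((potWeight W ξ * (inner ℝ a ξ * inner ℝ c ξ) : ℝ) : ℂ) *
    Complex.exp (Complex.I * ((θ * L * disp ‖ξ‖ + inner ℝ z ξ : ℝ) : ℂ))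

lemma norm_potKernel_neg (W : E5 → ℝ) (L : ℝ) (a c z : E5) :
    ‖potKernel W (-1) L a c z‖ = ‖potKernel W 1 L a c (-z)‖ := by
  rw [← RCLike.norm_conj (potKernel W (-1) L a c z)]
  congr 1
  rw [potKernel, ← integral_conj]
  refine integral_congr_ae (Filter.Eventually.of_forall fun ξ => ?_)
  beta_reduce
  rw [map_mul, Complex.conj_ofReal, ← Complex.exp_conj, map_mul, Complex.conj_I,
    Complex.conj_ofReal]
  congr 2
  rw [inner_neg_left]
  push_cast
  ring

/-- A number of derivatives which is available for potentials, and sufficient for the decay. -/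
lemma exists_order {n : ℝ} (hn : 1 / 4 < n) :
    ∃ N : ℕ, (N : ℝ) ≤ 4 * n + 4 ∧ 4 * n + 8 < 2 * N + 1 := by
  -- Rounding loses less than one derivative, so `2N + 1 > 8n + 7`, and `8n + 7 > 4n + 8` because `n
  -- > 1/4`.
  refine ⟨⌊4 * n + 4⌋₊, Nat.floor_le (by linarith), ?_⟩
  have := Nat.lt_floor_add_one (4 * n + 4)
  linarith

lemma integrable_potWeight {n : ℝ} (hn : 1 / 4 < n) {V W : E5 → ℝ} (hVW : IsPotential n V W) :
    Integrable (fun ξ => potWeight W ξ * ‖ξ‖ ^ 2) volume := by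
  obtain ⟨N, hN1, hN2⟩ := exists_order hn
  obtain ⟨C, hC0, hC⟩ := exists_weighted_word n hN1
  choose F hm hi _ hF using hC V W hVW
  have h := (integrable_radialWeight hn hN2).const_mul (∑ w, (∫ x, ‖F w x‖) ^ 2)
  refine h.mono' ((continuous_potWeight hVW.1.2.1).mul (by fun_prop)).aestronglyMeasurable
    (Filter.Eventually.of_forall fun ξ => ?_)
  have h0 : 0 ≤ radialWeight n (2 * N + 1) ‖ξ‖ := radialWeight_nonneg (norm_nonneg ξ)
  rw [Real.norm_of_nonneg (mul_nonneg (potWeight_nonneg _ _) (by positivity)),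
    potWeight_eq_sum (by linarith) hVW.1 hF, Finset.sum_mul, Finset.sum_mul]
  refine Finset.sum_le_sum fun w _ => ?_
  rw [mul_assoc]
  exact mul_le_mul_of_nonneg_right
    (pow_le_pow_left₀ (norm_nonneg _) (norm_cFourier_le _ _) 2) (by positivity)

/-- The kernel of a potential decays at the sonic rate. -/
lemma exists_norm_potKernel_le {n : ℝ} (hn : 1 / 4 < n) :
    ∃ C, 0 ≤ C ∧ ∀ V W, IsPotential n V W → ∀ θ : ℝ, θ = 1 ∨ θ = -1 → ∀ L δ, 0 < L → 0 ≤ δ →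
      ∀ a c z : E5, ‖z‖ ≤ L * (1 + δ) →
      ‖potKernel W θ L a c z‖ ≤
        C * (potentialNorm n V W).toReal ^ 2 * (‖a‖ * ‖c‖ * sonicRate n L δ) := by
  obtain ⟨N, hN1, hN2⟩ := exists_order hn
  obtain ⟨C, hC0, hC⟩ := exists_weighted_word n hN1
  obtain ⟨D, hD0, hD⟩ := exists_norm_integral_cFourier_sq_le hn hN2
  set k : ℝ := (Fintype.card (Fin N → Option (Fin 5)) : ℝ)
  refine ⟨k * (D * C ^ 2), by positivity, fun V W hVW θ hθ L δ hL hδ a c z hz => ?_⟩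
  wlog h1 : θ = 1 generalizing θ z
  · obtain rfl := hθ.resolve_left h1
    rw [norm_potKernel_neg]
    exact this 1 (Or.inl rfl) (-z) (by rwa [norm_neg]) rfl
  subst h1
  choose F hm hi hle hF using hC V W hVW
  have hS := sonicRate_nonneg (n := n) hL.le hδ
  have hFc : ∀ w, Continuous (cFourier (F w)) := fun w =>
    continuous_cFourier (integrable_of_weighted (hm w) (hi w))
  have hint : ∀ w, Integrable (fun ξ => ((‖cFourier (F w) ξ‖ ^ 2 : ℝ) : ℂ) *
      quadIntegrand n (2 * N + 1) L a c z ξ) volume := fun w => by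
    refine (integrable_quadIntegrand hn hN2 L a c z).bdd_mul (c := (∫ x, ‖F w x‖) ^ 2)
      (Continuous.aestronglyMeasurable (by have := hFc w; fun_prop))
      (Filter.Eventually.of_forall fun ξ => ?_)
    rw [Complex.norm_real, norm_pow, norm_norm]
    exact pow_le_pow_left₀ (norm_nonneg _) (norm_cFourier_le _ _) 2
  have heq : potKernel W 1 L a c z = ∑ w, ∫ ξ, ((‖cFourier (F w) ξ‖ ^ 2 : ℝ) : ℂ) *
      quadIntegrand n (2 * N + 1) L a c z ξ := by
    rw [← integral_finsetSum _ fun w _ => hint w]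
    refine integral_congr_ae (Filter.Eventually.of_forall fun ξ => ?_)
    beta_reduce
    rw [potWeight_eq_sum (by linarith) hVW.1 hF, one_mul, Finset.sum_mul, Complex.ofReal_sum,
      Finset.sum_mul]
    refine Finset.sum_congr rfl fun w _ => ?_
    rw [quadIntegrand]
    push_cast
    ring
  rw [heq]
  refine (norm_sum_le _ _).trans ((Finset.sum_le_sum (g := fun _ =>
    D * C ^ 2 * (potentialNorm n V W).toReal ^ 2 * (‖a‖ * ‖c‖ * sonicRate n L δ))
    fun w _ => ?_).trans (le_of_eq ?_))
  · refine (hD (F w) (hm w) (hi w) L δ hL hδ a c z hz).trans ?_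
    refine mul_le_mul_of_nonneg_right ?_ (by positivity)
    rw [mul_assoc, ← mul_pow]
    exact mul_le_mul_of_nonneg_left (pow_le_pow_left₀
      (integral_nonneg fun x => by positivity) (hle w) 2) hD0
  · rw [Finset.sum_const, Finset.card_univ, nsmul_eq_mul]
    ring


/-! ### Time decay along a trajectory -/

lemma decayExp_pos {n : ℝ} (hn : 1 / 4 < n) : 0 < decayExp n := by
  have : 0 < 2 * n + 2 := by linarith
  unfold decayExp
  positivity

/-- This is the threshold `n > 1/4` in terms of `α`; it makes `17/5 > 3 + α`. -/
lemma decayExp_lt {n : ℝ} (hn : 1 / 4 < n) : decayExp n < 2 / 5 := by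
  unfold decayExp
  rw [div_lt_div_iff₀ (by linarith) (by norm_num)]
  linarith

/-- The relation behind the choice of `α`: an excess velocity of order `t^(-α)`, raised to the power
`2n + 3` of the kernel bound, reproduces the decay of the acceleration. -/
lemma decayExp_mul {n : ℝ} (hn : 1 / 4 < n) : decayExp n * (2 * n + 3) = 1 + decayExp n := by
  have : 2 * n + 2 ≠ 0 := by linarith
  unfold decayExp
  field_simp
  ring

section Trajectory

variable {n M T : ℝ} {X P A : ℝ → E5}

lemma Bootstrap.norm_velocity_le (hb : Bootstrap n M T P A) (hM : 0 < M) {t : ℝ}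
    (ht : t ∈ Set.Icc 0 T) : ‖P t‖ ≤ 1 + M * (1 + t) ^ (-decayExp n) := by
  have h1t : 0 < 1 + t := by linarith [ht.1]
  have h := hb.velocity t ht
  rcases le_or_gt ‖P t‖ 1 with h1 | h1
  · have : 0 ≤ M * (1 + t) ^ (-decayExp n) := by positivity
    linarith
  · rw [Set.indicator_of_mem (show P t ∈ {p : E5 | 1 < ‖p‖} from h1), mul_comm,
      ← le_div_iff₀ (by positivity)] at h
    rw [Real.rpow_neg h1t.le, ← div_eq_mul_inv]
    linarith

lemma norm_displacement_le_of_velocity (hX : IsTrajectory T X P A) {τ t : ℝ} (hτ : 0 ≤ τ)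
    (hτt : τ ≤ t) (ht : t ≤ T) {B B' : ℝ → ℝ} (hB : ∀ s ∈ Set.Icc τ t, HasDerivAt B (B' s) s)
    (hP : ∀ s ∈ Set.Icc τ t, ‖P s‖ ≤ B' s) : ‖X t - X τ‖ ≤ B t - B τ := by
  have hsub : Set.Icc τ t ⊆ Set.Icc 0 T := Set.Icc_subset_Icc hτ ht
  refine image_norm_le_of_norm_deriv_right_le_deriv_boundary' (a := τ) (b := t)
    (f := fun s => X s - X τ) (f' := P) (B := fun s => B s - B τ) (B' := B') ?_ (fun s hs => ?_) ?_ ?_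
    (fun s hs => ?_) (fun s hs => hP s (Set.Ico_subset_Icc_self hs)) (Set.right_mem_Icc.2 hτt)
  · exact ContinuousOn.sub (fun s hs => ((hX.deriv_position s (hsub hs)).continuousWithinAt).mono
      hsub) continuousOn_const
  · have h1 := hX.deriv_position s (hsub (Set.Ico_subset_Icc_self hs))
    have h2 : HasDerivWithinAt X (P s) (Set.Ici s) s := by
      refine h1.mono_of_mem_nhdsWithin ?_
      exact mem_nhdsGE_iff_exists_Icc_subset.2 ⟨T, hs.2.trans_le ht,
        Set.Icc_subset_Icc (hτ.trans hs.1) le_rfl⟩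
    exact h2.sub_const _
  · simp
  · exact ContinuousOn.sub (fun s hs => (hB s hs).continuousAt.continuousWithinAt) continuousOn_const
  · exact ((hB s (Set.Ico_subset_Icc_self hs)).sub_const _).hasDerivWithinAt

lemma half_le_two_rpow_neg {α : ℝ} (hα : α ≤ 1) : 1 / 2 ≤ (2 : ℝ) ^ (-α) := by
  have : (2 : ℝ) ^ (-1 : ℝ) ≤ 2 ^ (-α) :=
    Real.rpow_le_rpow_of_exponent_le (by norm_num) (by linarith)
  rwa [Real.rpow_neg_one, ← one_div] at this

/-- Integrate `|P| ≤ 1 + M(1 + s)^(-α)`. The excess over the sound cone is to be bounded by the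
elapsed time alone, so that the average excess velocity decays in `t - τ`. -/
lemma norm_displacement_le (hn : 1 / 4 < n) (hM : 0 < M) (hX : IsTrajectory T X P A)
    (hb : Bootstrap n M T P A) {τ t : ℝ} (hτ : 0 ≤ τ) (hτt : τ ≤ t) (ht : t ≤ T) :
    ‖X t - X τ‖ ≤ (t - τ) + 4 * M * ((t - τ) * (1 + (t - τ)) ^ (-decayExp n)) := by
  have hα0 := decayExp_pos hn
  have hα1 := decayExp_lt hn
  set α := decayExp n
  set l := t - τ with hl
  have hl0 : 0 ≤ l := sub_nonneg.2 hτt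
  have hv : ∀ s ∈ Set.Icc τ t, ‖P s‖ ≤ 1 + M * (1 + s) ^ (-α) := fun s hs =>
    hb.norm_velocity_le hM ⟨hτ.trans hs.1, hs.2.trans ht⟩
  have h2 := half_le_two_rpow_neg (α := α) (by linarith)
  -- For short times the constant bound `1 + M` on the speed suffices. For long times the concave
  -- power `x ↦ x^(1-α)` is subadditive, which removes the dependence on `τ`, and `1/(1 - α) ≤ 2`.
  rcases le_total l 1 with h | h
  · have h1 := norm_displacement_le_of_velocity hX hτ hτt ht (B := fun s => (1 + M) * s)
      (B' := fun _ => 1 + M) (fun s _ => by simpa using (hasDerivAt_id s).const_mul (1 + M))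
      (fun s hs => (hv s hs).trans (by
        have : (1 + s) ^ (-α) ≤ 1 :=
          Real.rpow_le_one_of_one_le_of_nonpos (by linarith [hs.1]) (by linarith)
        nlinarith))
    have h3 : (2 : ℝ) ^ (-α) ≤ (1 + l) ^ (-α) :=
      Real.rpow_le_rpow_of_nonpos (by linarith) (by linarith) (by linarith)
    have h4 : M * l * (1 / 2) ≤ M * l * (1 + l) ^ (-α) :=
      mul_le_mul_of_nonneg_left (h2.trans h3) (by positivity)
    have h5 : 0 ≤ M * l := by positivity
    have h6 : (1 + M) * t - (1 + M) * τ = l + M * l := by rw [hl]; ring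
    nlinarith
  · have h1 := norm_displacement_le_of_velocity hX hτ hτt ht
      (B := fun s => s + M * ((1 + s) ^ (1 - α) / (1 - α)))
      (B' := fun s => 1 + M * (1 + s) ^ (-α)) (fun s hs => by
        have h1s : 0 < 1 + s := by linarith [hs.1]
        have h3 := ((hasDerivAt_id s).const_add 1).rpow_const (p := 1 - α) (Or.inl h1s.ne')
        have h4 := (hasDerivAt_id s).add ((h3.div_const (1 - α)).const_mul M)
        convert! h4 using 1
        have : 1 - α ≠ 0 := by linarith
        simp only [id, one_mul]
        rw [mul_div_cancel_left₀ _ this]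
        congr 3
        ring) hv
    have h3 : (1 + t) ^ (1 - α) ≤ (1 + τ) ^ (1 - α) + l ^ (1 - α) := by
      have := Real.rpow_add_le_add_rpow (p := 1 - α) (a := 1 + τ) (b := l) (by linarith) hl0
        (by linarith) (by linarith)
      rwa [show 1 + τ + l = 1 + t by rw [hl]; ring] at this
    have h4 : l ^ (1 - α) = l * l ^ (-α) := by
      rw [sub_eq_add_neg, Real.rpow_add (by linarith), Real.rpow_one]
    have h5 : (1 / 2) * l ^ (-α) ≤ (1 + l) ^ (-α) := by
      refine (mul_le_mul_of_nonneg_right h2 (by positivity)).trans ?_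
      rw [← Real.mul_rpow (by norm_num) hl0]
      exact Real.rpow_le_rpow_of_nonpos (by linarith) (by linarith) (by linarith)
    have h6 : M * ((1 + t) ^ (1 - α) / (1 - α)) - M * ((1 + τ) ^ (1 - α) / (1 - α)) ≤
        2 * M * l ^ (1 - α) := by
      rw [← mul_sub, ← sub_div, mul_comm 2 M, mul_assoc]
      refine mul_le_mul_of_nonneg_left ?_ hM.le
      rw [div_le_iff₀ (by linarith)]
      have : 0 ≤ l ^ (1 - α) := by positivity
      nlinarith
    have h7 : M * l * ((1 / 2) * l ^ (-α)) ≤ M * l * (1 + l) ^ (-α) :=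
      mul_le_mul_of_nonneg_left h5 (by positivity)
    rw [h4] at h6
    have h8 : (t + M * ((1 + t) ^ (1 - α) / (1 - α))) - (τ + M * ((1 + τ) ^ (1 - α) / (1 - α))) =
      l + (M * ((1 + t) ^ (1 - α) / (1 - α)) - M * ((1 + τ) ^ (1 - α) / (1 - α))) := by
      rw [hl]; ring
    nlinarith

end Trajectory

lemma mul_one_add_rpow_neg_le {α l L : ℝ} (hα : α ≤ 1) (hl : 0 ≤ l) (hL : l ≤ L) :
    l * (1 + l) ^ (-α) ≤ L * (1 + L) ^ (-α) := by
  have h1l : 0 < 1 + l := by linarith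
  have h1L : 0 < 1 + L := by linarith
  have h1 : ((1 + L) / (1 + l)) ^ α ≤ (1 + L) / (1 + l) := by
    have hone : 1 ≤ (1 + L) / (1 + l) := by rw [one_le_div h1l]; linarith
    simpa using Real.rpow_le_rpow_of_exponent_le hone hα
  rw [Real.div_rpow h1L.le h1l.le] at h1
  rw [Real.rpow_neg h1l.le, Real.rpow_neg h1L.le, ← div_eq_mul_inv, ← div_eq_mul_inv,
    div_le_div_iff₀ (by positivity) (by positivity)]
  rw [div_le_div_iff₀ (by positivity) h1l] at h1
  have h2 : 0 < (1 + l) ^ α := by positivity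
  have h3 : l * (1 + L) ≤ L * (1 + l) := by nlinarith
  have h4 : l * (1 + L) * (1 + l) ^ α ≤ L * (1 + l) * (1 + l) ^ α :=
    mul_le_mul_of_nonneg_right h3 h2.le
  have h5 : l * ((1 + L) ^ α * (1 + l)) ≤ l * ((1 + L) * (1 + l) ^ α) :=
    mul_le_mul_of_nonneg_left h1 hl
  refine le_of_mul_le_mul_right ?_ h1l
  nlinarith

/-- The decay in time of the kernels which occur in the remainder. -/
noncomputable def timeRate (α t τ u : ℝ) : ℝ :=
  (1 + (t - τ) + u) ^ (-(3 + α)) +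
    Set.indicator (Set.Ioi t) (fun u => (1 + u) ^ (-2 : ℝ) * (1 + t) ^ (-(1 + α))) u

/-- The displacement consists of the actual path on `[τ, t]` and a drift at velocity `P(t)` during
time `u`. The drift keeps the excess `(1 + t)^(-α)`, comparable to `L^(-α)` only while `u ≤ t`; for
`u > t` this excess is kept as it is and the factor `L⁻² ≤ u⁻²` provides integrability. -/
lemma exists_sonicRate_le_timeRate {n M : ℝ} (hn : 1 / 4 < n) (hM : 0 < M) :
    ∃ C, 0 ≤ C ∧ ∀ (T : ℝ) (X P A : ℝ → E5), IsTrajectory T X P A → Bootstrap n M T P A →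
      ∀ τ t u : ℝ, 0 ≤ τ → τ ≤ t → t ≤ T → 0 < u →
      ∃ δ, 0 ≤ δ ∧ ‖X t - X τ + u • P t‖ ≤ (t + u - τ) * (1 + δ) ∧
        sonicRate n (t + u - τ) δ ≤ C * timeRate (decayExp n) t τ u := by
  have hα0 := decayExp_pos hn
  have hα1 := decayExp_lt hn
  have hαn := decayExp_mul hn
  refine ⟨(12 * M) ^ (2 * n + 3) + 1, by positivity, fun T X P A hX hb τ t u hτ hτt ht hu => ?_⟩
  have h0 := norm_displacement_le hn hM hX hb hτ hτt ht
  have h1 := hb.norm_velocity_le hM ⟨hτ.trans hτt, ht⟩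
  set α := decayExp n
  set L := t + u - τ with hL
  have h1t : 0 < 1 + t := by linarith
  have hL0 : 0 < L := by linarith
  have h1L : 0 < 1 + L := by linarith
  set g : ℝ := Set.indicator (Set.Ioi t) (fun _ => (1 + t) ^ (-α)) u with hg
  have hg0 : 0 ≤ g := Set.indicator_nonneg (fun _ _ => by positivity) _
  have hpos : 0 < (1 + L) ^ (-α) := by positivity
  -- If `u ≤ t` then `L ≤ 2t`, whence `1 + t ≥ (1 + L)/2`; otherwise `g` is the left side itself.
  have h2 : (1 + t) ^ (-α) ≤ 2 * (1 + L) ^ (-α) + g := by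
    rcases le_or_gt u t with h | h
    · have h3 : (1 + t) ^ (-α) ≤ ((1 + L) / 2) ^ (-α) :=
        Real.rpow_le_rpow_of_nonpos (by linarith) (by linarith) (by linarith)
      rw [Real.div_rpow h1L.le (by norm_num), le_div_iff₀ (by positivity)] at h3
      have := half_le_two_rpow_neg (α := α) (by linarith)
      nlinarith [Real.rpow_pos_of_pos h1t (-α)]
    · rw [hg, Set.indicator_of_mem (show u ∈ Set.Ioi t from h)]
      linarith
  -- The coefficient is `4M` from the path plus `2M` from the drift; separating the two terms of `δ`
  -- later doubles it to `12M`.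
  refine ⟨6 * M * ((1 + L) ^ (-α) + g), by positivity, ?_, ?_⟩
  · have h3 := mul_one_add_rpow_neg_le (α := α) (l := t - τ) (L := L) (by linarith)
      (by linarith) (by linarith)
    have h4 : ‖u • P t‖ ≤ u + L * (M * (2 * (1 + L) ^ (-α) + g)) := by
      rw [norm_smul, Real.norm_of_nonneg hu.le]
      calc u * ‖P t‖ ≤ u * (1 + M * (1 + t) ^ (-α)) := mul_le_mul_of_nonneg_left h1 hu.le
        _ = u + u * (M * (1 + t) ^ (-α)) := by ring
        _ ≤ u + L * (M * (2 * (1 + L) ^ (-α) + g)) :=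
          add_le_add_right (mul_le_mul (by linarith) (mul_le_mul_of_nonneg_left h2 hM.le)
            (by positivity) hL0.le) u
    have h5 := norm_add_le (X t - X τ) (u • P t)
    have h6 : 4 * M * ((t - τ) * (1 + (t - τ)) ^ (-α)) ≤ 4 * M * (L * (1 + L) ^ (-α)) :=
      mul_le_mul_of_nonneg_left h3 (by positivity)
    have h7 : 0 ≤ L * (M * g) := by positivity
    nlinarith
  · have hLu : 1 + (t - τ) + u = 1 + L := by rw [hL]; ring
    rw [sonicRate, timeRate, hLu]
    have hG : g ^ (2 * n + 3) = Set.indicator (Set.Ioi t) (fun _ => (1 + t) ^ (-(1 + α))) u := by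
      rw [hg]
      by_cases h : u ∈ Set.Ioi t
      · rw [Set.indicator_of_mem h, Set.indicator_of_mem h, ← Real.rpow_mul h1t.le, neg_mul, hαn]
      · rw [Set.indicator_of_notMem h, Set.indicator_of_notMem h, Real.zero_rpow (by linarith)]
    have h3 := min_one_add_rpow_le (p := 2 * n + 3) (by linarith)
      (a := 6 * M * (1 + L) ^ (-α)) (b := 6 * M * g) (by positivity) (by positivity)
    rw [← mul_add] at h3
    have h4 : min 1 (6 * M * (1 + L) ^ (-α)) ^ (2 * n + 3) ≤
        (6 * M) ^ (2 * n + 3) * (1 + L) ^ (-(1 + α)) := by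
      refine (Real.rpow_le_rpow (le_min zero_le_one (by positivity)) (min_le_right _ _)
        (by linarith)).trans (le_of_eq ?_)
      rw [Real.mul_rpow (by positivity) hpos.le, ← Real.rpow_mul h1L.le, neg_mul, hαn]
    have h5 : min 1 (6 * M * g) ^ (2 * n + 3) ≤ (6 * M) ^ (2 * n + 3) * g ^ (2 * n + 3) := by
      refine (Real.rpow_le_rpow (le_min zero_le_one (by positivity)) (min_le_right _ _)
        (by linarith)).trans (le_of_eq ?_)
      rw [Real.mul_rpow (by positivity) hg0]
    set G := g ^ (2 * n + 3) with hGdef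
    have hG0 : 0 ≤ G := by positivity
    have h6 : min 1 (6 * M * ((1 + L) ^ (-α) + g)) ^ (2 * n + 3) ≤
        (12 * M) ^ (2 * n + 3) * ((1 + L) ^ (-(1 + α)) + G) := by
      refine h3.trans ((mul_le_mul_of_nonneg_left (add_le_add h4 h5) (by positivity)).trans
        (le_of_eq ?_))
      rw [← mul_add, ← mul_assoc, ← Real.mul_rpow (by norm_num) (by positivity)]
      ring_nf
    have h7 : (1 + L) ^ (-(17 / 5) : ℝ) ≤ (1 + L) ^ (-(3 + α)) :=
      Real.rpow_le_rpow_of_exponent_le (by linarith) (by linarith)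
    have h8 : (1 + L) ^ (-2 : ℝ) * (1 + L) ^ (-(1 + α)) = (1 + L) ^ (-(3 + α)) := by
      rw [← Real.rpow_add h1L]
      congr 1
      ring
    have h9 : (1 + L) ^ (-2 : ℝ) * G ≤
        Set.indicator (Set.Ioi t) (fun u => (1 + u) ^ (-2 : ℝ) * (1 + t) ^ (-(1 + α))) u := by
      rw [hG]
      by_cases h : u ∈ Set.Ioi t
      · rw [Set.indicator_of_mem h, Set.indicator_of_mem h]
        refine mul_le_mul_of_nonneg_right ?_ (by positivity)
        exact Real.rpow_le_rpow_of_nonpos (by linarith) (by linarith) (by norm_num)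
      · rw [Set.indicator_of_notMem h, Set.indicator_of_notMem h, mul_zero]
    set J := Set.indicator (Set.Ioi t) (fun u => (1 + u) ^ (-2 : ℝ) * (1 + t) ^ (-(1 + α))) u
    have hk : 0 ≤ (12 * M) ^ (2 * n + 3) := by positivity
    set k := (12 * M) ^ (2 * n + 3)
    have h10 : 0 ≤ (1 + L) ^ (-2 : ℝ) := by positivity
    have h11 : 0 ≤ J := le_trans (by positivity) h9
    have h12 : 0 ≤ (1 + L) ^ (-(3 + α)) := by positivity
    calc _ ≤ (1 + L) ^ (-2 : ℝ) * (k * ((1 + L) ^ (-(1 + α)) + G)) + (1 + L) ^ (-(3 + α)) :=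
          add_le_add (mul_le_mul_of_nonneg_left h6 h10) h7
      _ = k * ((1 + L) ^ (-2 : ℝ) * (1 + L) ^ (-(1 + α)) + (1 + L) ^ (-2 : ℝ) * G) +
          (1 + L) ^ (-(3 + α)) := by ring
      _ ≤ k * ((1 + L) ^ (-(3 + α)) + J) + (1 + L) ^ (-(3 + α)) := by
          rw [h8]
          gcongr
      _ ≤ _ := by linarith [add_mul k 1 ((1 + L) ^ (-(3 + α)) + J)]


/-! ### Integration of the decay rates over the time parameters -/

lemma lintegral_Ioi_add_rpow {p a b : ℝ} (hp : 1 < p) (hab : 0 < a + b) :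
    ∫⁻ u in Set.Ioi a, ENNReal.ofReal ((b + u) ^ (-p)) =
      ENNReal.ofReal ((a + b) ^ (1 - p) / (p - 1)) := by
  have hshift : ∫⁻ u in Set.Ioi a, ENNReal.ofReal ((b + u) ^ (-p)) =
      ∫⁻ v in Set.Ioi (a + b), ENNReal.ofReal (v ^ (-p)) := by
    rw [← lintegral_indicator measurableSet_Ioi, ← lintegral_indicator measurableSet_Ioi]
    refine Eq.trans (lintegral_congr fun u => ?_) (lintegral_add_left_eq_self _ b)
    by_cases h : a < u
    · rw [Set.indicator_of_mem (show u ∈ Set.Ioi a from h),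
        Set.indicator_of_mem (show b + u ∈ Set.Ioi (a + b) by
          rw [Set.mem_Ioi, add_comm]; linarith)]
    · rw [Set.indicator_of_notMem (show u ∉ Set.Ioi a from h),
        Set.indicator_of_notMem (show b + u ∉ Set.Ioi (a + b) by
          rw [Set.mem_Ioi, add_comm a]; simpa using h)]
  rw [hshift, ← ofReal_integral_eq_lintegral_ofReal
    (integrableOn_Ioi_rpow_of_lt (by linarith) hab)
    ((ae_restrict_iff' measurableSet_Ioi).2 (Filter.Eventually.of_forall fun v hv =>
      Real.rpow_nonneg (hab.trans hv).le _)), integral_Ioi_rpow_of_lt (by linarith) hab,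
    show -p + 1 = 1 - p by ring, neg_div, ← div_neg]
  congr 2
  ring

lemma lintegral_Ioc_sub_rpow_le {p s t : ℝ} (hp : 1 < p) (hst : s ≤ t) :
    ∫⁻ τ in Set.Ioc 0 s, ENNReal.ofReal ((1 + (t - τ)) ^ (-p)) ≤
      ENNReal.ofReal ((1 + (t - s)) ^ (1 - p) / (p - 1)) := by
  have h := lintegral_Ioi_add_rpow (p := p) (a := 0) (b := 1 + (t - s)) hp (by linarith)
  rw [zero_add] at h
  rw [← h, setLIntegral_congr Ioi_ae_eq_Ici, ← lintegral_indicator measurableSet_Ioc,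
    ← lintegral_indicator measurableSet_Ici]
  refine le_trans (lintegral_mono fun τ => ?_) (lintegral_sub_left_eq_self
    ((Set.Ici 0).indicator fun u => ENNReal.ofReal ((1 + (t - s) + u) ^ (-p))) s).le
  by_cases hτ : τ ∈ Set.Ioc 0 s
  swap
  · rw [Set.indicator_of_notMem hτ]
    exact zero_le
  rw [Set.indicator_of_mem hτ]
  rw [Set.indicator_of_mem (show s - τ ∈ Set.Ici 0 by simpa using hτ.2),
    show 1 + (t - s) + (s - τ) = 1 + (t - τ) by ring]

lemma measurable_timeRate (α t : ℝ) : Measurable fun p : ℝ × ℝ => timeRate α t p.1 p.2 := by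
  have h : Measurable fun u : ℝ => Set.indicator (Set.Ioi t)
      (fun u => (1 + u) ^ (-2 : ℝ) * (1 + t) ^ (-(1 + α))) u :=
    Measurable.indicator (by fun_prop) measurableSet_Ioi
  unfold timeRate
  exact Measurable.add (by fun_prop) (h.comp measurable_snd)

/-- Integration in `u` costs one power. The tail `u > t` gives `(1 + t)⁻¹(1 + t)^(-(1+α))`, which is
smaller than the main contribution since `1 + t ≥ 1 + (t - τ)`. -/
lemma lintegral_timeRate_le {α t τ : ℝ} (hα : 0 < α) (hτ : 0 ≤ τ) (hτt : τ ≤ t) :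
    ∫⁻ u in Set.Ioi 0, ENNReal.ofReal (timeRate α t τ u) ≤
      ENNReal.ofReal (2 * (1 + (t - τ)) ^ (-(2 + α))) := by
  have h1t : 0 < 1 + t := by linarith
  have h1l : 0 < 1 + (t - τ) := by linarith
  have h1 := lintegral_Ioi_add_rpow (p := 3 + α) (a := 0) (b := 1 + (t - τ)) (by linarith)
    (by linarith)
  have h2 := lintegral_Ioi_add_rpow (p := 2) (a := t) (b := 1) (by norm_num) (by linarith)
  have hm : Measurable fun u : ℝ => ENNReal.ofReal ((1 + (t - τ) + u) ^ (-(3 + α))) := by fun_prop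
  calc ∫⁻ u in Set.Ioi 0, ENNReal.ofReal (timeRate α t τ u)
      ≤ ∫⁻ u in Set.Ioi 0, (ENNReal.ofReal ((1 + (t - τ) + u) ^ (-(3 + α))) +
          ENNReal.ofReal (Set.indicator (Set.Ioi t)
            (fun u => (1 + u) ^ (-2 : ℝ) * (1 + t) ^ (-(1 + α))) u)) :=
        lintegral_mono fun u => ENNReal.ofReal_add_le
    _ ≤ ENNReal.ofReal ((0 + (1 + (t - τ))) ^ (1 - (3 + α)) / (3 + α - 1)) +
          ENNReal.ofReal ((t + 1) ^ (1 - 2 : ℝ) / (2 - 1)) * ENNReal.ofReal ((1 + t) ^ (-(1 + α))) := by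
        rw [lintegral_add_left hm, h1]
        refine add_le_add_right ?_ _
        rw [← h2, ← lintegral_mul_const _ (by fun_prop)]
        refine (setLIntegral_le_lintegral _ _).trans ?_
        rw [← lintegral_indicator measurableSet_Ioi]
        refine lintegral_mono fun u => ?_
        by_cases h : u ∈ Set.Ioi t
        · rw [Set.indicator_of_mem h, Set.indicator_of_mem h]
          have : 0 < 1 + u := by have : t < u := h; linarith
          rw [ENNReal.ofReal_mul (by positivity)]
        · rw [Set.indicator_of_notMem h, Set.indicator_of_notMem h, ENNReal.ofReal_zero]
    _ ≤ _ := by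
        rw [zero_add, add_comm t 1, show (2 : ℝ) - 1 = 1 by norm_num, div_one,
          ← ENNReal.ofReal_mul (by positivity),
          ← ENNReal.ofReal_add (div_nonneg (by positivity) (by linarith)) (by positivity)]
        refine ENNReal.ofReal_le_ofReal ?_
        rw [show 1 - (3 + α) = -(2 + α) by ring, ← Real.rpow_add h1t,
          show (1 - 2 : ℝ) + -(1 + α) = -(2 + α) by ring]
        have h3 : (1 + (t - τ)) ^ (-(2 + α)) / (3 + α - 1) ≤ (1 + (t - τ)) ^ (-(2 + α)) :=
          div_le_self (by positivity) (by linarith)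
        have h4 : (1 + t) ^ (-(2 + α)) ≤ (1 + (t - τ)) ^ (-(2 + α)) :=
          Real.rpow_le_rpow_of_nonpos h1l (by linarith) (by linarith)
        linarith

/-- One of `s` and `t - s` is at least `t/2`; its factor is bounded by the decay in `t` and the
other one is kept for integration. -/
lemma convolution_rpow_le {p s t : ℝ} (hp : 0 ≤ p) (hs : 0 ≤ s) (hst : s ≤ t) :
    (1 + s) ^ (-p) * (1 + (t - s)) ^ (-p) ≤
      2 ^ p * (1 + t) ^ (-p) * ((1 + s) ^ (-p) + (1 + (t - s)) ^ (-p)) := by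
  have h1t : 0 < 1 + t := by linarith
  have key : ∀ r, 0 ≤ r → t / 2 ≤ r → (1 + r) ^ (-p) ≤ 2 ^ p * (1 + t) ^ (-p) := fun r hr h => by
    have h1 : (1 + r) ^ (-p) ≤ ((1 + t) / 2) ^ (-p) :=
      Real.rpow_le_rpow_of_nonpos (by linarith) (by linarith) (by linarith)
    rwa [Real.div_rpow h1t.le (by norm_num), Real.rpow_neg (by norm_num : (0 : ℝ) ≤ 2), div_inv_eq_mul,
      mul_comm] at h1
  have ha : 0 ≤ (1 + s) ^ (-p) := by positivity
  have hb : 0 ≤ (1 + (t - s)) ^ (-p) := Real.rpow_nonneg (by linarith) _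
  have hk : 0 ≤ 2 ^ p * (1 + t) ^ (-p) := by positivity
  rcases le_total (t / 2) s with h | h
  · have h1 := mul_le_mul_of_nonneg_right (key s hs h) hb
    nlinarith
  · have h1 := mul_le_mul_of_nonneg_left (key (t - s) (by linarith) (by linarith)) ha
    nlinarith

lemma lintegral_convolution_le {α t : ℝ} (hα : 0 < α) (ht : 0 ≤ t) :
    ∫⁻ s in Set.Ioc 0 t, ENNReal.ofReal ((1 + s) ^ (-(1 + α)) * (2 * (1 + (t - s)) ^ (-(1 + α)))) ≤
      ENNReal.ofReal (2 ^ (3 + α) / α * (1 + t) ^ (-(1 + α))) := by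
  have h1t : 0 < 1 + t := by linarith
  set k : ℝ := 2 * (2 ^ (1 + α) * (1 + t) ^ (-(1 + α)))
  have hk : 0 ≤ k := by positivity
  have h1 : ∫⁻ s in Set.Ioc 0 t, ENNReal.ofReal ((1 + s) ^ (-(1 + α))) ≤ ENNReal.ofReal (1 / α) := by
    refine (lintegral_mono_set Set.Ioc_subset_Ioi_self).trans (le_of_eq ?_)
    rw [lintegral_Ioi_add_rpow (by linarith) (by norm_num)]
    norm_num
  have h2 : ∫⁻ s in Set.Ioc 0 t, ENNReal.ofReal ((1 + (t - s)) ^ (-(1 + α))) ≤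
      ENNReal.ofReal (1 / α) := by
    refine (lintegral_Ioc_sub_rpow_le (p := 1 + α) (by linarith) le_rfl).trans (le_of_eq ?_)
    norm_num
  calc _ ≤ ∫⁻ s in Set.Ioc 0 t, ENNReal.ofReal k * (ENNReal.ofReal ((1 + s) ^ (-(1 + α))) +
        ENNReal.ofReal ((1 + (t - s)) ^ (-(1 + α)))) := by
        refine setLIntegral_mono' measurableSet_Ioc fun s hs => ?_
        have h0s : 0 < 1 + s := by linarith [hs.1]
        have h0l : 0 < 1 + (t - s) := by linarith [hs.2]
        rw [← ENNReal.ofReal_add (by positivity) (by positivity), ← ENNReal.ofReal_mul hk]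
        refine ENNReal.ofReal_le_ofReal ?_
        have := convolution_rpow_le (p := 1 + α) (by linarith) hs.1.le hs.2
        simp only [k]
        linarith
    _ = ENNReal.ofReal k * ((∫⁻ s in Set.Ioc 0 t, ENNReal.ofReal ((1 + s) ^ (-(1 + α)))) +
        ∫⁻ s in Set.Ioc 0 t, ENNReal.ofReal ((1 + (t - s)) ^ (-(1 + α)))) := by
        rw [lintegral_const_mul _ (by fun_prop), lintegral_add_left (by fun_prop)]
    _ ≤ ENNReal.ofReal k * (ENNReal.ofReal (1 / α) + ENNReal.ofReal (1 / α)) := by gcongr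
    _ = _ := by
        rw [← ENNReal.ofReal_add (by positivity) (by positivity), ← ENNReal.ofReal_mul hk]
        congr 1
        rw [show (3 : ℝ) + α = 2 + (1 + α) by ring, Real.rpow_add (by norm_num) 2 (1 + α)]
        simp only [k]
        norm_num
        ring

/-- The parameters `(s, τ, u)`: two times in `(0, t]` and a positive number. -/
noncomputable def timeMeasure (t : ℝ) : Measure ((ℝ × ℝ) × ℝ) :=
  ((volume.restrict (Set.Ioc 0 t)).prod (volume.restrict (Set.Ioc 0 t))).prod
    (volume.restrict (Set.Ioi 0))

instance (t : ℝ) : SFinite (timeMeasure t) := by unfold timeMeasure; infer_instance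

/-- The region where the two times are ordered. -/
def orderedTimes : Set ((ℝ × ℝ) × ℝ) := {p | p.1.2 ≤ p.1.1}

lemma measurableSet_orderedTimes : MeasurableSet orderedTimes :=
  measurableSet_le (by fun_prop) (by fun_prop)

lemma ae_timeMeasure (t : ℝ) :
    ∀ᵐ p ∂timeMeasure t, p.1.1 ∈ Set.Ioc 0 t ∧ p.1.2 ∈ Set.Ioc 0 t ∧ 0 < p.2 := by
  rw [timeMeasure, Measure.prod_restrict, Measure.prod_restrict,
    ae_restrict_iff' ((measurableSet_Ioc.prod measurableSet_Ioc).prod measurableSet_Ioi)]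
  exact Filter.Eventually.of_forall fun p hp => ⟨hp.1.1, hp.1.2, hp.2⟩

/-- Integration over the time parameters preserves the decay rate of the acceleration. -/
lemma norm_integral_timeMeasure_le {α t D : ℝ} (hα : 0 < α) (ht : 0 ≤ t) (hD : 0 ≤ D)
    {Φ : (ℝ × ℝ) × ℝ → ℂ} (hΦ : ∀ p : (ℝ × ℝ) × ℝ, p.1.1 ∈ Set.Ioc 0 t → p.1.2 ∈ Set.Ioc 0 t →
      0 < p.2 → p ∈ orderedTimes →
        ‖Φ p‖ ≤ D * ((1 + p.1.1) ^ (-(1 + α)) * timeRate α t p.1.2 p.2)) :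
    ‖∫ p, orderedTimes.indicator Φ p ∂timeMeasure t‖ ≤
      D * (2 ^ (3 + α) / α * (1 + t) ^ (-(1 + α))) := by
  have h1t : 0 < 1 + t := by linarith
  -- The estimate is carried out on extended nonnegative integrals of a measurable majorant, so
  -- nothing needs to be known about the measurability of `Φ`.
  set B : (ℝ × ℝ) × ℝ → ℝ≥0∞ := orderedTimes.indicator fun p =>
    ENNReal.ofReal (D * ((1 + p.1.1) ^ (-(1 + α)))) * ENNReal.ofReal (timeRate α t p.1.2 p.2) with hB
  have hBm : Measurable B := by
    refine Measurable.indicator ?_ measurableSet_orderedTimes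
    have h := (measurable_timeRate α t).comp
      (f := fun p : (ℝ × ℝ) × ℝ => (p.1.2, p.2)) (by fun_prop)
    exact Measurable.mul (by fun_prop) h.ennreal_ofReal
  have hle : ∫⁻ p, ‖orderedTimes.indicator Φ p‖ₑ ∂timeMeasure t ≤ ∫⁻ p, B p ∂timeMeasure t := by
    refine lintegral_mono_ae ?_
    filter_upwards [ae_timeMeasure t] with p hp
    by_cases h : p ∈ orderedTimes
    · rw [hB, Set.indicator_of_mem h, Set.indicator_of_mem h, ← ofReal_norm]
      have h0 : 0 < 1 + p.1.1 := by linarith [hp.1.1]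
      rw [← ENNReal.ofReal_mul (by positivity), mul_assoc]
      exact ENNReal.ofReal_le_ofReal (hΦ p hp.1 hp.2.1 hp.2.2 h)
    · rw [Set.indicator_of_notMem h, enorm_zero]
      exact zero_le
  have hBint : ∫⁻ p, B p ∂timeMeasure t ≤
      ENNReal.ofReal (D * (2 ^ (3 + α) / α * (1 + t) ^ (-(1 + α)))) := by
    rw [timeMeasure, lintegral_prod _ hBm.aemeasurable,
      lintegral_prod _ (hBm.lintegral_prod_right').aemeasurable, ENNReal.ofReal_mul hD]
    refine le_trans ?_ (mul_le_mul_right (lintegral_convolution_le hα ht) _)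
    rw [← lintegral_const_mul _ (by fun_prop)]
    refine setLIntegral_mono' measurableSet_Ioc fun s hs => ?_
    have h0s : 0 < 1 + s := by linarith [hs.1]
    rw [ENNReal.ofReal_mul (by positivity), ← mul_assoc, ← ENNReal.ofReal_mul hD]
    calc ∫⁻ τ in Set.Ioc 0 t, ∫⁻ u in Set.Ioi 0, B ((s, τ), u)
        ≤ ∫⁻ τ in Set.Ioc 0 t, (Set.Ioc 0 s).indicator (fun τ =>
            ENNReal.ofReal (D * ((1 + s) ^ (-(1 + α)))) *
              ENNReal.ofReal (2 * (1 + (t - τ)) ^ (-(2 + α)))) τ := by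
          refine setLIntegral_mono' measurableSet_Ioc fun τ hτ => ?_
          by_cases h : τ ≤ s
          · rw [Set.indicator_of_mem (show τ ∈ Set.Ioc 0 s from ⟨hτ.1, h⟩)]
            have h1 : ∀ u, B ((s, τ), u) = ENNReal.ofReal (D * ((1 + s) ^ (-(1 + α)))) *
                ENNReal.ofReal (timeRate α t τ u) := fun u =>
              Set.indicator_of_mem (show ((s, τ), u) ∈ orderedTimes from h) _
            simp only [h1]
            have hmu : Measurable fun u => ENNReal.ofReal (timeRate α t τ u) :=
              ((measurable_timeRate α t).comp (f := fun u : ℝ => (τ, u))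
                (by fun_prop)).ennreal_ofReal
            rw [lintegral_const_mul _ hmu]
            exact mul_le_mul_right (lintegral_timeRate_le hα hτ.1.le hτ.2) _
          · have h1 : ∀ u, B ((s, τ), u) = 0 := fun u =>
              Set.indicator_of_notMem (show ((s, τ), u) ∉ orderedTimes from h) _
            simp only [h1, lintegral_zero]
            exact zero_le
      _ ≤ ∫⁻ τ in Set.Ioc 0 s, ENNReal.ofReal (D * ((1 + s) ^ (-(1 + α)))) *
              ENNReal.ofReal (2 * (1 + (t - τ)) ^ (-(2 + α))) := by
          refine (setLIntegral_le_lintegral _ _).trans (le_of_eq ?_)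
          rw [lintegral_indicator measurableSet_Ioc]
      _ = ENNReal.ofReal (D * ((1 + s) ^ (-(1 + α)))) * (ENNReal.ofReal 2 *
            ∫⁻ τ in Set.Ioc 0 s, ENNReal.ofReal ((1 + (t - τ)) ^ (-(2 + α)))) := by
          simp only [ENNReal.ofReal_mul (by norm_num : (0 : ℝ) ≤ 2)]
          rw [lintegral_const_mul _ (by fun_prop), lintegral_const_mul _ (by fun_prop)]
      _ ≤ ENNReal.ofReal (D * ((1 + s) ^ (-(1 + α)))) *
            ENNReal.ofReal (2 * (1 + (t - s)) ^ (-(1 + α))) := by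
          rw [ENNReal.ofReal_mul (by norm_num : (0 : ℝ) ≤ 2)]
          refine mul_le_mul_right (mul_le_mul_right
            ((lintegral_Ioc_sub_rpow_le (by linarith) hs.2).trans
              (ENNReal.ofReal_le_ofReal ?_)) _) _
          have h0l : 0 < 1 + (t - s) := by linarith [hs.2]
          rw [show 1 - (2 + α) = -(1 + α) by ring]
          exact div_le_self (by positivity) (by linarith)
  have hfin := (enorm_integral_le_lintegral_enorm _).trans (hle.trans hBint)
  rw [← ofReal_norm] at hfin
  exact (ENNReal.ofReal_le_ofReal_iff (by positivity)).1 hfin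


/-! ### The time representation of the remainder -/

/-- The integrand of the representation of `factorD` over the time parameters. -/
noncomputable def timeIntegrand (θ : ℝ) (X P A : ℝ → E5) (ε t : ℝ) (ξ : E5)
    (p : (ℝ × ℝ) × ℝ) : ℂ :=
  ((Real.exp (-(ε * p.2)) * inner ℝ (A p.1.1) ξ : ℝ) : ℂ) *
    Complex.exp (Complex.I * ((θ * (t + p.2 - p.1.2) * disp ‖ξ‖ +
      inner ℝ (X t - X p.1.2 + p.2 • P t) ξ : ℝ) : ℂ))

section Representation

variable {θ ε t b : ℝ} {X P A : ℝ → E5}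

lemma norm_timeIntegrand_le (hA : ∀ s, ‖A s‖ ≤ b) (ξ : E5) (p : (ℝ × ℝ) × ℝ) :
    ‖timeIntegrand θ X P A ε t ξ p‖ ≤ b * ‖ξ‖ * Real.exp (-(ε * p.2)) := by
  rw [timeIntegrand, norm_mul_exp_I, abs_mul, abs_of_pos (Real.exp_pos _), mul_comm]
  refine mul_le_mul_of_nonneg_right ((abs_real_inner_le_norm _ _).trans ?_) (Real.exp_pos _).le
  exact mul_le_mul_of_nonneg_right (hA _) (norm_nonneg _)

lemma continuous_timeIntegrand (hX : Continuous X) (hA : Continuous A) :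
    Continuous fun r : E5 × ((ℝ × ℝ) × ℝ) => timeIntegrand θ X P A ε t r.1 r.2 := by
  have := continuous_disp
  unfold timeIntegrand
  fun_prop

/-- `factorD` as an absolutely convergent integral over time parameters. -/
lemma factorD_eq_integral (hX : Continuous X) (hA : Continuous A) (hε : 0 < ε) (ht : 0 ≤ t)
    (ξ : E5) :
    factorD θ X P A ε t ξ =
      -Complex.I * ∫ p, orderedTimes.indicator (timeIntegrand θ X P A ε t ξ) p ∂timeMeasure t := by
  set β : ℂ := Complex.I * ((θ * phi1 ξ + inner ℝ (P t) ξ : ℝ) : ℂ) - (ε : ℂ) with hβ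
  set e₀ : ℂ := Complex.exp (Complex.I * ((θ * t * phi1 ξ + inner ℝ (X t - X 0) ξ : ℝ) : ℂ))
  set h : ℝ → ℝ → ℂ := fun s τ => ((inner ℝ (A s) ξ : ℝ) : ℂ) *
    Complex.exp (-(Complex.I * ((θ * τ * phi1 ξ + inner ℝ (X τ - X 0) ξ : ℝ) : ℂ))) with hh
  set H : ℝ × ℝ → ℂ := {p : ℝ × ℝ | p.2 ≤ p.1}.indicator fun p => h p.1 p.2 with hH
  have hS : MeasurableSet {p : ℝ × ℝ | p.2 ≤ p.1} := measurableSet_le (by fun_prop) (by fun_prop)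
  have hhc : Continuous fun p : ℝ × ℝ => h p.1 p.2 := by simp only [hh]; fun_prop
  have hre : β.re = -ε := by simp [hβ]
  -- The regularization `ε > 0` gives `β` a negative real part, so its inverse is minus a convergent
  -- Laplace integral.
  have hint : ∫ u in Set.Ioi (0 : ℝ), Complex.exp (β * u) = -β⁻¹ := by
    have := integral_exp_mul_complex_Ioi (a := β) (by rw [hre]; linarith) 0
    rw [this]
    simp [neg_div]
  have hsplit : ∀ p : (ℝ × ℝ) × ℝ, orderedTimes.indicator (timeIntegrand θ X P A ε t ξ) p =
      H p.1 * (e₀ * Complex.exp (β * p.2)) := fun p => by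
    by_cases hp : p.1.2 ≤ p.1.1
    · rw [Set.indicator_of_mem (show p ∈ orderedTimes from hp), hH,
        Set.indicator_of_mem (show p.1 ∈ {p : ℝ × ℝ | p.2 ≤ p.1} from hp), timeIntegrand]
      simp only [hh, e₀, hβ]
      rw [Complex.ofReal_mul, Complex.ofReal_exp, mul_comm (Complex.exp _) ((inner ℝ _ _ : ℝ) : ℂ),
        mul_assoc ((inner ℝ _ _ : ℝ) : ℂ), mul_assoc ((inner ℝ _ _ : ℝ) : ℂ)]
      congr 1
      rw [← Complex.exp_add, ← Complex.exp_add, ← Complex.exp_add]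
      congr 1
      simp only [inner_add_left, inner_sub_left, inner_smul_left, phi1_eq_disp]
      push_cast
      simp only [RCLike.conj_to_real]
      ring
    · rw [Set.indicator_of_notMem (show p ∉ orderedTimes from hp), hH,
        Set.indicator_of_notMem (show p.1 ∉ {p : ℝ × ℝ | p.2 ≤ p.1} from hp), zero_mul]
  simp only [hsplit]
  rw [timeMeasure, integral_prod_mul (f := H) (g := fun u : ℝ => e₀ * Complex.exp (β * u)),
    integral_const_mul, hint]
  have hHint : Integrable H ((volume.restrict (Set.Ioc 0 t)).prod
      (volume.restrict (Set.Ioc 0 t))) := by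
    rw [Measure.prod_restrict]
    have h1 : IntegrableOn (fun p : ℝ × ℝ => h p.1 p.2) (Set.Icc 0 t ×ˢ Set.Icc 0 t)
        (volume.prod volume) :=
      hhc.continuousOn.integrableOn_compact (isCompact_Icc.prod isCompact_Icc)
    exact (h1.mono_set (Set.prod_mono Set.Ioc_subset_Icc_self Set.Ioc_subset_Icc_self)).indicator hS
  have hiter : ∫ p, H p ∂((volume.restrict (Set.Ioc 0 t)).prod (volume.restrict (Set.Ioc 0 t))) =
      ∫ s in (0 : ℝ)..t, ∫ τ in (0 : ℝ)..s, h s τ := by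
    rw [integral_prod _ hHint, intervalIntegral.integral_of_le ht]
    refine setIntegral_congr_fun measurableSet_Ioc fun s hs => ?_
    have h2 : (fun τ => H (s, τ)) = (Set.Iic s).indicator (h s) := by
      funext τ
      by_cases hτ : τ ≤ s
      · rw [hH, Set.indicator_of_mem (show (s, τ) ∈ {p : ℝ × ℝ | p.2 ≤ p.1} from hτ),
          Set.indicator_of_mem (show τ ∈ Set.Iic s from hτ)]
      · rw [hH, Set.indicator_of_notMem (show (s, τ) ∉ {p : ℝ × ℝ | p.2 ≤ p.1} from hτ),
          Set.indicator_of_notMem (show τ ∉ Set.Iic s from hτ)]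
    rw [h2, setIntegral_indicator measurableSet_Iic, intervalIntegral.integral_of_le hs.1.le,
      Set.Ioc_inter_Iic, min_eq_right hs.2]
  rw [hiter, factorD, div_eq_mul_inv]
  ring

/-- The Fourier side of the remainder is a time integral of the kernels of the potential. -/
lemma integral_potWeight_mul_factorD {W : E5 → ℝ} (hW : Integrable W volume)
    (hpot : Integrable (fun ξ => potWeight W ξ * ‖ξ‖ ^ 2) volume)
    (hX : Continuous X) (hA : Continuous A) (hb : ∀ s, ‖A s‖ ≤ b) (hε : 0 < ε) (ht : 0 ≤ t)
    (a : E5) :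
    Integrable (fun ξ => ((potWeight W ξ * inner ℝ a ξ : ℝ) : ℂ) * factorD θ X P A ε t ξ) volume ∧
    ∫ ξ, ((potWeight W ξ * inner ℝ a ξ : ℝ) : ℂ) * factorD θ X P A ε t ξ =
      -Complex.I * ∫ p, orderedTimes.indicator (fun p => (Real.exp (-(ε * p.2)) : ℂ) *
        potKernel W θ (t + p.2 - p.1.2) a (A p.1.1) (X t - X p.1.2 + p.2 • P t)) p
          ∂timeMeasure t := by
  have hb0 : 0 ≤ b := (norm_nonneg _).trans (hb 0)
  -- Fubini needs absolute convergence in `u`, which the damping supplies for each fixed `ε`. The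
  -- size of this integral does not enter the final bound.
  have hexp : Integrable (fun p : (ℝ × ℝ) × ℝ => (1 : ℝ) * Real.exp (-(ε * p.2)))
      (timeMeasure t) := by
    refine Integrable.mul_prod (f := fun _ : ℝ × ℝ => (1 : ℝ))
      (g := fun u : ℝ => Real.exp (-(ε * u))) (integrable_const _) ?_
    have h := exp_neg_integrableOn_Ioi 0 hε
    simp only [neg_mul] at h
    exact h
  have hmeas : AEStronglyMeasurable (fun r : E5 × ((ℝ × ℝ) × ℝ) =>
      ((potWeight W r.1 * inner ℝ a r.1 : ℝ) : ℂ) *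
        orderedTimes.indicator (timeIntegrand θ X P A ε t r.1) r.2)
      (volume.prod (timeMeasure t)) := by
    have h1 : Continuous fun r : E5 × ((ℝ × ℝ) × ℝ) =>
        ((potWeight W r.1 * inner ℝ a r.1 : ℝ) : ℂ) := by
      have := continuous_potWeight hW
      fun_prop
    have h2 := ((continuous_timeIntegrand (θ := θ) (P := P) (ε := ε) (t := t) hX hA).measurable.indicator
      (measurable_snd (α := E5) measurableSet_orderedTimes))
    exact h1.aestronglyMeasurable.mul h2.aestronglyMeasurable
  have hint : Integrable (fun r : E5 × ((ℝ × ℝ) × ℝ) =>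
      ((potWeight W r.1 * inner ℝ a r.1 : ℝ) : ℂ) *
        orderedTimes.indicator (timeIntegrand θ X P A ε t r.1) r.2)
      (volume.prod (timeMeasure t)) := by
    refine ((hpot.mul_prod hexp).const_mul (‖a‖ * b)).mono' hmeas
      (Filter.Eventually.of_forall fun r => ?_)
    rw [norm_mul, Complex.norm_real, norm_mul, Real.norm_of_nonneg (potWeight_nonneg _ _)]
    have h1 : ‖orderedTimes.indicator (timeIntegrand θ X P A ε t r.1) r.2‖ ≤
        b * ‖r.1‖ * Real.exp (-(ε * r.2.2)) :=
      (norm_indicator_le_norm_self _ _).trans (norm_timeIntegrand_le hb _ _)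
    have h2 : ‖(inner ℝ a r.1 : ℝ)‖ ≤ ‖a‖ * ‖r.1‖ := abs_real_inner_le_norm _ _
    have h0 := potWeight_nonneg W r.1
    calc _ ≤ potWeight W r.1 * (‖a‖ * ‖r.1‖) * (b * ‖r.1‖ * Real.exp (-(ε * r.2.2))) := by
          gcongr
      _ = _ := by ring
  have hD : ∀ ξ, ((potWeight W ξ * inner ℝ a ξ : ℝ) : ℂ) * factorD θ X P A ε t ξ =
      -Complex.I * ∫ p, ((potWeight W ξ * inner ℝ a ξ : ℝ) : ℂ) *
        orderedTimes.indicator (timeIntegrand θ X P A ε t ξ) p ∂timeMeasure t := fun ξ => by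
    rw [factorD_eq_integral hX hA hε ht, integral_const_mul]
    ring
  simp only [hD]
  refine ⟨hint.integral_prod_left.const_mul _, ?_⟩
  rw [integral_const_mul, integral_integral_swap hint]
  congr 1
  refine integral_congr_ae (Filter.Eventually.of_forall fun p => ?_)
  beta_reduce
  by_cases hp : p ∈ orderedTimes
  · simp only [Set.indicator_of_mem hp]
    rw [potKernel, ← integral_const_mul]
    refine integral_congr_ae (Filter.Eventually.of_forall fun ξ => ?_)
    simp only [timeIntegrand]
    push_cast
    ring
  · simp only [Set.indicator_of_notMem hp, mul_zero, integral_zero]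

end Representation

/-- Only the trajectory on `[0, t]` matters. -/
lemma factorD_congr {θ ε t : ℝ} {X X' P A A' : ℝ → E5} (ht : 0 ≤ t)
    (hX : ∀ s ∈ Set.Icc 0 t, X s = X' s) (hA : ∀ s ∈ Set.Icc 0 t, A s = A' s) (ξ : E5) :
    factorD θ X P A ε t ξ = factorD θ X' P A' ε t ξ := by
  have h0 := hX 0 (Set.left_mem_Icc.2 ht)
  have h1 := hX t (Set.right_mem_Icc.2 ht)
  unfold factorD
  rw [h0, h1]
  congr 2
  refine intervalIntegral.integral_congr fun s hs => ?_
  rw [Set.uIcc_of_le ht] at hs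
  refine intervalIntegral.integral_congr fun τ hτ => ?_
  rw [Set.uIcc_of_le hs.1] at hτ
  simp only [hA s hs, hX τ ⟨hτ.1, hτ.2.trans hs.2⟩]

lemma integrandR3_eq (W : E5 → ℝ) (X P A : ℝ → E5) (ε t : ℝ) (j : Fin 5) (ξ : E5) :
    integrandR3 W X P A ε t j ξ =
      ((potWeight W ξ * inner ℝ (EuclideanSpace.single j 1 : E5) ξ : ℝ) : ℂ) *
          factorD (-1) X P A ε t ξ -
        ((potWeight W ξ * inner ℝ (EuclideanSpace.single j 1 : E5) ξ : ℝ) : ℂ) *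
          factorD 1 X P A ε t ξ := by
  have hb : ((bracket ‖ξ‖ : ℝ) : ℂ) ≠ 0 := by exact_mod_cast (bracket_pos ‖ξ‖).ne'
  have hsq : (starRingEnd ℂ) (paperFourier W ξ) * paperFourier W ξ =
      ((‖paperFourier W ξ‖ ^ 2 : ℝ) : ℂ) := by
    rw [mul_comm, Complex.mul_conj, Complex.normSq_eq_norm_sq]
  have hin : (inner ℝ (EuclideanSpace.single j 1 : E5) ξ : ℝ) = ξ j := by
    simp [EuclideanSpace.inner_single_left]
  rw [hin, integrandR3, potWeight]
  change _ * (paperFourier W ξ * (‖ξ‖ : ℂ) / (Complex.I * ((bracket ‖ξ‖ : ℝ) : ℂ)) * _ -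
    paperFourier W ξ * (‖ξ‖ : ℂ) / (Complex.I * ((bracket ‖ξ‖ : ℝ) : ℂ)) * _) = _
  rw [map_mul, map_mul, Complex.conj_I, Complex.conj_ofReal, Complex.ofReal_mul,
    Complex.ofReal_mul, ← hsq, Complex.ofReal_div]
  field_simp
  ring

/-- The decay of one of the two parts of a component of the remainder. -/
lemma exists_norm_integral_factorD_le {n M : ℝ} (hn : 1 / 4 < n) (hM : 0 < M) :
    ∃ C, 0 ≤ C ∧ ∀ V W, IsPotential n V W → ∀ (T : ℝ) (X P A : ℝ → E5), IsTrajectory T X P A →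
      Bootstrap n M T P A → ∀ ε, 0 < ε → ∀ t ∈ Set.Icc 0 T, ∀ θ : ℝ, θ = 1 ∨ θ = -1 → ∀ a : E5,
      Integrable (fun ξ => ((potWeight W ξ * inner ℝ a ξ : ℝ) : ℂ) * factorD θ X P A ε t ξ)
        volume ∧
      ‖∫ ξ, ((potWeight W ξ * inner ℝ a ξ : ℝ) : ℂ) * factorD θ X P A ε t ξ‖ ≤
        C * (potentialNorm n V W).toReal ^ 2 * ‖a‖ * (1 + t) ^ (-(1 + decayExp n)) := by
  obtain ⟨C, hC0, hC⟩ := exists_norm_potKernel_le hn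
  obtain ⟨D, hD0, hD⟩ := exists_sonicRate_le_timeRate hn hM
  have hα0 := decayExp_pos hn
  set α := decayExp n with hα
  refine ⟨C * M ^ (3 + 2 * n) * D * (2 ^ (3 + α) / α), by positivity,
    fun V W hVW T X P A hX hb ε hε t ht θ hθ a => ?_⟩
  have hT : 0 ≤ T := ht.1.trans ht.2
  -- The curve and its acceleration are extended by constants outside `[0, T]`, which gives global
  -- continuity and a global bound on the acceleration without changing the factor at time `t`.
  set X' : ℝ → E5 := Set.IccExtend hT ((Set.Icc 0 T).domRestrict X) with hX'
  set A' : ℝ → E5 := Set.IccExtend hT ((Set.Icc 0 T).domRestrict A) with hA'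
  have hXeq : ∀ s ∈ Set.Icc 0 T, X s = X' s := fun s hs =>
    (Set.IccExtend_of_mem hT ((Set.Icc 0 T).domRestrict X) hs).symm
  have hAeq : ∀ s ∈ Set.Icc 0 T, A s = A' s := fun s hs =>
    (Set.IccExtend_of_mem hT ((Set.Icc 0 T).domRestrict A) hs).symm
  have hXc : Continuous X' := Continuous.Icc_extend' (continuousOn_iff_continuous_domRestrict.1
    fun s hs => (hX.deriv_position s hs).continuousWithinAt)
  have hAc : Continuous A' := Continuous.Icc_extend'
    (continuousOn_iff_continuous_domRestrict.1 hX.continuous_acceleration)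
  have hAle : ∀ s ∈ Set.Icc 0 T, ‖A s‖ ≤ M ^ (3 + 2 * n) * (1 + s) ^ (-(1 + α)) := fun s hs => by
    have h0 : 0 < 1 + s := by linarith [hs.1]
    rw [Real.rpow_neg h0.le, ← div_eq_mul_inv, le_div_iff₀ (by positivity), mul_comm]
    exact hb.acceleration s hs
  have hAb : ∀ s, ‖A' s‖ ≤ M ^ (3 + 2 * n) := fun s => by
    have hs := (Set.projIcc 0 T hT s).2
    refine (hAle _ hs).trans (mul_le_of_le_one_right (by positivity) ?_)
    exact Real.rpow_le_one_of_one_le_of_nonpos (by linarith [hs.1]) (by linarith)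
  have hsub : Set.Icc 0 t ⊆ Set.Icc 0 T := Set.Icc_subset_Icc le_rfl ht.2
  simp only [factorD_congr ht.1 (fun s hs => hXeq s (hsub hs)) (fun s hs => hAeq s (hsub hs))]
  obtain ⟨h1, h2⟩ := integral_potWeight_mul_factorD (θ := θ) (P := P) hVW.1.2.1
    (integrable_potWeight hn hVW) hXc hAc hAb hε ht.1 a
  refine ⟨h1, ?_⟩
  set w := (potentialNorm n V W).toReal
  rw [h2, norm_mul, norm_neg, Complex.norm_I, one_mul]
  refine (norm_integral_timeMeasure_le hα0 ht.1
    (D := C * w ^ 2 * (‖a‖ * (M ^ (3 + 2 * n) * D))) (by positivity)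
    (fun p hs hτ hu hp => ?_)).trans (le_of_eq (by ring))
  have hsT := hsub (Set.Ioc_subset_Icc_self hs)
  have hτT := hsub (Set.Ioc_subset_Icc_self hτ)
  obtain ⟨δ, hδ0, hδ1, hδ2⟩ := hD T X P A hX hb p.1.2 t p.2 hτ.1.le hτ.2 ht.2 hu
  rw [hXeq t ht, hXeq _ hτT] at hδ1
  have hL : 0 < t + p.2 - p.1.2 := by linarith [hτ.2]
  have hK := hC V W hVW θ hθ _ δ hL hδ0 a (A' p.1.1) _ hδ1
  have hA1 := hAle _ hsT
  rw [hAeq _ hsT] at hA1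
  have h0s : 0 < 1 + p.1.1 := by linarith [hs.1]
  have hS := sonicRate_nonneg (n := n) hL.le hδ0
  -- The damping is discarded, so the constant does not depend on `ε`.
  have hexp : ‖(Real.exp (-(ε * p.2)) : ℂ)‖ ≤ 1 := by
    rw [Complex.norm_real, Real.norm_of_nonneg (Real.exp_pos _).le, Real.exp_le_one_iff]
    have : 0 ≤ ε * p.2 := by positivity
    linarith
  rw [norm_mul]
  calc _ ≤ 1 * (C * w ^ 2 * (‖a‖ * ‖A' p.1.1‖ * sonicRate n (t + p.2 - p.1.2) δ)) :=
        mul_le_mul hexp hK (norm_nonneg _) zero_le_one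
    _ ≤ 1 * (C * w ^ 2 * (‖a‖ * (M ^ (3 + 2 * n) * (1 + p.1.1) ^ (-(1 + α))) *
          (D * timeRate α t p.1.2 p.2))) := by gcongr
    _ = _ := by ring

end BoseGas

/-! ### The bound for the remainder vector -/

theorem lemma3p5 (n : ℝ) (hn : 1 / 4 < n) (M : ℝ) (hM : 0 < M) :
    ∃ C : ℝ, 0 < C ∧
      ∀ (ρ₀ : ℝ), 0 < ρ₀ →
      ∀ (V W : BoseGas.E5 → ℝ), BoseGas.IsPotential n V W →
      ∀ (T : ℝ) (X P A : ℝ → BoseGas.E5), BoseGas.IsTrajectory T X P A →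
        BoseGas.Bootstrap n M T P A →
      ∀ (ε : ℝ), 0 < ε →
      ∀ t ∈ Set.Icc 0 T,
        (∀ j : Fin 5, MeasureTheory.Integrable (BoseGas.integrandR3 W X P A ε t j)
          MeasureTheory.volume) ∧
        ‖BoseGas.R3 ρ₀ W X P A ε t‖ ≤
          ρ₀ * (C * (BoseGas.potentialNorm n V W).toReal ^ 2) /
            (1 + t) ^ (1 + BoseGas.decayExp n) := by
  obtain ⟨C, hC0, hC⟩ := BoseGas.exists_norm_integral_factorD_le hn hM
  -- Five components contribute `C` each, the two signs of the phase being offset by the prefactor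
  -- `1/2`; the added `1` ensures strict positivity when `C = 0`.
  refine ⟨5 * C + 1, by positivity, fun ρ₀ hρ V W hVW T X P A hX hb ε hε t ht => ?_⟩
  have hplus := fun j : Fin 5 => hC V W hVW T X P A hX hb ε hε t ht 1 (Or.inl rfl)
    (EuclideanSpace.single j 1)
  have hminus := fun j : Fin 5 => hC V W hVW T X P A hX hb ε hε t ht (-1) (Or.inr rfl)
    (EuclideanSpace.single j 1)
  have heq : ∀ j, BoseGas.integrandR3 W X P A ε t j = _ := fun j =>
    funext (BoseGas.integrandR3_eq W X P A ε t j)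
  have h1t : 0 < 1 + t := by linarith [ht.1]
  set w := (BoseGas.potentialNorm n V W).toReal
  set r := (1 + t) ^ (-(1 + BoseGas.decayExp n)) with hr
  have hr0 : 0 ≤ r := by positivity
  have hcomp : ∀ j, ‖∫ ξ, BoseGas.integrandR3 W X P A ε t j ξ‖ ≤ 2 * (C * w ^ 2 * r) := fun j => by
    rw [heq, integral_sub (hminus j).1 (hplus j).1]
    refine (norm_sub_le _ _).trans ?_
    have h1 := (hplus j).2
    have h2 := (hminus j).2
    simp only [PiLp.norm_single, norm_one, mul_one] at h1 h2
    linarith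
  refine ⟨fun j => ?_, ?_⟩
  · rw [heq]
    exact (hminus j).1.sub (hplus j).1
  · have hpi : ρ₀ / (2 * (2 * Real.pi) ^ 5) ≤ ρ₀ / 2 := by
      refine div_le_div_of_nonneg_left hρ.le (by norm_num) ?_
      have : (1 : ℝ) ≤ (2 * Real.pi) ^ 5 := one_le_pow₀ (by linarith [Real.pi_gt_three])
      linarith
    have hj : ∀ j, ‖BoseGas.R3 ρ₀ W X P A ε t j‖ ≤ ρ₀ * (C * w ^ 2 * r) := fun j => by
      change ‖-(ρ₀ / (2 * (2 * Real.pi) ^ 5)) * (∫ ξ, BoseGas.integrandR3 W X P A ε t j ξ).re‖ ≤ _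
      rw [norm_mul, norm_neg, Real.norm_of_nonneg (by positivity)]
      have h1 := (Complex.abs_re_le_norm _).trans (hcomp j)
      calc _ ≤ ρ₀ / 2 * (2 * (C * w ^ 2 * r)) :=
            mul_le_mul hpi h1 (abs_nonneg _) (by positivity)
        _ = _ := by ring
    have hsum : ‖BoseGas.R3 ρ₀ W X P A ε t‖ ≤ ∑ j, ‖BoseGas.R3 ρ₀ W X P A ε t j‖ := by
      rw [EuclideanSpace.norm_eq]
      refine Real.sqrt_le_iff.2 ⟨by positivity, ?_⟩
      exact Finset.sum_sq_le_sq_sum_of_nonneg fun _ _ => norm_nonneg _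
    have h5 : ∑ j, ‖BoseGas.R3 ρ₀ W X P A ε t j‖ ≤ 5 * (ρ₀ * (C * w ^ 2 * r)) := by
      refine (Finset.sum_le_sum fun j _ => hj j).trans (le_of_eq ?_)
      simp
    refine hsum.trans (h5.trans ?_)
    rw [div_eq_mul_inv, ← Real.rpow_neg h1t.le, ← hr]
    have h6 : 0 ≤ ρ₀ * w ^ 2 * r := by positivity
    nlinarith
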